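/- Fix $s\in\mathbb N=\{0,1,2,\dots\}$ and put $p=2s+1$. Conventions. An LR mesh for a bidegree $\mathbf q=(q_1,q_2)$ on a rectangle $\Omega=[a_1,b_1]\times[a_2,b_2]$, together with its collection of LR B-splines of bidegree $\mathbf q$, is defined recursively. The start is an open tensor-product mesh on $\Omega$ (boundary meshlines in direction $k$ have multiplicity $q_k+1$, internal ones a multiplicity between $1$ and $q_k+1$), with its tensor-product B-splines. Each step inserts an axis-parallel meshline segment in $\Omega$ whose end points lie on orthogonal meshlines. Either the segment is new (possibly prolonging or joining existing meshlines) and the resulting line traverses the support of at least one current LR B-spline that it did not traverse before, or the step increases the multiplicity of an existing meshline; multiplicities never exceed $q_k+1$. After each step, every B-spline whose support is traversed by a meshline of multiplicity larger than its multiplicity in the local knot vector is replaced by the two B-splines obtained from knot insertion, repeatedly, until all B-splines have minimal support. A cell is a closed rectangle whose sides lie on meshlines and whose interior meets no meshline. The LR B-splines are locally linearly independent if, for every open $U\subseteq\Omega$, those that do not vanish identically on $U$ are linearly independent on $U$. For $r\in\mathbb N$, a mesh is admissible for RM B-splines of degree $(2r+1,2r+1)$ if it is an LR mesh for this bidegree,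 every internal meshline has multiplicity $r+1$, every boundary meshline has multiplicity $2r+2$, and the LR B-splines of this bidegree on it are locally linearly independent. Proposition. Let $\mathcal M$ be a mesh that is admissible for RM B-splines of degree $(1,1)$, and let $\mathcal M'$ be obtained from $\mathcal M$ by increasing the multiplicity of every internal meshline by $s$ and that of every boundary meshline by $2s$. Then $\mathcal M'$ is admissible for RM B-splines of degree $(p,p)$; in particular it is an LR mesh for bidegree $(p,p)$, and the LR B-splines of bidegree $(p,p)$ on it are locally linearly independent. Moreover, every cell of $\mathcal M'$ is contained in the supports of exactly $4(s+1)^2=(p+1)^2$ of these LR B-splines. -/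

import Mathlib

noncomputable section

open Classical

namespace LR

/-- The B-spline of degree `p` on the knots `t 0 ≤ t 1 ≤ ⋯ ≤ t (p + 1)`, by the Cox–de Boor
recursion; a term whose knot difference vanishes is zero, which is what division by zero gives. -/
def bspline : ℕ → (ℕ → ℝ) → ℝ → ℝ
  | 0, t, x => if t 0 ≤ x ∧ x < t 1 then 1 else 0
  | p + 1, t, x =>
      (x - t 0) / (t (p + 1) - t 0) * bspline p t x
        + (t (p + 2) - x) / (t (p + 2) - t 1) * bspline p (fun i => t (i + 1)) x

/-- A bivariate tensor-product B-spline, given by its two local knot vectors (increasing lists;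
in bidegree `p` the list in direction `k` has `p k + 2` entries).
Direction `0` is the first coordinate (vertical meshlines), direction `1` the second one
(horizontal meshlines); `k.rev` is the direction other than `k`. -/
@[ext] structure TBSpline where
  knots : Fin 2 → List ℝ

namespace TBSpline

/-- First local knot in direction `k`. -/
def first (B : TBSpline) (k : Fin 2) : ℝ := (B.knots k).headD 0

/-- Last local knot in direction `k`. -/
def last (B : TBSpline) (k : Fin 2) : ℝ := (B.knots k).getLastD 0

/-- The support: the closed rectangle enclosed by the local tensor mesh. -/
def supp (B : TBSpline) : Set (Fin 2 → ℝ) := Set.Icc B.first B.last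

/-- The function of bidegree `p` defined by the local knot vectors. -/
def eval (p : Fin 2 → ℕ) (B : TBSpline) (x : Fin 2 → ℝ) : ℝ :=
  ∏ k, bspline (p k) (fun i => (B.knots k).getD i 0) (x k)

/-- After inserting the knot `t` in direction `k`: the B-spline on all but the last knot. -/
def leftChild (B : TBSpline) (k : Fin 2) (t : ℝ) : TBSpline :=
  ⟨Function.update B.knots k ((B.knots k).orderedInsert (· ≤ ·) t).dropLast⟩

/-- After inserting the knot `t` in direction `k`: the B-spline on all but the first knot. -/
def rightChild (B : TBSpline) (k : Fin 2) (t : ℝ) : TBSpline :=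
  ⟨Function.update B.knots k ((B.knots k).orderedInsert (· ≤ ·) t).tail⟩

end TBSpline

/-- A mesh with multiplicities on the rectangle `[lo 0, hi 0] × [lo 1, hi 1]`.
`mult k t u` is the multiplicity of the meshline contained in `{x | x k = t}` at the point whose
other coordinate is `u`; it is `0` when no meshline orthogonal to direction `k` passes there. -/
@[ext] structure Mesh where
  lo : Fin 2 → ℝ
  hi : Fin 2 → ℝ
  mult : Fin 2 → ℝ → ℝ → ℕ

/-- `B` fails to have minimal support on `M` because of the value `t` in direction `k`:
`M` contains a meshline `{x k = t}` that passes through the interior of the support of `B`, from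
side to side, with a multiplicity larger than the local one. -/
def Skips (M : Mesh) (B : TBSpline) (k : Fin 2) (t : ℝ) : Prop :=
  B.first k < t ∧ t < B.last k ∧
    ∀ u ∈ Set.Icc (B.first k.rev) (B.last k.rev), (B.knots k).count t < M.mult k t u

/-- The minimal support property: no meshline of `M` is skipped. -/
def MinimalSupport (M : Mesh) (B : TBSpline) : Prop :=
  ∀ k t, ¬ Skips M B k t

/-- One application of the knot insertion procedure: a B-spline without minimal support is
replaced by the two B-splines obtained by inserting a skipped knot. -/
def Replace (M : Mesh) (S S' : Set TBSpline) : Prop :=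
  ∃ B ∈ S, ∃ k t, Skips M B k t ∧ S' = (S \ {B}) ∪ {B.leftChild k t, B.rightChild k t}

/-- `S'` is obtained from `S` by knot insertions until all members have minimal support. -/
def Refines (M : Mesh) (S S' : Set TBSpline) : Prop :=
  Relation.ReflTransGen (Replace M) S S' ∧ ∀ B ∈ S', MinimalSupport M B

/-- `l` is an open knot vector of degree `p` on `[a, b]`: end knots of multiplicity `p + 1`, and
no knot of larger multiplicity. -/
structure IsOpenKnotVector (p : ℕ) (a b : ℝ) (l : List ℝ) : Prop where
  lt : a < b
  sorted : l.Pairwise (· ≤ ·)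
  mem_Icc : ∀ t ∈ l, t ∈ Set.Icc a b
  count_left : l.count a = p + 1
  count_right : l.count b = p + 1
  count_le : ∀ t, l.count t ≤ p + 1

/-- The tensor-product mesh of two global knot vectors. -/
def tensorMesh (lo hi : Fin 2 → ℝ) (X : Fin 2 → List ℝ) : Mesh where
  lo := lo
  hi := hi
  mult k t u := if u ∈ Set.Icc (lo k.rev) (hi k.rev) then (X k).count t else 0

/-- The tensor-product B-splines of bidegree `p`: in each direction, the local knot vector
consists of `p k + 2` consecutive entries of the global one. -/
def tensorSplines (p : Fin 2 → ℕ) (X : Fin 2 → List ℝ) : Set TBSpline :=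
  {B | ∀ k, B.knots k <:+: X k ∧ (B.knots k).length = p k + 2}

/-- A meshline `{x | x dir = pos, x dir.rev ∈ [beg, fin]}` of multiplicity `mul`. -/
structure Meshline where
  dir : Fin 2
  pos : ℝ
  beg : ℝ
  fin : ℝ
  mul : ℕ

/-- The mesh `M` with the meshline `g` added: along `g` the multiplicity becomes `g.mul`, unless
it was already larger. This covers new lines, prolongations of existing ones, and increases of
multiplicity. -/
def Mesh.insert (M : Mesh) (g : Meshline) : Mesh where
  lo := M.lo
  hi := M.hi
  mult k t u :=
    if k = g.dir ∧ t = g.pos ∧ u ∈ Set.Icc g.beg g.fin then max (M.mult k t u) g.mul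
    else M.mult k t u

/-- The line `{x k = t}` of `M` crosses the support of `B` through its interior, from side to
side. -/
def Traverses (M : Mesh) (k : Fin 2) (t : ℝ) (B : TBSpline) : Prop :=
  B.first k < t ∧ t < B.last k ∧ ∀ u ∈ Set.Icc (B.first k.rev) (B.last k.rev), 0 < M.mult k t u

/-- `g` may be inserted in the mesh `M` with LR B-splines `S` of bidegree `p`: it is a segment
inside the domain, its end points lie on orthogonal meshlines (so that the cells remain
rectangles), its multiplicity is admissible, and either its insertion creates a meshline
traversing the support of at least one LR B-spline that was not traversed before, or it lies on
an existing meshline, whose multiplicity is increased. -/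
structure CanInsert (p : Fin 2 → ℕ) (M : Mesh) (S : Set TBSpline) (g : Meshline) : Prop where
  lo_lt : M.lo g.dir < g.pos
  lt_hi : g.pos < M.hi g.dir
  lo_le : M.lo g.dir.rev ≤ g.beg
  beg_lt : g.beg < g.fin
  le_hi : g.fin ≤ M.hi g.dir.rev
  beg_mem : 0 < M.mult g.dir.rev g.beg g.pos
  fin_mem : 0 < M.mult g.dir.rev g.fin g.pos
  one_le : 1 ≤ g.mul
  mul_le : g.mul ≤ p g.dir + 1
  new_or_old :
    (∃ B ∈ S, Traverses (M.insert g) g.dir g.pos B ∧ ¬ Traverses M g.dir g.pos B) ∨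
      (∀ u ∈ Set.Icc g.beg g.fin, 0 < M.mult g.dir g.pos u)

/-- `IsLR p M S`: `M` is an LR mesh for the bidegree `p`, and `S` is the collection of LR
B-splines of bidegree `p` on `M`. -/
inductive IsLR (p : Fin 2 → ℕ) : Mesh → Set TBSpline → Prop
  | tensor (lo hi : Fin 2 → ℝ) (X : Fin 2 → List ℝ)
      (hX : ∀ k, IsOpenKnotVector (p k) (lo k) (hi k) (X k)) :
      IsLR p (tensorMesh lo hi X) (tensorSplines p X)
  | insert (M : Mesh) (S S' : Set TBSpline) (g : Meshline)
      (hM : IsLR p M S) (hg : CanInsert p M S g) (hS : Refines (M.insert g) S S') :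
      IsLR p (M.insert g) S'

/-- Local linear independence on the domain of `M`: on every open subset `U` of the domain, the
members of `S` that do not vanish identically on `U` are linearly independent on `U`. -/
def LocallyLinearIndependent (p : Fin 2 → ℕ) (M : Mesh) (S : Set TBSpline) : Prop :=
  ∀ U : Set (Fin 2 → ℝ), IsOpen U → U ⊆ Set.Icc M.lo M.hi →
    LinearIndependent ℝ
      (fun (B : {B : TBSpline // B ∈ S ∧ ∃ x ∈ U, B.eval p x ≠ 0}) (x : U) => B.1.eval p x)

/-- `M` is admissible for RM B-splines of degree `(2 * s + 1, 2 * s + 1)`: it is an LR mesh for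
this degree, internal meshlines have multiplicity `s + 1` and boundary meshlines multiplicity
`2 * s + 2`, and the LR B-splines on `M` are locally linearly independent. -/
structure Admissible (s : ℕ) (M : Mesh) : Prop where
  isLR : ∃ S, IsLR (fun _ => 2 * s + 1) M S
  internal : ∀ k t u, M.lo k < t → t < M.hi k → M.mult k t u ≠ 0 → M.mult k t u = s + 1
  boundary : ∀ k t u, (t = M.lo k ∨ t = M.hi k) → u ∈ Set.Icc (M.lo k.rev) (M.hi k.rev) →
    M.mult k t u = 2 * s + 2
  locallyLinearIndependent : ∀ S, IsLR (fun _ => 2 * s + 1) M S →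
    LocallyLinearIndependent (fun _ => 2 * s + 1) M S

/-- The mesh `M` with the multiplicities of the boundary meshlines increased by `2 * s` and those
of the internal meshlines increased by `s`. -/
def Mesh.raise (M : Mesh) (s : ℕ) : Mesh where
  lo := M.lo
  hi := M.hi
  mult k t u :=
    if M.mult k t u = 0 then 0
    else if t = M.lo k ∨ t = M.hi k then M.mult k t u + 2 * s
    else M.mult k t u + s

/-- The closed rectangle with corners `c`, `d` is a cell of `M`: its sides lie on meshlines, and
no meshline meets its interior. -/
structure IsCell (M : Mesh) (c d : Fin 2 → ℝ) : Prop where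
  lo_le : ∀ k, M.lo k ≤ c k
  lt : ∀ k, c k < d k
  le_hi : ∀ k, d k ≤ M.hi k
  side_left : ∀ k, ∀ u ∈ Set.Icc (c k.rev) (d k.rev), 0 < M.mult k (c k) u
  side_right : ∀ k, ∀ u ∈ Set.Icc (c k.rev) (d k.rev), 0 < M.mult k (d k) u
  inside : ∀ k, ∀ t ∈ Set.Ioo (c k) (d k), ∀ u ∈ Set.Ioo (c k.rev) (d k.rev), M.mult k t u = 0

end LR

end

noncomputable section

open Classical

namespace LR

-- A degree-one LR B-spline `B` has three knots per direction. If each of them is repeated `s + 1`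
-- times, the windows of `2 * s + 3` consecutive entries are the local knot vectors of at most `(s +
-- 1) ^ 2` B-splines of degree `p = 2 * s + 1`, the set `raised s B`. A window omits only `s` of the
-- `3 * s + 3` entries, fewer than one block. So each member has the support of `B`, and a knot
-- strictly inside that support has `s + 1` times its multiplicity in `B`.
--
-- The main point is that the LR B-splines on the raised mesh are exactly the union of these sets
-- over the LR B-splines of degree one (`IsLR.eq_iUnion_raised`). Knot insertion is confluent
-- (`isDescendant_child_of_skips`). Hence the collection on an LR mesh depends only on the mesh: it
-- consists of the minimal-support descendants of the Bernstein B-splines on the whole domain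
-- (`IsLR.eq_descendants`). Inserting a knot into `B` corresponds to inserting it `s + 1` times into
-- `raised s B` (`descendants_raised_of_skips`), so the union has the same descendants on the raised
-- mesh as the Bernstein B-splines of degree `p`. It also has minimal support there, hence equals
-- its own descendants. As supports are preserved, each step in the construction of the original
-- mesh is legitimate for the raised one, and termination of knot insertion supplies the new
-- collection (`IsLR.exists_raise`).
--
-- The rest is a dimension count on a rectangle free of meshlines. A support either covers the
-- rectangle or misses its interior, and the covering B-splines are nonzero polynomials there. Local
-- linear independence in degree one allows at most `4` of them
-- (`LocallyLinearIndependent.ncard_covers_le`), hence at most `4 * (s + 1) ^ 2 = (p + 1) ^ 2` on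
-- the raised mesh. Conversely, the Bernstein B-splines span all polynomials of bidegree `(p, p)`
-- and are combinations of their descendants, so the covering LR B-splines span a space of dimension
-- at least `(p + 1) ^ 2`. Equality holds and they are independent (`IsLR.linearIndepOn_covers`).
-- This gives the count on cells and, through small rectangles inside an open set, local linear
-- independence.

local notation "ins" => List.orderedInsert (fun a b : ℝ => a ≤ b)

/-! ### Sorted lists and insertion of one knot -/

theorem sorted_ins {L : List ℝ} (h : L.Pairwise (· ≤ ·)) (t : ℝ) :
    (ins t L).Pairwise (· ≤ ·) := h.orderedInsert t L

theorem eq_of_perm_of_sorted {L L' : List ℝ} (h : L.Perm L') (h₁ : L.Pairwise (· ≤ ·))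
    (h₂ : L'.Pairwise (· ≤ ·)) : L = L' :=
  h.eq_of_sortedLE h₁.sortedLE h₂.sortedLE

theorem ins_comm {L : List ℝ} (h : L.Pairwise (· ≤ ·)) (t u : ℝ) :
    ins t (ins u L) = ins u (ins t L) := by
  refine eq_of_perm_of_sorted ?_ (sorted_ins (sorted_ins h u) t) (sorted_ins (sorted_ins h t) u)
  refine (List.perm_orderedInsert _ _ _).trans ?_
  refine ((List.perm_orderedInsert _ _ _).cons t).trans ?_
  refine (List.Perm.swap _ _ _).trans ?_
  refine ((List.perm_orderedInsert (fun a b : ℝ => a ≤ b) t L).symm.cons u).trans ?_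
  exact (List.perm_orderedInsert _ _ _).symm

theorem ins_cons_of_lt {a t : ℝ} (L : List ℝ) (h : a < t) : ins t (a :: L) = a :: ins t L :=
  List.orderedInsert_of_not_le _ L (not_le.mpr h)

theorem ins_concat_of_le {t m : ℝ} (h : t ≤ m) (L : List ℝ) :
    ins t (L ++ [m]) = ins t L ++ [m] := by
  induction L with
  | nil => simp [h]
  | cons b L ih =>
    by_cases hb : t ≤ b
    · simp [hb]
    · simp [hb, ih]

theorem ins_ne_nil (t : ℝ) (L : List ℝ) : ins t L ≠ [] := by
  intro h
  have := List.orderedInsert_length (fun a b : ℝ => a ≤ b) L t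
  simp [h] at this

theorem ins_eq_concat {N : List ℝ} {t : ℝ} (hN : N.Pairwise (· ≤ ·)) (h : ∀ a ∈ N, a ≤ t) :
    ins t N = N ++ [t] := by
  refine eq_of_perm_of_sorted ?_ (sorted_ins hN t) ?_
  · exact (List.perm_orderedInsert _ _ _).trans (List.perm_append_singleton t N).symm
  · simpa [List.pairwise_append, hN] using h

theorem ins_eq_cons {N : List ℝ} {t : ℝ} (hN : N.Pairwise (· ≤ ·)) (h : ∀ a ∈ N, t ≤ a) :
    ins t N = t :: N := by
  refine eq_of_perm_of_sorted (List.perm_orderedInsert _ _ _) (sorted_ins hN t) ?_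
  simpa [hN] using h

theorem count_ins (t u : ℝ) (L : List ℝ) :
    (ins t L).count u = L.count u + if t = u then 1 else 0 := by
  rw [(List.perm_orderedInsert _ t L).count_eq, List.count_cons]
  simp

theorem exists_eq_cons_concat {L : List ℝ} (h : 2 ≤ L.length) :
    ∃ a mid m, L = a :: (mid ++ [m]) := by
  match L, h with
  | a :: b :: L', _ =>
    refine ⟨a, (b :: L').dropLast, (b :: L').getLast (by simp), ?_⟩
    rw [List.dropLast_append_getLast]

theorem le_getLastD {L : List ℝ} (h : L.Pairwise (· ≤ ·)) {a : ℝ} (ha : a ∈ L) :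
    a ≤ L.getLastD 0 := by
  rcases List.eq_nil_or_concat L with rfl | ⟨L', b, rfl⟩
  · simp at ha
  · simp only [List.concat_eq_append, List.pairwise_append, List.mem_append,
      List.getLastD_concat] at h ha ⊢
    rcases ha with ha | ha
    · exact h.2.2 a ha b (by simp)
    · simp at ha; exact ha.le

theorem headD_le {L : List ℝ} (h : L.Pairwise (· ≤ ·)) {a : ℝ} (ha : a ∈ L) :
    L.headD 0 ≤ a := by
  cases L with
  | nil => simp at ha
  | cons b L =>
    simp only [List.pairwise_cons, List.mem_cons, List.headD_cons] at h ha ⊢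
    rcases ha with rfl | ha
    · exact le_rfl
    · exact h.1 a ha

theorem headD_mem {L : List ℝ} (h : L ≠ []) : L.headD 0 ∈ L := by
  cases L with
  | nil => simp at h
  | cons b L => simp

theorem getLastD_mem {L : List ℝ} (h : L ≠ []) : L.getLastD 0 ∈ L := by
  rcases List.eq_nil_or_concat L with rfl | ⟨L', b, rfl⟩
  · simp at h
  · simp

theorem getLastD_cons_concat (a m : ℝ) (mid : List ℝ) :
    (a :: (mid ++ [m])).getLastD 0 = m := by
  rw [← List.cons_append, List.getLastD_concat]

theorem dropLast_ins {a t m : ℝ} (mid : List ℝ) (h₁ : a < t) (h₂ : t ≤ m) :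
    (ins t (a :: (mid ++ [m]))).dropLast = a :: ins t mid := by
  rw [ins_cons_of_lt _ h₁, ins_concat_of_le h₂, ← List.cons_append, List.dropLast_concat]

theorem tail_ins {a t m : ℝ} (mid : List ℝ) (h₁ : a < t) (h₂ : t ≤ m) :
    (ins t (a :: (mid ++ [m]))).tail = ins t mid ++ [m] := by
  rw [ins_cons_of_lt _ h₁, ins_concat_of_le h₂, List.tail_cons]

/-! ### Local knot vectors of bivariate B-splines -/

namespace TBSpline

/-- Replace the local knot vector in direction `k`. -/
def setKnots (B : TBSpline) (k : Fin 2) (L : List ℝ) : TBSpline :=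
  ⟨Function.update B.knots k L⟩

theorem leftChild_eq (B : TBSpline) (k : Fin 2) (t : ℝ) :
    B.leftChild k t = B.setKnots k (ins t (B.knots k)).dropLast := rfl

theorem rightChild_eq (B : TBSpline) (k : Fin 2) (t : ℝ) :
    B.rightChild k t = B.setKnots k (ins t (B.knots k)).tail := rfl

@[simp] theorem knots_setKnots_self (B : TBSpline) (k : Fin 2) (L : List ℝ) :
    (B.setKnots k L).knots k = L := by simp [setKnots]

theorem knots_setKnots_of_ne (B : TBSpline) {k j : Fin 2} (h : j ≠ k) (L : List ℝ) :
    (B.setKnots k L).knots j = B.knots j := by simp [setKnots, h]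

theorem rev_ne (k : Fin 2) : k.rev ≠ k := by fin_cases k <;> simp

theorem eq_rev_of_ne {j k : Fin 2} (h : j ≠ k) : j = k.rev := by
  fin_cases k <;> fin_cases j <;> simp_all

@[simp] theorem knots_setKnots_rev (B : TBSpline) (k : Fin 2) (L : List ℝ) :
    (B.setKnots k L).knots k.rev = B.knots k.rev := knots_setKnots_of_ne B (rev_ne k) L

@[simp] theorem setKnots_setKnots (B : TBSpline) (k : Fin 2) (L L' : List ℝ) :
    (B.setKnots k L).setKnots k L' = B.setKnots k L' := by simp [setKnots]

theorem setKnots_comm (B : TBSpline) {j k : Fin 2} (h : j ≠ k) (L L' : List ℝ) :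
    (B.setKnots j L).setKnots k L' = (B.setKnots k L').setKnots j L := by
  simp [setKnots, Function.update_comm h]

@[simp] theorem setKnots_knots (B : TBSpline) (k : Fin 2) : B.setKnots k (B.knots k) = B := by
  simp [setKnots]

theorem ext_knots {B C : TBSpline} (k : Fin 2) (h₁ : B.knots k = C.knots k)
    (h₂ : B.knots k.rev = C.knots k.rev) : B = C := by
  ext1
  funext j
  by_cases h : j = k
  · rw [h, h₁]
  · rw [eq_rev_of_ne h, h₂]

/-- All local knot vectors are sorted and have the right number of entries. -/
def IsKnotted (p : Fin 2 → ℕ) (B : TBSpline) : Prop :=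
  ∀ k, (B.knots k).Pairwise (· ≤ ·) ∧ (B.knots k).length = p k + 2

theorem IsKnotted.setKnots {p : Fin 2 → ℕ} {B : TBSpline} (hB : B.IsKnotted p) {k : Fin 2}
    {L : List ℝ} (hL : L.Pairwise (· ≤ ·)) (hl : L.length = p k + 2) :
    (B.setKnots k L).IsKnotted p := by
  intro j
  by_cases h : j = k
  · subst h; simpa using ⟨hL, hl⟩
  · rw [knots_setKnots_of_ne _ h]; exact hB j

theorem IsKnotted.leftChild {p : Fin 2 → ℕ} {B : TBSpline} (hB : B.IsKnotted p) (k : Fin 2)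
    (t : ℝ) : (B.leftChild k t).IsKnotted p :=
  hB.setKnots ((sorted_ins (hB k).1 t).sublist (List.dropLast_sublist _))
    (by simp [List.orderedInsert_length, (hB k).2])

theorem IsKnotted.rightChild {p : Fin 2 → ℕ} {B : TBSpline} (hB : B.IsKnotted p) (k : Fin 2)
    (t : ℝ) : (B.rightChild k t).IsKnotted p :=
  hB.setKnots ((sorted_ins (hB k).1 t).sublist (List.tail_sublist _))
    (by simp [List.orderedInsert_length, (hB k).2])

/-- The decomposition of a local knot vector into end knots and inner ones. -/
theorem IsKnotted.exists_decomp {p : Fin 2 → ℕ} {B : TBSpline} (hB : B.IsKnotted p) (k : Fin 2) :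
    ∃ mid, B.knots k = B.first k :: (mid ++ [B.last k]) := by
  obtain ⟨a, mid, m, h⟩ := exists_eq_cons_concat (L := B.knots k) (by rw [(hB k).2]; omega)
  refine ⟨mid, ?_⟩
  rw [first, last, h, getLastD_cons_concat, List.headD_cons]

theorem IsKnotted.first_le {p : Fin 2 → ℕ} {B : TBSpline} (hB : B.IsKnotted p) {k : Fin 2} {t : ℝ}
    (ht : t ∈ B.knots k) : B.first k ≤ t := headD_le (hB k).1 ht

theorem IsKnotted.le_last {p : Fin 2 → ℕ} {B : TBSpline} (hB : B.IsKnotted p) {k : Fin 2} {t : ℝ}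
    (ht : t ∈ B.knots k) : t ≤ B.last k := le_getLastD (hB k).1 ht

theorem IsKnotted.ne_nil {p : Fin 2 → ℕ} {B : TBSpline} (hB : B.IsKnotted p) (k : Fin 2) :
    B.knots k ≠ [] := by
  intro h
  have := (hB k).2
  simp [h] at this

theorem IsKnotted.first_mem {p : Fin 2 → ℕ} {B : TBSpline} (hB : B.IsKnotted p) (k : Fin 2) :
    B.first k ∈ B.knots k := headD_mem (hB.ne_nil k)

theorem IsKnotted.last_mem {p : Fin 2 → ℕ} {B : TBSpline} (hB : B.IsKnotted p) (k : Fin 2) :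
    B.last k ∈ B.knots k := getLastD_mem (hB.ne_nil k)

theorem IsKnotted.first_le_last {p : Fin 2 → ℕ} {B : TBSpline} (hB : B.IsKnotted p) (k : Fin 2) :
    B.first k ≤ B.last k := hB.first_le (hB.last_mem k)

theorem first_setKnots_self (B : TBSpline) (k : Fin 2) (L : List ℝ) :
    (B.setKnots k L).first k = L.headD 0 := by rw [first, knots_setKnots_self]

theorem last_setKnots_self (B : TBSpline) (k : Fin 2) (L : List ℝ) :
    (B.setKnots k L).last k = L.getLastD 0 := by rw [last, knots_setKnots_self]

theorem first_setKnots_rev (B : TBSpline) (k : Fin 2) (L : List ℝ) :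
    (B.setKnots k L).first k.rev = B.first k.rev := by rw [first, knots_setKnots_rev, first]

theorem last_setKnots_rev (B : TBSpline) (k : Fin 2) (L : List ℝ) :
    (B.setKnots k L).last k.rev = B.last k.rev := by rw [last, knots_setKnots_rev, last]

end TBSpline

/-! ### Confluence of knot insertion -/

open TBSpline

/-- One step of the knot insertion procedure, seen from a single B-spline. -/
def Child (M : Mesh) (B C : TBSpline) : Prop :=
  ∃ k t, Skips M B k t ∧ (C = B.leftChild k t ∨ C = B.rightChild k t)

/-- `C` is obtained from `B` by knot insertions and has minimal support. -/
def IsDescendant (M : Mesh) (B C : TBSpline) : Prop :=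
  Relation.ReflTransGen (Child M) B C ∧ MinimalSupport M C

/-- The B-splines with minimal support obtained from members of `A` by knot insertions. -/
def descendants (M : Mesh) (A : Set TBSpline) : Set TBSpline :=
  {C | ∃ B ∈ A, IsDescendant M B C}

theorem IsDescendant.of_child {M : Mesh} {B B' C : TBSpline} (h : Child M B B')
    (h' : IsDescendant M B' C) : IsDescendant M B C := ⟨h'.1.head h, h'.2⟩

theorem Child.isKnotted {p : Fin 2 → ℕ} {M : Mesh} {B C : TBSpline} (h : Child M B C)
    (hB : B.IsKnotted p) : C.IsKnotted p := by
  obtain ⟨k, t, -, rfl | rfl⟩ := h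
  · exact hB.leftChild k t
  · exact hB.rightChild k t

/-- How a second insertion acts on the left child of a first one. -/
theorem dropLast_ins_cons {a t : ℝ} {N : List ℝ} (h : a < t) :
    (ins t (a :: N)).dropLast = a :: (ins t N).dropLast ∧ (ins t (a :: N)).tail = ins t N := by
  rw [ins_cons_of_lt _ h]
  exact ⟨List.dropLast_cons_of_ne_nil (ins_ne_nil _ _), rfl⟩

/-- How a second insertion acts on the right child of a first one. -/
theorem tail_ins_concat {t m : ℝ} {N : List ℝ} (h : t ≤ m) :
    (ins t (N ++ [m])).dropLast = ins t N ∧ (ins t (N ++ [m])).tail = (ins t N).tail ++ [m] := by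
  rw [ins_concat_of_le h]
  exact ⟨List.dropLast_concat, List.tail_append_of_ne_nil (ins_ne_nil _ _)⟩

theorem Skips.setKnots_self {M : Mesh} {B : TBSpline} {k : Fin 2} {t : ℝ} (h : Skips M B k t)
    {L : List ℝ} (h₁ : L.headD 0 < t) (h₂ : t < L.getLastD 0)
    (h₃ : L.count t ≤ (B.knots k).count t) : Skips M (B.setKnots k L) k t := by
  refine ⟨by rwa [first_setKnots_self], by rwa [last_setKnots_self], ?_⟩
  intro u hu
  rw [first_setKnots_rev, last_setKnots_rev] at hu
  rw [knots_setKnots_self]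
  exact h₃.trans_lt (h.2.2 u hu)

/-- A smaller support in the other direction only shortens the segment along which the meshline has
to pass, so a skipped line remains skipped. -/
theorem Skips.setKnots_rev {M : Mesh} {B : TBSpline} {k : Fin 2} {t : ℝ}
    (h : Skips M B k t) {L : List ℝ} (h₁ : B.first k.rev ≤ L.headD 0)
    (h₂ : L.getLastD 0 ≤ B.last k.rev) : Skips M (B.setKnots k.rev L) k t := by
  have e : (B.setKnots k.rev L).knots k = B.knots k :=
    knots_setKnots_of_ne B (rev_ne k).symm L
  refine ⟨?_, ?_, ?_⟩
  · rw [first, e]; exact h.1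
  · rw [last, e]; exact h.2.1
  · intro u hu
    rw [first_setKnots_self, last_setKnots_self] at hu
    rw [e]
    exact h.2.2 u ⟨h₁.trans hu.1, hu.2.trans h₂⟩

theorem getLastD_cons_of_ne_nil {N : List ℝ} (a : ℝ) (hN : N ≠ []) :
    (a :: N).getLastD 0 = N.getLastD 0 := by
  rcases List.eq_nil_or_concat N with rfl | ⟨N', b, rfl⟩
  · exact absurd rfl hN
  · rw [List.concat_eq_append, getLastD_cons_concat, List.getLastD_concat]

theorem headD_append_of_ne_nil {N : List ℝ} (L : List ℝ) (hN : N ≠ []) :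
    (N ++ L).headD 0 = N.headD 0 := by
  cases N with
  | nil => exact absurd rfl hN
  | cons b N => simp

/-- Range of the children's knots. -/
theorem child_range {p : Fin 2 → ℕ} {B : TBSpline} (hB : B.IsKnotted p) {k : Fin 2}
    {t : ℝ} (h₁ : B.first k < t) (h₂ : t < B.last k) {C : TBSpline}
    (hC : C = B.leftChild k t ∨ C = B.rightChild k t) :
    B.first k ≤ C.first k ∧ C.last k ≤ B.last k := by
  have hs : ∀ x ∈ C.knots k, B.first k ≤ x ∧ x ≤ B.last k := by
    have : ∀ x ∈ ins t (B.knots k), B.first k ≤ x ∧ x ≤ B.last k := by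
      intro x hx
      rcases List.mem_orderedInsert _ |>.mp hx with rfl | hx
      · exact ⟨h₁.le, h₂.le⟩
      · exact ⟨hB.first_le hx, hB.le_last hx⟩
    rcases hC with rfl | rfl
    · rw [leftChild_eq, knots_setKnots_self]
      exact fun x hx => this x (List.dropLast_subset _ hx)
    · rw [rightChild_eq, knots_setKnots_self]
      exact fun x hx => this x (List.tail_subset _ hx)
  have hC' : C.IsKnotted p := by
    rcases hC with rfl | rfl
    · exact hB.leftChild k t
    · exact hB.rightChild k t
  exact ⟨(hs _ (hC'.first_mem k)).1, (hs _ (hC'.last_mem k)).2⟩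

theorem Skips.child_rev {p : Fin 2 → ℕ} {M : Mesh} {B : TBSpline} (hB : B.IsKnotted p)
    {k : Fin 2} {t u : ℝ} (h : Skips M B k t) (hu : Skips M B k.rev u) :
    Skips M (B.leftChild k.rev u) k t ∧ Skips M (B.rightChild k.rev u) k t := by
  have h₁ := child_range hB hu.1 hu.2.1 (Or.inl rfl)
  have h₂ := child_range hB hu.1 hu.2.1 (Or.inr rfl)
  rw [leftChild_eq, first_setKnots_self, last_setKnots_self] at h₁
  rw [rightChild_eq, first_setKnots_self, last_setKnots_self] at h₂
  exact ⟨h.setKnots_rev h₁.1 h₁.2, h.setKnots_rev h₂.1 h₂.2⟩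

theorem leftChild_comm_rev (B : TBSpline) (k : Fin 2) (t u : ℝ) :
    (B.leftChild k.rev u).leftChild k t = (B.leftChild k t).leftChild k.rev u ∧
    (B.leftChild k.rev u).rightChild k t = (B.rightChild k t).leftChild k.rev u ∧
    (B.rightChild k.rev u).leftChild k t = (B.leftChild k t).rightChild k.rev u ∧
    (B.rightChild k.rev u).rightChild k t = (B.rightChild k t).rightChild k.rev u := by
  have e : ∀ L, (B.setKnots k.rev L).knots k = B.knots k :=
    fun L => knots_setKnots_of_ne B (rev_ne k).symm L
  simp only [leftChild_eq, rightChild_eq, e, knots_setKnots_rev]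
  simp only [setKnots_comm B (rev_ne k), and_self]

/-- The effect of two insertions in the same direction: there are three B-splines `W₀, W₁, W₂`
such that each first child is one of the outer ones, or has the two adjacent ones as its own
children. -/
theorem exists_three_windows {p : Fin 2 → ℕ} {M : Mesh} {B : TBSpline} (hB : B.IsKnotted p)
    {k : Fin 2} {t u : ℝ} (ht : Skips M B k t) (hu : Skips M B k u) (hne : t ≠ u) :
    ∃ W₀ W₁ W₂ : TBSpline, ∀ x y, (x = t ∧ y = u ∨ x = u ∧ y = t) →
      (B.leftChild k x = W₀ ∨ (Skips M (B.leftChild k x) k y ∧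
        (B.leftChild k x).leftChild k y = W₀ ∧ (B.leftChild k x).rightChild k y = W₁)) ∧
      (B.rightChild k x = W₂ ∨ (Skips M (B.rightChild k x) k y ∧
        (B.rightChild k x).leftChild k y = W₁ ∧ (B.rightChild k x).rightChild k y = W₂)) ∧
      ((Skips M (B.leftChild k x) k y ∧ (B.leftChild k x).rightChild k y = W₁) ∨
        (Skips M (B.rightChild k x) k y ∧ (B.rightChild k x).leftChild k y = W₁)) := by
  obtain ⟨mid, hmid⟩ := hB.exists_decomp k
  set a := B.first k with ha
  set m := B.last k with hm
  have hs : mid.Pairwise (· ≤ ·) := by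
    have := (hB k).1
    rw [hmid, List.pairwise_cons, List.pairwise_append] at this
    exact this.2.1
  set Z := ins t (ins u mid) with hZ
  -- With both knots inserted the vector is `a :: Z ++ [m]`, two entries too long; these are its
  -- three windows of the right length.
  refine ⟨B.setKnots k (a :: Z.dropLast), B.setKnots k Z, B.setKnots k (Z.tail ++ [m]), ?_⟩
  intro x y hxy
  have hx : Skips M B k x := by rcases hxy with ⟨rfl, rfl⟩ | ⟨rfl, rfl⟩ <;> assumption
  have hy : Skips M B k y := by rcases hxy with ⟨rfl, rfl⟩ | ⟨rfl, rfl⟩ <;> assumption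
  have hay : a ≠ y := hy.1.ne
  have hmy : m ≠ y := hy.2.1.ne'
  have hxy' : x ≠ y := by
    rcases hxy with ⟨rfl, rfl⟩ | ⟨rfl, rfl⟩
    exacts [hne, hne.symm]
  have hZ' : Z = ins y (ins x mid) := by
    rcases hxy with ⟨rfl, rfl⟩ | ⟨rfl, rfl⟩
    · rw [hZ, ins_comm hs]
    · rw [hZ]
  have hl : B.leftChild k x = B.setKnots k (a :: ins x mid) := by
    rw [leftChild_eq, hmid, dropLast_ins mid hx.1 hx.2.1.le]
  have hr : B.rightChild k x = B.setKnots k (ins x mid ++ [m]) := by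
    rw [rightChild_eq, hmid, tail_ins mid hx.1 hx.2.1.le]
  set N := ins x mid with hN
  have hN0 : N ≠ [] := ins_ne_nil _ _
  have hNs : N.Pairwise (· ≤ ·) := sorted_ins hs x
  have hcount : N.count y = mid.count y := by rw [hN, count_ins, if_neg hxy']; rfl
  have hcB : (B.knots k).count y = mid.count y := by
    rw [hmid, List.count_cons, List.count_append, List.count_singleton]
    simp [hay, hmy]
  have hll : (B.leftChild k x).leftChild k y = B.setKnots k (a :: Z.dropLast) := by
    rw [hl, leftChild_eq, knots_setKnots_self, setKnots_setKnots, (dropLast_ins_cons hy.1).1,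
      hZ']
  have hlr : (B.leftChild k x).rightChild k y = B.setKnots k Z := by
    rw [hl, rightChild_eq, knots_setKnots_self, setKnots_setKnots, (dropLast_ins_cons hy.1).2,
      hZ']
  have hrl : (B.rightChild k x).leftChild k y = B.setKnots k Z := by
    rw [hr, leftChild_eq, knots_setKnots_self, setKnots_setKnots,
      (tail_ins_concat hy.2.1.le).1, hZ']
  have hrr : (B.rightChild k x).rightChild k y = B.setKnots k (Z.tail ++ [m]) := by
    rw [hr, rightChild_eq, knots_setKnots_self, setKnots_setKnots,
      (tail_ins_concat hy.2.1.le).2, hZ']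
  have hL : y < N.getLastD 0 → Skips M (B.leftChild k x) k y := by
    intro h
    rw [hl]
    refine hy.setKnots_self (by simpa using hy.1) ?_ ?_
    · rwa [getLastD_cons_of_ne_nil _ hN0]
    · rw [List.count_cons, hcount, hcB]
      simp [hay]
  have hR : N.headD 0 < y → Skips M (B.rightChild k x) k y := by
    intro h
    rw [hr]
    refine hy.setKnots_self ?_ (by rw [List.getLastD_concat]; exact hy.2.1) ?_
    · rwa [headD_append_of_ne_nil _ hN0]
    · rw [List.count_append, hcount, hcB, List.count_singleton]
      simp [hmy]
  refine ⟨?_, ?_, ?_⟩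
  · by_cases h : y < N.getLastD 0
    · exact Or.inr ⟨hL h, hll, hlr⟩
    -- Here `y` is not below the last entry of `N`, so `Z` is `N` followed by `y`, and dropping `y`
    -- gives back the first child: it is already the outer window.
    · left
      rw [hl, hZ', ins_eq_concat hNs fun z hz => (le_getLastD hNs hz).trans (not_lt.mp h),
        List.dropLast_concat]
  · by_cases h : N.headD 0 < y
    · exact Or.inr ⟨hR h, hrl, hrr⟩
    · left
      rw [hr, hZ', ins_eq_cons hNs fun z hz => (not_lt.mp h).trans (headD_le hNs hz),
        List.tail_cons]
  · by_cases h : y < N.getLastD 0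
    · exact Or.inl ⟨hL h, hlr⟩
    · refine Or.inr ⟨hR ?_, hrl⟩
      -- If `y` is not inside the left child, all of `N`, in particular `x`, lies below or at `y`.
      -- As `x ≠ y`, the knot `y` is strictly to the right of the first entry of `N`.
      have hxN : x ∈ N := (List.mem_orderedInsert _).mpr (Or.inl rfl)
      have h₁ := le_getLastD hNs hxN
      have h₂ := headD_le hNs hxN
      exact h₂.trans_lt (lt_of_le_of_ne (h₁.trans (not_lt.mp h)) hxy')

/-- The descendants do not depend on the order of the insertions. -/
theorem isDescendant_child_of_skips {p : Fin 2 → ℕ} {M : Mesh} {B C : TBSpline}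
    (hB : B.IsKnotted p) (hC : IsDescendant M B C) {k : Fin 2} {t : ℝ} (h : Skips M B k t) :
    IsDescendant M (B.leftChild k t) C ∨ IsDescendant M (B.rightChild k t) C := by
  obtain ⟨hBC, hmin⟩ := hC
  -- Diamond argument along the path from `B` to `C`: the induction hypothesis lets the first
  -- B-spline of the path insert `t` next, and the two insertions are then exchanged.
  induction hBC using Relation.ReflTransGen.head_induction_on generalizing k t with
  | refl => exact absurd h (hmin k t)
  | @head B B₁ hB₁ hrest ih =>
    have ih' := fun k t => ih (hB₁.isKnotted hB) (k := k) (t := t)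
    obtain ⟨j, u, hu, hB₁'⟩ := hB₁
    have hd : IsDescendant M B₁ C := ⟨hrest, hmin⟩
    by_cases hjk : j = k
    · subst hjk
      by_cases htu : t = u
      · subst htu
        rcases hB₁' with rfl | rfl
        exacts [Or.inl hd, Or.inr hd]
      · obtain ⟨W₀, W₁, W₂, hW⟩ := exists_three_windows hB h hu htu
        obtain ⟨h₀, h₂, h₁⟩ := hW t u (Or.inl ⟨rfl, rfl⟩)
        obtain ⟨g₀, g₂, -⟩ := hW u t (Or.inr ⟨rfl, rfl⟩)
        have hW₀ : IsDescendant M W₀ C → IsDescendant M (B.leftChild j t) C := by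
          intro hw
          rcases h₀ with h₀ | ⟨hs, h₀, -⟩
          · rwa [h₀]
          · exact hw.of_child ⟨j, u, hs, Or.inl h₀.symm⟩
        have hW₂ : IsDescendant M W₂ C → IsDescendant M (B.rightChild j t) C := by
          intro hw
          rcases h₂ with h₂ | ⟨hs, -, h₂⟩
          · rwa [h₂]
          · exact hw.of_child ⟨j, u, hs, Or.inr h₂.symm⟩
        have hW₁ : IsDescendant M W₁ C →
            IsDescendant M (B.leftChild j t) C ∨ IsDescendant M (B.rightChild j t) C := by
          intro hw
          rcases h₁ with ⟨hs, h₁⟩ | ⟨hs, h₁⟩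
          · exact Or.inl (hw.of_child ⟨j, u, hs, Or.inr h₁.symm⟩)
          · exact Or.inr (hw.of_child ⟨j, u, hs, Or.inl h₁.symm⟩)
        -- The path starts with `u`. Either that child is itself an outer window, or inserting `t`
        -- next leads to two adjacent windows; each window is reached by inserting `t` first.
        rcases hB₁' with rfl | rfl
        · rcases g₀ with g | ⟨hs, g, g'⟩
          · exact Or.inl (hW₀ (g ▸ hd))
          · have := ih' j t hs
            rw [g, g'] at this
            rcases this with this | this
            exacts [Or.inl (hW₀ this), hW₁ this]
        · rcases g₂ with g | ⟨hs, g, g'⟩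
          · exact Or.inr (hW₂ (g ▸ hd))
          · have := ih' j t hs
            rw [g, g'] at this
            rcases this with this | this
            exacts [hW₁ this, Or.inr (hW₂ this)]
    · obtain rfl := eq_rev_of_ne hjk
      -- In different directions both skips survive the other insertion, and the children commute.
      have hs := h.child_rev hB hu
      have hs' := hu.child_rev (k := k.rev) (u := t) hB (by rwa [Fin.rev_rev])
      rw [Fin.rev_rev] at hs'
      obtain ⟨e₁, e₂, e₃, e₄⟩ := leftChild_comm_rev B k t u
      rcases hB₁' with rfl | rfl
      · have := ih' k t hs.1
        rw [e₁, e₂] at this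
        rcases this with this | this
        · exact Or.inl (this.of_child ⟨_, u, hs'.1, Or.inl rfl⟩)
        · exact Or.inr (this.of_child ⟨_, u, hs'.2, Or.inl rfl⟩)
      · have := ih' k t hs.2
        rw [e₃, e₄] at this
        rcases this with this | this
        · exact Or.inl (this.of_child ⟨_, u, hs'.1, Or.inr rfl⟩)
        · exact Or.inr (this.of_child ⟨_, u, hs'.2, Or.inr rfl⟩)

theorem descendants_union (M : Mesh) (A A' : Set TBSpline) :
    descendants M (A ∪ A') = descendants M A ∪ descendants M A' := by
  ext C
  simp only [descendants, Set.mem_ofPred_eq, Set.mem_union, or_and_right, exists_or]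

theorem descendants_mono {M : Mesh} {A A' : Set TBSpline} (h : A ⊆ A') :
    descendants M A ⊆ descendants M A' := fun _ ⟨B, hB, hC⟩ => ⟨B, h hB, hC⟩

/-- By confluence any skipped knot may be inserted first without changing the final outcome. This
makes `descendants` an invariant of the insertion procedure. -/
theorem descendants_singleton_of_skips {p : Fin 2 → ℕ} {M : Mesh} {B : TBSpline}
    (hB : B.IsKnotted p) {k : Fin 2} {t : ℝ} (h : Skips M B k t) :
    descendants M {B} = descendants M {B.leftChild k t, B.rightChild k t} := by
  ext C
  simp only [descendants, Set.mem_singleton_iff, exists_eq_left, Set.mem_ofPred_eq,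
    Set.mem_insert_iff, exists_eq_or_imp]
  constructor
  · intro hC
    exact isDescendant_child_of_skips hB hC h
  · rintro (hC | hC)
    · exact hC.of_child ⟨k, t, h, Or.inl rfl⟩
    · exact hC.of_child ⟨k, t, h, Or.inr rfl⟩

theorem descendants_of_minimalSupport {M : Mesh} {S : Set TBSpline}
    (h : ∀ B ∈ S, MinimalSupport M B) : descendants M S = S := by
  ext C
  constructor
  · rintro ⟨B, hB, hBC, -⟩
    rcases hBC.cases_head with rfl | ⟨B', ⟨k, t, hs, -⟩, -⟩
    · exact hB
    · exact absurd hs (h B hB k t)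
  · intro hC
    exact ⟨C, hC, .refl, h C hC⟩

theorem Skips.mono {M M' : Mesh} (h : ∀ k t u, M.mult k t u ≤ M'.mult k t u) {B : TBSpline}
    {k : Fin 2} {t : ℝ} (hs : Skips M B k t) : Skips M' B k t :=
  ⟨hs.1, hs.2.1, fun u hu => (hs.2.2 u hu).trans_le (h k t u)⟩

theorem Replace.isKnotted {p : Fin 2 → ℕ} {M : Mesh} {S S' : Set TBSpline} (h : Replace M S S')
    (hS : ∀ B ∈ S, B.IsKnotted p) : ∀ B ∈ S', B.IsKnotted p := by
  obtain ⟨B, hB, k, t, -, rfl⟩ := h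
  rintro C (hC | rfl | rfl)
  · exact hS C hC.1
  · exact (hS B hB).leftChild k t
  · exact (hS B hB).rightChild k t

/-- A line skipped on `M` is skipped on every finer mesh `M'`, so a replacement on an intermediate
mesh is also a step towards the descendants on the final mesh. -/
theorem descendants_eq_of_replace {p : Fin 2 → ℕ} {M M' : Mesh}
    (hM : ∀ k t u, M.mult k t u ≤ M'.mult k t u) {S S' : Set TBSpline} (h : Replace M S S')
    (hS : ∀ B ∈ S, B.IsKnotted p) : descendants M' S' = descendants M' S := by
  obtain ⟨B, hB, k, t, hs, rfl⟩ := h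
  rw [descendants_union, ← descendants_singleton_of_skips (hS B hB) (hs.mono hM),
    ← descendants_union, Set.sdiff_union_self, Set.union_eq_self_of_subset_right]
  simpa using hB

/-! ### Tensor-product B-splines under knot insertion -/

theorem ins_append_left {A L : List ℝ} {t : ℝ} (h : (A ++ L).Pairwise (· ≤ ·))
    (hA : ∀ a ∈ A, a ≤ t) : ins t (A ++ L) = A ++ ins t L := by
  rw [List.pairwise_append] at h
  refine eq_of_perm_of_sorted ?_ (sorted_ins (List.pairwise_append.mpr h) t) ?_
  · refine (List.perm_orderedInsert _ _ _).trans ?_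
    refine List.perm_middle.symm.trans ?_
    exact (List.perm_orderedInsert _ _ _).symm.append_left A
  · refine List.pairwise_append.mpr ⟨h.1, sorted_ins h.2.1 t, fun a ha b hb => ?_⟩
    rcases (List.mem_orderedInsert _).mp hb with rfl | hb
    exacts [hA a ha, h.2.2 a ha b hb]

theorem ins_append_right {L C : List ℝ} {t : ℝ} (h : (L ++ C).Pairwise (· ≤ ·))
    (hC : ∀ c ∈ C, t ≤ c) : ins t (L ++ C) = ins t L ++ C := by
  rw [List.pairwise_append] at h
  refine eq_of_perm_of_sorted ?_ (sorted_ins (List.pairwise_append.mpr h) t) ?_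
  · refine (List.perm_orderedInsert _ _ _).trans ?_
    exact ((List.perm_orderedInsert (fun a b : ℝ => a ≤ b) t L).symm.append_right C)
  · refine List.pairwise_append.mpr ⟨sorted_ins h.1 t, h.2.1, fun a ha b hb => ?_⟩
    rcases (List.mem_orderedInsert _).mp ha with rfl | ha
    exacts [hC b hb, h.2.2 a ha b hb]

theorem exists_ins_split {X : List ℝ} (hX : X.Pairwise (· ≤ ·)) (t : ℝ) :
    ∃ A C, X = A ++ C ∧ ins t X = A ++ t :: C ∧ (∀ a ∈ A, a < t) ∧ ∀ c ∈ C, t ≤ c := by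
  induction X with
  | nil => exact ⟨[], [], by simp⟩
  | cons b X ih =>
    by_cases hb : t ≤ b
    · refine ⟨[], b :: X, rfl, by simp [hb], by simp, ?_⟩
      rw [List.pairwise_cons] at hX
      intro c hc
      rcases List.mem_cons.mp hc with rfl | hc
      exacts [hb, hb.trans (hX.1 c hc)]
    · obtain ⟨A, C, rfl, h₂, h₃, h₄⟩ := ih hX.of_cons
      refine ⟨b :: A, C, rfl, by simp [hb, h₂], ?_, h₄⟩
      intro a ha
      rcases List.mem_cons.mp ha with rfl | ha
      exacts [not_le.mp hb, h₃ a ha]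

/-- The inserted knot can be placed weakly to the right or weakly to the left of the whole window,
which therefore stays contiguous. -/
theorem infix_ins_of_not_inside {X V : List ℝ} (hX : X.Pairwise (· ≤ ·)) (hV : V <:+: X) {t : ℝ}
    (h : ¬ (V.headD 0 < t ∧ t < V.getLastD 0)) : V <:+: ins t X := by
  obtain ⟨A, C, rfl⟩ := hV
  by_cases h₁ : V.headD 0 < t
  · have h₂ : V.getLastD 0 ≤ t := not_lt.mp fun h' => h ⟨h₁, h'⟩
    by_cases hV0 : V = []
    · subst hV0; exact List.nil_infix
    rw [ins_append_left hX]
    · exact ⟨A, _, rfl⟩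
    · rw [List.pairwise_append] at hX
      intro a ha
      refine le_trans ?_ h₂
      exact (List.mem_append.mp ha).elim
        (fun ha => (List.pairwise_append.mp hX.1).2.2 a ha _ (getLastD_mem hV0))
        (fun ha => le_getLastD (List.pairwise_append.mp hX.1).2.1 ha)
  · by_cases hV0 : V = []
    · subst hV0; exact List.nil_infix
    rw [List.append_assoc] at hX ⊢
    rw [ins_append_right hX]
    · exact ⟨_, C, by rw [List.append_assoc]⟩
    · intro c hc
      have hs := (List.pairwise_append.mp hX).2.1
      have := headD_le hs hc
      rw [headD_append_of_ne_nil _ hV0] at this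
      exact (not_lt.mp h₁).trans this

theorem ins_infix_of_inside {X V : List ℝ} (hX : X.Pairwise (· ≤ ·)) (hV : V <:+: X) {t : ℝ}
    (h₁ : V.headD 0 < t) (h₂ : t < V.getLastD 0) : ins t V <:+: ins t X := by
  obtain ⟨A, C, rfl⟩ := hV
  have hV0 : V ≠ [] := by
    rintro rfl
    simp at h₁ h₂
    exact absurd h₁ (not_lt.mpr h₂.le)
  have hAV := (List.pairwise_append.mp hX).1
  rw [ins_append_right hX, ins_append_left hAV]
  · exact ⟨A, C, rfl⟩
  · intro a ha
    exact ((List.pairwise_append.mp hAV).2.2 a ha _ (headD_mem hV0)).trans h₁.le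
  · intro c hc
    exact h₂.le.trans ((List.pairwise_append.mp hX).2.2 _
      (List.mem_append_right A (getLastD_mem hV0)) c hc)

theorem infix_middle_cases {A C W : List ℝ} {t : ℝ} (h : W <:+: A ++ t :: C) (hW : W ≠ []) :
    W <:+: A ++ C ∨ ∃ Pre P Q Post, W = P ++ t :: Q ∧ A = Pre ++ P ∧ C = Q ++ Post := by
  obtain ⟨Pre, Post, h⟩ := h
  rw [List.append_assoc, List.append_eq_append_iff] at h
  rcases h with ⟨A', rfl, h⟩ | ⟨A', rfl, h⟩
  · rw [List.append_eq_append_iff] at h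
    rcases h with ⟨W', rfl, h⟩ | ⟨W', rfl, h⟩
    · exact Or.inl ⟨Pre, W' ++ C, by simp⟩
    · cases W' with
      | nil => exact Or.inl ⟨Pre, C, by simp⟩
      | cons w W' =>
        rw [List.cons_append, List.cons.injEq] at h
        obtain ⟨rfl, rfl⟩ := h
        exact Or.inr ⟨Pre, A', W', Post, rfl, rfl, rfl⟩
  · cases A' with
    | nil =>
      cases W with
      | nil => exact absurd rfl hW
      | cons w W =>
        rw [List.nil_append, List.cons_append, List.cons.injEq] at h
        obtain ⟨rfl, rfl⟩ := h
        exact Or.inr ⟨A, [], W, Post, rfl, by simp, rfl⟩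
    | cons a A' =>
      rw [List.cons_append, List.cons.injEq] at h
      obtain ⟨rfl, rfl⟩ := h
      exact Or.inl ⟨A ++ A', Post, by simp⟩

theorem getLastD_append_of_ne_nil {L : List ℝ} (A : List ℝ) (hL : L ≠ []) :
    (A ++ L).getLastD 0 = L.getLastD 0 := by
  rcases List.eq_nil_or_concat L with rfl | ⟨L', b, rfl⟩
  · exact absurd rfl hL
  · rw [List.concat_eq_append, ← List.append_assoc, List.getLastD_concat, List.getLastD_concat]

/-- A window of a knot vector with one more knot either is a window of the original knot vector, or
arises from one by inserting the knot. -/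
theorem window_ins_cases {X W : List ℝ} {t : ℝ} {n : ℕ} (hX : X.Pairwise (· ≤ ·))
    (hW : W <:+: ins t X) (hn : W.length = n + 2) (hXn : n + 2 ≤ X.length)
    (h₁ : X.headD 0 < t) (h₂ : t < X.getLastD 0) (hc : X.count t ≤ n) :
    W <:+: X ∨ ∃ V, V <:+: X ∧ V.length = n + 2 ∧ V.headD 0 < t ∧ t < V.getLastD 0 ∧
      (W = (ins t V).dropLast ∨ W = (ins t V).tail) := by
  obtain ⟨A, C, rfl, hins, hA, hC⟩ := exists_ins_split hX t
  rw [hins] at hW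
  have hW0 : W ≠ [] := by rintro rfl; simp at hn
  rcases infix_middle_cases hW hW0 with h | ⟨Pre, P, Q, Post, rfl, rfl, rfl⟩
  · exact Or.inl h
  have hQs : Q.Pairwise (· ≤ ·) :=
    (List.pairwise_append.mp (List.pairwise_append.mp hX).2.1).1
  have hPs : P.Pairwise (· ≤ ·) :=
    (List.pairwise_append.mp (List.pairwise_append.mp hX).1).2.1
  have hQt : ∀ q ∈ Q, t ≤ q := fun q hq => hC q (List.mem_append_left _ hq)
  have hPt : ∀ q ∈ P, q < t := fun q hq => hA q (List.mem_append_right _ hq)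
  have hinsQ : ins t Q = t :: Q := ins_eq_cons hQs hQt
  simp only [List.length_append, List.length_cons] at hn hXn
  -- Without `t` the window is one entry short. It is extended by a neighbouring entry, on the left
  -- or on the right, chosen so that `t` lies strictly between the ends of the result. With no entry
  -- left on the right, the extension is on the left.
  rcases Post with _ | ⟨c, Post⟩
  · simp only [List.append_nil, List.length_nil, Nat.add_zero] at hXn hX h₂ hc ⊢
    have hQ0 : Q ≠ [] := by
      rintro rfl
      rw [List.append_nil] at h₂
      by_cases hP : Pre ++ P = []
      · rw [hP] at h₂ h₁; simp at h₁ h₂; linarith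
      · exact absurd (hA _ (getLastD_mem hP)) (not_lt.mpr h₂.le)
    rcases List.eq_nil_or_concat Pre with rfl | ⟨Pre, a, rfl⟩
    · simp at hXn; omega
    rw [List.concat_eq_append] at hX hA hXn h₂ ⊢
    have hat : a < t := hA a (by simp)
    have hs : (P ++ Q).Pairwise (· ≤ ·) := by
      rw [List.append_assoc] at hX
      exact (List.pairwise_append.mp hX).2.1
    refine Or.inr ⟨a :: (P ++ Q), ⟨Pre, [], by simp⟩, by simp; omega, by simp [hat], ?_, Or.inr ?_⟩
    · rw [← List.cons_append, getLastD_append_of_ne_nil _ hQ0]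
      rwa [getLastD_append_of_ne_nil _ hQ0] at h₂
    · rw [ins_cons_of_lt _ hat, List.tail_cons, ins_append_left hs fun q hq => (hPt q hq).le,
        hinsQ]
  · have htc : t ≤ c := hC c (by simp)
    rcases htc.eq_or_lt with rfl | htc
    -- If the next entry is again `t`, then `Q` consists of copies of `t`. The new copy can be
    -- exchanged with that entry, so the window was present before.
    · left
      have hQ' : ∀ q ∈ Q, q ≤ t := by
        intro q hq
        have := (List.pairwise_append.mp hX).2.1
        exact (List.pairwise_append.mp this).2.2 q hq t (by simp)
      have : t :: Q = Q ++ [t] := by rw [← hinsQ, ins_eq_concat hQs hQ']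
      rw [this]
      exact ⟨Pre, Post, by simp⟩
    · rcases List.eq_nil_or_concat P with rfl | ⟨P', b, rfl⟩
      · simp only [List.append_nil, List.length_nil, Nat.zero_add] at hn hXn hX h₁ h₂ hA hc ⊢
        rcases List.eq_nil_or_concat Pre with rfl | ⟨Pre, a, rfl⟩
        · exfalso
          have : (Q ++ c :: Post) ≠ [] := by simp
          exact absurd h₁ (not_lt.mpr (hC _ (headD_mem this)))
        rw [List.concat_eq_append] at hX hA hXn h₂ hc ⊢
        have hat : a < t := hA a (by simp)
        have hQ0 : Q ≠ [] := by rintro rfl; simp at hn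
        refine Or.inr ⟨a :: Q, ⟨Pre, c :: Post, by simp⟩, by simp; omega, by simp [hat], ?_, Or.inr ?_⟩
        · rw [getLastD_cons_of_ne_nil _ hQ0]
          by_contra hcon
          -- Otherwise all `n + 1` entries of `Q` equal `t`, against the bound `n` on its
          -- multiplicity.
          have hall : ∀ q ∈ Q, t = q := fun q hq =>
            le_antisymm (hQt q hq) ((le_getLastD hQs hq).trans (not_lt.mp hcon))
          have hcount : Q.count t = Q.length := List.count_eq_length.mpr hall
          rw [List.count_append, List.count_append (l₁ := Q), hcount] at hc
          omega
        · rw [ins_cons_of_lt _ hat, List.tail_cons, hinsQ]; simp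
      · rw [List.concat_eq_append] at *
        have hs : ((P' ++ [b]) ++ (Q ++ [c])).Pairwise (· ≤ ·) := by
          refine hX.sublist ?_
          refine (List.sublist_append_right Pre _).append ?_
          exact (List.Sublist.refl Q).append (by simp)
        have hs' : (Q ++ [c]).Pairwise (· ≤ ·) := (List.pairwise_append.mp hs).2.1
        refine Or.inr ⟨(P' ++ [b]) ++ (Q ++ [c]), ⟨Pre, Post, by simp⟩, ?_, ?_, ?_, Or.inl ?_⟩
        · simp at hn ⊢; omega
        · rw [headD_append_of_ne_nil _ (by simp)]
          exact hPt _ (headD_mem (by simp))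
        · rw [getLastD_append_of_ne_nil _ (by simp), List.getLastD_concat]
          exact htc
        · rw [ins_append_left hs fun q hq => (hPt q hq).le, ins_concat_of_le htc.le, hinsQ,
            ← List.append_assoc, List.dropLast_concat]

theorem isKnotted_of_mem_tensorSplines {p : Fin 2 → ℕ} {X : Fin 2 → List ℝ}
    (hX : ∀ k, (X k).Pairwise (· ≤ ·)) {B : TBSpline} (hB : B ∈ tensorSplines p X) :
    B.IsKnotted p :=
  fun k => ⟨(hX k).sublist (hB k).1.sublist, (hB k).2⟩

theorem range_of_infix {X V : List ℝ} (hX : X.Pairwise (· ≤ ·)) (hV : V <:+: X) (h0 : V ≠ []) :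
    X.headD 0 ≤ V.headD 0 ∧ V.getLastD 0 ≤ X.getLastD 0 :=
  ⟨headD_le hX (hV.sublist.subset (headD_mem h0)),
    le_getLastD hX (hV.sublist.subset (getLastD_mem h0))⟩

/-- Insertion of one knot in a tensor-product mesh covered by `M` does not change the
descendants. -/
theorem descendants_tensorSplines_ins {p : Fin 2 → ℕ} {M : Mesh} {X : Fin 2 → List ℝ}
    (hX : ∀ k, (X k).Pairwise (· ≤ ·)) {k : Fin 2} {t : ℝ} (hlen : p k + 2 ≤ (X k).length)
    (h₁ : (X k).headD 0 < t) (h₂ : t < (X k).getLastD 0) (hc : (X k).count t ≤ p k)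
    (hM : ∀ u ∈ Set.Icc ((X k.rev).headD 0) ((X k.rev).getLastD 0),
      (X k).count t < M.mult k t u) :
    descendants M (tensorSplines p (Function.update X k (ins t (X k)))) =
      descendants M (tensorSplines p X) := by
  -- A local multiplicity is at most the global one, which is smaller than that of the meshline; so
  -- the line is skipped by every B-spline that has `t` inside its support.
  have hskip : ∀ B ∈ tensorSplines p X, B.first k < t → t < B.last k → Skips M B k t := by
    intro B hB hB₁ hB₂
    refine ⟨hB₁, hB₂, fun u hu => ?_⟩
    have := range_of_infix (hX k.rev) (hB k.rev).1
      ((isKnotted_of_mem_tensorSplines hX hB).ne_nil k.rev)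
    exact ((hB k).1.sublist.count_le t).trans_lt
      (hM u ⟨this.1.trans hu.1, hu.2.trans this.2⟩)
  have hmem : ∀ {B : TBSpline} {Y : List ℝ},
      B ∈ tensorSplines p (Function.update X k Y) ↔
        (B.knots k <:+: Y ∧ (B.knots k).length = p k + 2) ∧
        (B.knots k.rev <:+: X k.rev ∧ (B.knots k.rev).length = p k.rev + 2) := by
    intro B Y
    constructor
    · intro h
      have h₁ := h k
      have h₂ := h k.rev
      rw [Function.update_self] at h₁
      rw [Function.update_of_ne (rev_ne k)] at h₂
      exact ⟨h₁, h₂⟩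
    · rintro ⟨h₁, h₂⟩ j
      by_cases hj : j = k
      · subst hj; rwa [Function.update_self]
      · obtain rfl := eq_rev_of_ne hj
        rwa [Function.update_of_ne (rev_ne k)]
  have hmemX : ∀ {B : TBSpline}, B ∈ tensorSplines p X ↔
        (B.knots k <:+: X k ∧ (B.knots k).length = p k + 2) ∧
        (B.knots k.rev <:+: X k.rev ∧ (B.knots k.rev).length = p k.rev + 2) := by
    intro B
    conv_lhs => rw [← Function.update_eq_self k X]
    exact hmem
  ext C
  constructor
  · rintro ⟨B', hB', hC⟩
    obtain ⟨h, h'⟩ := hmem.mp hB'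
    rcases window_ins_cases (hX k) h.1 h.2 hlen h₁ h₂ hc with hw | ⟨V, hV, hVl, hV₁, hV₂, hw⟩
    · exact ⟨B', hmemX.mpr ⟨⟨hw, h.2⟩, h'⟩, hC⟩
    · have hB : B'.setKnots k V ∈ tensorSplines p X := by
        rw [hmemX, knots_setKnots_self, knots_setKnots_rev]
        exact ⟨⟨hV, hVl⟩, h'⟩
      refine ⟨_, hB, hC.of_child ⟨k, t, hskip _ hB ?_ ?_, ?_⟩⟩
      · rwa [first_setKnots_self]
      · rwa [last_setKnots_self]
      · refine hw.imp (fun hw => ?_) (fun hw => ?_)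
        · rw [leftChild_eq, knots_setKnots_self, setKnots_setKnots, ← hw, setKnots_knots]
        · rw [rightChild_eq, knots_setKnots_self, setKnots_setKnots, ← hw, setKnots_knots]
  · rintro ⟨B, hB, hC⟩
    have hBk := isKnotted_of_mem_tensorSplines hX hB
    obtain ⟨h, h'⟩ := hmemX.mp hB
    by_cases hin : B.first k < t ∧ t < B.last k
    · have hi := ins_infix_of_inside (hX k) h.1 hin.1 hin.2
      rcases isDescendant_child_of_skips hBk hC (hskip B hB hin.1 hin.2) with hd | hd
      · refine ⟨_, hmem.mpr ⟨⟨?_, (hBk.leftChild k t k).2⟩, ?_⟩, hd⟩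
        · rw [leftChild_eq, knots_setKnots_self]
          exact (List.dropLast_prefix _).isInfix.trans hi
        · rwa [leftChild_eq, knots_setKnots_rev]
      · refine ⟨_, hmem.mpr ⟨⟨?_, (hBk.rightChild k t k).2⟩, ?_⟩, hd⟩
        · rw [rightChild_eq, knots_setKnots_self]
          exact (List.tail_suffix _).isInfix.trans hi
        · rwa [rightChild_eq, knots_setKnots_rev]
    · exact ⟨B, hmem.mpr ⟨⟨infix_ins_of_not_inside (hX k) h.1 hin, h.2⟩, h'⟩, hC⟩

/-- Insert several knots. -/
def insAll (ts L : List ℝ) : List ℝ := ts.foldr (fun t L => ins t L) L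

theorem insAll_perm (ts L : List ℝ) : (insAll ts L).Perm (ts ++ L) := by
  induction ts with
  | nil => exact .refl _
  | cons t ts ih => exact (List.perm_orderedInsert _ _ _).trans (ih.cons t)

theorem sorted_insAll (ts : List ℝ) {L : List ℝ} (h : L.Pairwise (· ≤ ·)) :
    (insAll ts L).Pairwise (· ≤ ·) := by
  induction ts with
  | nil => exact h
  | cons t ts ih => exact sorted_ins ih t

theorem headD_eq_of {L L' : List ℝ} (hL' : L'.Pairwise (· ≤ ·)) (hmem : L.headD 0 ∈ L') (h : ∀ x ∈ L', L.headD 0 ≤ x) :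
    L'.headD 0 = L.headD 0 :=
  le_antisymm (headD_le hL' hmem) (h _ (headD_mem (List.ne_nil_of_mem hmem)))

theorem getLastD_eq_of {L L' : List ℝ} (hL' : L'.Pairwise (· ≤ ·))
    (hmem : L.getLastD 0 ∈ L') (h : ∀ x ∈ L', x ≤ L.getLastD 0) :
    L'.getLastD 0 = L.getLastD 0 :=
  le_antisymm (h _ (getLastD_mem (List.ne_nil_of_mem hmem))) (le_getLastD hL' hmem)

theorem ends_insAll {ts L : List ℝ} (hL : L.Pairwise (· ≤ ·)) (h0 : L ≠ [])
    (h : ∀ t ∈ ts, L.headD 0 < t ∧ t < L.getLastD 0) :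
    (insAll ts L).headD 0 = L.headD 0 ∧ (insAll ts L).getLastD 0 = L.getLastD 0 := by
  have hm : ∀ x, x ∈ insAll ts L ↔ x ∈ ts ∨ x ∈ L := fun x => by
    rw [(insAll_perm ts L).mem_iff, List.mem_append]
  constructor
  · refine headD_eq_of (sorted_insAll ts hL) ((hm _).mpr (Or.inr (headD_mem h0))) ?_
    intro x hx
    rcases (hm x).mp hx with hx | hx
    exacts [(h x hx).1.le, headD_le hL hx]
  · refine getLastD_eq_of (sorted_insAll ts hL) ((hm _).mpr (Or.inr (getLastD_mem h0))) ?_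
    intro x hx
    rcases (hm x).mp hx with hx | hx
    exacts [(h x hx).2.le, le_getLastD hL hx]

theorem count_insAll (ts L : List ℝ) (t : ℝ) :
    (insAll ts L).count t = ts.count t + L.count t := by
  rw [(insAll_perm ts L).count_eq, List.count_append]

theorem length_insAll (ts L : List ℝ) : (insAll ts L).length = ts.length + L.length := by
  rw [(insAll_perm ts L).length_eq, List.length_append]

/-- One knot at a time; the bounds contain `ts.count t` because earlier copies in the list raise the
current multiplicity. -/
theorem descendants_tensorSplines_insAll {p : Fin 2 → ℕ} {M : Mesh} {X : Fin 2 → List ℝ}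
    (hX : ∀ k, (X k).Pairwise (· ≤ ·)) {k : Fin 2} (hlen : p k + 2 ≤ (X k).length)
    (ts : List ℝ) (hts : ∀ t ∈ ts, (X k).headD 0 < t ∧ t < (X k).getLastD 0)
    (hc : ∀ t ∈ ts, ts.count t + (X k).count t ≤ p k + 1)
    (hM : ∀ t ∈ ts, ∀ u ∈ Set.Icc ((X k.rev).headD 0) ((X k.rev).getLastD 0),
      ts.count t + (X k).count t ≤ M.mult k t u) :
    descendants M (tensorSplines p (Function.update X k (insAll ts (X k)))) =
      descendants M (tensorSplines p X) := by
  induction ts with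
  | nil => simp [insAll]
  | cons t ts ih =>
    have hle : ∀ x, ts.count x ≤ (t :: ts).count x := fun x =>
      (List.sublist_cons_self t ts).count_le x
    rw [← ih (fun x hx => hts x (List.mem_cons_of_mem _ hx))
      (fun x hx => (Nat.add_le_add_right (hle x) _).trans (hc x (List.mem_cons_of_mem _ hx)))
      (fun x hx u hu =>
        (Nat.add_le_add_right (hle x) _).trans (hM x (List.mem_cons_of_mem _ hx) u hu))]
    have h0 : X k ≠ [] := by
      intro h
      rw [h] at hlen
      simp at hlen
    have hends := ends_insAll (hX k) h0 fun x hx => hts x (List.mem_cons_of_mem _ hx)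
    have ht := hts t List.mem_cons_self
    have hc' := hc t List.mem_cons_self
    have hM' := hM t List.mem_cons_self
    rw [List.count_cons_self] at hc' hM'
    have := descendants_tensorSplines_ins (p := p) (M := M)
      (X := Function.update X k (insAll ts (X k))) (k := k) (t := t) ?_ ?_ ?_ ?_ ?_ ?_
    · rw [Function.update_self, Function.update_idem] at this
      exact this
    · intro j
      by_cases hj : j = k
      · subst hj; rw [Function.update_self]; exact sorted_insAll _ (hX _)
      · rw [Function.update_of_ne hj]; exact hX j
    · rw [Function.update_self, length_insAll]; omega
    · rw [Function.update_self, hends.1]; exact ht.1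
    · rw [Function.update_self, hends.2]; exact ht.2
    · rw [Function.update_self, count_insAll]; omega
    · rw [Function.update_self, Function.update_of_ne (rev_ne k), count_insAll]
      intro u hu
      have := hM' u hu
      omega

/-! ### Open knot vectors and the Bernstein knots -/

/-- The open knot vector without internal knots. -/
def bernsteinKnots (p : ℕ) (a b : ℝ) : List ℝ :=
  List.replicate (p + 1) a ++ List.replicate (p + 1) b

theorem sorted_bernsteinKnots (p : ℕ) {a b : ℝ} (h : a ≤ b) :
    (bernsteinKnots p a b).Pairwise (· ≤ ·) := by
  rw [bernsteinKnots, List.pairwise_append]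
  refine ⟨?_, ?_, ?_⟩
  · exact List.pairwise_replicate.mpr (Or.inr le_rfl)
  · exact List.pairwise_replicate.mpr (Or.inr le_rfl)
  · intro x hx y hy
    rw [List.eq_of_mem_replicate hx, List.eq_of_mem_replicate hy]
    exact h

theorem headD_bernsteinKnots (p : ℕ) (a b : ℝ) : (bernsteinKnots p a b).headD 0 = a := by
  simp [bernsteinKnots, List.replicate_succ]

theorem getLastD_bernsteinKnots (p : ℕ) (a b : ℝ) : (bernsteinKnots p a b).getLastD 0 = b := by
  rw [bernsteinKnots, List.replicate_succ', List.replicate_succ', ← List.append_assoc,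
    List.getLastD_concat]

theorem count_bernsteinKnots (p : ℕ) (a b t : ℝ) :
    (bernsteinKnots p a b).count t =
      (if a = t then p + 1 else 0) + (if b = t then p + 1 else 0) := by
  rw [bernsteinKnots, List.count_append, List.count_replicate, List.count_replicate]
  simp

theorem length_bernsteinKnots (p : ℕ) (a b : ℝ) :
    (bernsteinKnots p a b).length = 2 * p + 2 := by
  simp [bernsteinKnots]; ring

namespace IsOpenKnotVector

variable {p : ℕ} {a b : ℝ} {l : List ℝ}

theorem eq_insAll (h : IsOpenKnotVector p a b l) :
    l = insAll (l.filter fun t => a < t ∧ t < b) (bernsteinKnots p a b) := by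
  refine eq_of_perm_of_sorted ?_ h.sorted (sorted_insAll _ (sorted_bernsteinKnots p h.lt.le))
  rw [List.perm_iff_count]
  intro t
  rw [count_insAll, count_bernsteinKnots]
  by_cases ha : a = t
  · subst ha
    rw [h.count_left, List.count_eq_zero_of_not_mem (by simp)]
    simp [h.lt.ne']
  by_cases hb : b = t
  · subst hb
    rw [h.count_right, List.count_eq_zero_of_not_mem (by simp)]
    simp [h.lt.ne]
  simp only [ha, hb, if_false, Nat.add_zero]
  by_cases hin : a < t ∧ t < b
  · rw [List.count_filter (by simpa using hin)]
  · have h₁ : t ∉ l := fun hm => by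
      have := h.mem_Icc t hm
      exact hin ⟨lt_of_le_of_ne this.1 ha, lt_of_le_of_ne this.2 (Ne.symm hb)⟩
    have h₂ : t ∉ l.filter fun t => a < t ∧ t < b := fun hm => h₁ (List.mem_filter.mp hm).1
    rw [List.count_eq_zero_of_not_mem h₁, List.count_eq_zero_of_not_mem h₂]

theorem headD_eq (h : IsOpenKnotVector p a b l) : l.headD 0 = a := by
  have ha : a ∈ l := List.count_pos_iff.mp (by rw [h.count_left]; omega)
  exact le_antisymm (headD_le h.sorted ha)
    (h.mem_Icc _ (headD_mem (List.ne_nil_of_mem ha))).1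

theorem getLastD_eq (h : IsOpenKnotVector p a b l) : l.getLastD 0 = b := by
  have hb : b ∈ l := List.count_pos_iff.mp (by rw [h.count_right]; omega)
  exact le_antisymm (h.mem_Icc _ (getLastD_mem (List.ne_nil_of_mem hb))).2
    (le_getLastD h.sorted hb)

end IsOpenKnotVector

/-- The tensor-product B-splines on an open mesh have the same descendants as those without
internal knots, provided that the mesh contains the internal knot lines. -/
theorem descendants_tensorSplines_of_open {p : Fin 2 → ℕ} {M : Mesh} {lo hi : Fin 2 → ℝ}
    {X : Fin 2 → List ℝ} (hX : ∀ k, IsOpenKnotVector (p k) (lo k) (hi k) (X k))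
    (hM : ∀ k t, lo k < t → t < hi k → ∀ u ∈ Set.Icc (lo k.rev) (hi k.rev),
      (X k).count t ≤ M.mult k t u) :
    descendants M (tensorSplines p X) =
      descendants M (tensorSplines p fun k => bernsteinKnots (p k) (lo k) (hi k)) := by
  -- One direction is treated at a time. In the other one only the end knots matter, since they
  -- determine the length that the meshlines must have.
  have key : ∀ (Y : Fin 2 → List ℝ) (k : Fin 2), (∀ j, (Y j).Pairwise (· ≤ ·)) →
      Y k = bernsteinKnots (p k) (lo k) (hi k) →
      (Y k.rev).headD 0 = lo k.rev → (Y k.rev).getLastD 0 = hi k.rev →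
      descendants M (tensorSplines p (Function.update Y k (X k))) =
        descendants M (tensorSplines p Y) := by
    intro Y k hY hk h₁ h₂
    have hXk := (hX k).eq_insAll
    rw [← hk] at hXk
    conv_lhs => rw [hXk]
    have hmem : ∀ t ∈ (X k).filter (fun t => lo k < t ∧ t < hi k), lo k < t ∧ t < hi k :=
      fun t ht => by simpa using (List.mem_filter.mp ht).2
    have hcnt : ∀ t, ((X k).filter fun t => lo k < t ∧ t < hi k).count t + (Y k).count t
        = (X k).count t := by
      intro t
      conv_rhs => rw [hXk]
      rw [count_insAll]
    refine descendants_tensorSplines_insAll hY ?_ _ ?_ ?_ ?_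
    · rw [hk, length_bernsteinKnots]; omega
    · rw [hk, headD_bernsteinKnots, getLastD_bernsteinKnots]
      exact hmem
    · intro t _
      rw [hcnt]
      exact (hX k).count_le t
    · intro t ht u hu
      rw [hcnt]
      rw [h₁, h₂] at hu
      exact hM k t (hmem t ht).1 (hmem t ht).2 u hu
  set X₀ : Fin 2 → List ℝ := fun k => bernsteinKnots (p k) (lo k) (hi k) with hX₀
  have hs₀ : ∀ j, (X₀ j).Pairwise (· ≤ ·) := fun j => sorted_bernsteinKnots _ (hX j).lt.le
  have e : X = Function.update (Function.update X₀ 0 (X 0)) 1 (X 1) := by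
    funext j
    fin_cases j <;> simp [Function.update]
  have e₁ : (Function.update X₀ 0 (X 0)) 1 = X₀ 1 := Function.update_of_ne (by decide) _ _
  have e₀ : (Function.update X₀ 0 (X 0)) 0 = X 0 := Function.update_self _ _ _
  rw [e, key _ 1 ?_ e₁ ?_ ?_, key _ 0 hs₀ rfl ?_ ?_]
  · exact headD_bernsteinKnots _ _ _
  · exact getLastD_bernsteinKnots _ _ _
  · intro j
    by_cases hj : j = 0
    · subst hj; rw [e₀]; exact (hX 0).sorted
    · rw [Function.update_of_ne hj]; exact hs₀ j
  · exact e₀ ▸ (hX 0).headD_eq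
  · exact e₀ ▸ (hX 0).getLastD_eq

/-! ### Invariants of LR B-splines and their dependence on the mesh alone -/

/-- The two possible local knot vectors after an insertion. -/
theorem child_knots {p : Fin 2 → ℕ} {B C : TBSpline} (hB : B.IsKnotted p) {k : Fin 2} {t : ℝ}
    (h₁ : B.first k < t) (h₂ : t < B.last k)
    (hC : C = B.leftChild k t ∨ C = B.rightChild k t) :
    C.knots k.rev = B.knots k.rev ∧ ∃ mid, B.knots k = B.first k :: (mid ++ [B.last k]) ∧
      (C.knots k = B.first k :: ins t mid ∨ C.knots k = ins t mid ++ [B.last k]) := by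
  obtain ⟨mid, hmid⟩ := hB.exists_decomp k
  refine ⟨?_, mid, hmid, hC.imp ?_ ?_⟩
  · rcases hC with rfl | rfl
    · rw [leftChild_eq, knots_setKnots_rev]
    · rw [rightChild_eq, knots_setKnots_rev]
  · rintro rfl
    rw [leftChild_eq, knots_setKnots_self]
    conv_lhs => rw [hmid]
    exact dropLast_ins mid h₁ h₂.le
  · rintro rfl
    rw [rightChild_eq, knots_setKnots_self]
    conv_lhs => rw [hmid]
    exact tail_ins mid h₁ h₂.le

/-- The local knot lines of `B` are meshlines of `M` that traverse the support of `B`. -/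
structure IsOnMesh (p : Fin 2 → ℕ) (M : Mesh) (B : TBSpline) : Prop where
  isKnotted : B.IsKnotted p
  lt : ∀ k, B.first k < B.last k
  mem : ∀ k, ∀ t ∈ B.knots k, M.lo k ≤ t ∧ t ≤ M.hi k
  mult_pos : ∀ k, ∀ t ∈ B.knots k, ∀ u ∈ Set.Icc (B.first k.rev) (B.last k.rev),
    0 < M.mult k t u

theorem IsOnMesh.mono {p : Fin 2 → ℕ} {M M' : Mesh} {B : TBSpline} (h : IsOnMesh p M B)
    (hlo : M.lo = M'.lo) (hhi : M.hi = M'.hi) (hM : ∀ k t u, M.mult k t u ≤ M'.mult k t u) :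
    IsOnMesh p M' B :=
  ⟨h.isKnotted, h.lt, hlo ▸ hhi ▸ h.mem,
    fun k t ht u hu => (h.mult_pos k t ht u hu).trans_le (hM k t u)⟩

/-- The inserted knot comes from a meshline that crosses the support from side to side, and the old
knot lines have to traverse a support that only becomes smaller. -/
theorem IsOnMesh.child {p : Fin 2 → ℕ} {M : Mesh} {B C : TBSpline} (h : IsOnMesh p M B)
    (hC : Child M B C) : IsOnMesh p M C := by
  have hCk := hC.isKnotted h.isKnotted
  obtain ⟨k, t, hs, hC⟩ := hC
  have hr := child_range h.isKnotted hs.1 hs.2.1 hC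
  obtain ⟨hrev, mid, hmid, hk⟩ := child_knots h.isKnotted hs.1 hs.2.1 hC
  have hmem : ∀ x ∈ C.knots k, x = t ∨ x ∈ B.knots k := by
    intro x hx
    rw [hmid]
    rcases hk with hk | hk <;> rw [hk] at hx <;>
      simp only [List.mem_cons, List.mem_append, List.mem_orderedInsert, List.mem_nil_iff] at hx ⊢
    all_goals tauto
  have hfirst : C.first k.rev = B.first k.rev := by rw [first, hrev, first]
  have hlast : C.last k.rev = B.last k.rev := by rw [last, hrev, last]
  have htC : t ∈ C.knots k := by
    rcases hk with hk | hk <;> rw [hk] <;> simp [List.mem_orderedInsert]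
  have hlt : C.first k < C.last k := by
    rcases hk with hk | hk
    · have : C.first k = B.first k := by rw [first, hk, List.headD_cons]
      rw [this]
      exact hs.1.trans_le (hCk.le_last htC)
    · have : C.last k = B.last k := by rw [last, hk, List.getLastD_concat]
      rw [this]
      exact (hCk.first_le htC).trans_lt hs.2.1
  refine ⟨hCk, ?_, ?_, ?_⟩
  · intro j
    by_cases hj : j = k
    · subst hj; exact hlt
    · obtain rfl := eq_rev_of_ne hj
      rw [hfirst, hlast]; exact h.lt _
  · intro j x hx
    by_cases hj : j = k
    · subst hj
      rcases hmem x hx with rfl | hx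
      · exact ⟨(h.mem j _ (h.isKnotted.first_mem j)).1.trans hs.1.le,
          hs.2.1.le.trans (h.mem j _ (h.isKnotted.last_mem j)).2⟩
      · exact h.mem j x hx
    · obtain rfl := eq_rev_of_ne hj
      rw [hrev] at hx
      exact h.mem _ x hx
  · intro j x hx u hu
    by_cases hj : j = k
    · subst hj
      rw [hfirst, hlast] at hu
      rcases hmem x hx with rfl | hx
      · exact (Nat.zero_le _).trans_lt (hs.2.2 u hu)
      · exact h.mult_pos j x hx u hu
    · obtain rfl := eq_rev_of_ne hj
      rw [hrev] at hx
      rw [Fin.rev_rev] at hu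
      refine h.mult_pos _ x hx u ?_
      rw [Fin.rev_rev]
      exact ⟨hr.1.trans hu.1, hu.2.trans hr.2⟩

theorem forall_of_refines_path {M : Mesh} {P : TBSpline → Prop}
    (hP : ∀ B C, P B → Child M B C → P C) {S S' : Set TBSpline}
    (h : Relation.ReflTransGen (Replace M) S S') (hS : ∀ B ∈ S, P B) : ∀ B ∈ S', P B := by
  induction h with
  | refl => exact hS
  | tail _ hr ih =>
    obtain ⟨B, hB, k, t, hs, rfl⟩ := hr
    rintro C (hC | rfl | rfl)
    · exact ih C hC.1
    · exact hP B _ (ih B hB) ⟨k, t, hs, Or.inl rfl⟩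
    · exact hP B _ (ih B hB) ⟨k, t, hs, Or.inr rfl⟩

theorem descendants_eq_of_path {p : Fin 2 → ℕ} {M M' : Mesh}
    (hM : ∀ k t u, M.mult k t u ≤ M'.mult k t u) {S S' : Set TBSpline}
    (h : Relation.ReflTransGen (Replace M) S S')
    (hS : ∀ B ∈ S, B.IsKnotted p) : descendants M' S' = descendants M' S := by
  induction h with
  | refl => rfl
  | tail hp hr ih =>
    rw [descendants_eq_of_replace hM hr
      (forall_of_refines_path (fun B C hB hC => hC.isKnotted hB) hp hS), ih]

/-- In a sorted list, all copies of a value strictly between the ends of a window belong to the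
window. This is why tensor-product B-splines have minimal support. -/
theorem count_eq_of_infix {X V : List ℝ} (hX : X.Pairwise (· ≤ ·)) (hV : V <:+: X) {t : ℝ}
    (h₁ : V.headD 0 < t) (h₂ : t < V.getLastD 0) : X.count t = V.count t := by
  obtain ⟨A, C, rfl⟩ := hV
  have hV0 : V ≠ [] := by
    rintro rfl
    simp at h₁ h₂
    exact absurd h₁ (not_lt.mpr h₂.le)
  have hA : t ∉ A := fun h => by
    have := (List.pairwise_append.mp (List.pairwise_append.mp hX).1).2.2 t h _ (headD_mem hV0)
    linarith
  have hC : t ∉ C := fun h => by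
    have := (List.pairwise_append.mp hX).2.2 _ (List.mem_append_right A (getLastD_mem hV0)) t h
    linarith
  rw [List.count_append, List.count_append, List.count_eq_zero_of_not_mem hA,
    List.count_eq_zero_of_not_mem hC]
  omega

theorem Mesh.mult_le_insert (M : Mesh) (g : Meshline) (k : Fin 2) (t u : ℝ) :
    M.mult k t u ≤ (M.insert g).mult k t u := by
  simp only [Mesh.insert]
  split_ifs
  · exact le_max_left _ _
  · exact le_rfl

theorem mult_bound_insert {M : Mesh} {T : Finset ℝ} {N : ℕ}
    (hTN : ∀ k t u, M.mult k t u ≤ N ∧ (M.mult k t u ≠ 0 → t ∈ T)) (g : Meshline) (k : Fin 2)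
    (t u : ℝ) : (M.insert g).mult k t u ≤ max N g.mul ∧
      ((M.insert g).mult k t u ≠ 0 → t ∈ {g.pos} ∪ T) := by
  have := hTN k t u
  simp only [Mesh.insert]
  split_ifs with hc
  · exact ⟨max_le_max this.1 le_rfl, fun _ => by simp [hc.2.1]⟩
  · exact ⟨this.1.trans (le_max_left _ _), fun h => Finset.mem_union_right _ (this.2 h)⟩

section Tensor

variable {p : Fin 2 → ℕ} {lo hi : Fin 2 → ℝ} {X : Fin 2 → List ℝ}

theorem mem_Icc_of_mem_tensorSplines (hX : ∀ k, IsOpenKnotVector (p k) (lo k) (hi k) (X k))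
    {B : TBSpline} (hB : B ∈ tensorSplines p X) (k : Fin 2) {t : ℝ} (ht : t ∈ B.knots k) :
    t ∈ Set.Icc (lo k) (hi k) := (hX k).mem_Icc t ((hB k).1.sublist.subset ht)

theorem isOnMesh_of_mem_tensorSplines
    (hX : ∀ k, IsOpenKnotVector (p k) (lo k) (hi k) (X k)) {B : TBSpline}
    (hB : B ∈ tensorSplines p X) : IsOnMesh p (tensorMesh lo hi X) B := by
  have hk := isKnotted_of_mem_tensorSplines (fun k => (hX k).sorted) hB
  refine ⟨hk, ?_, fun k t ht => mem_Icc_of_mem_tensorSplines hX hB k ht, ?_⟩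
  · intro k
    by_contra hcon
    have hall : ∀ t ∈ B.knots k, B.first k = t := fun t ht =>
      le_antisymm (hk.first_le ht) ((hk.le_last ht).trans (not_lt.mp hcon))
    have h₁ := List.count_eq_length.mpr hall
    have h₂ := (hB k).1.sublist.count_le (B.first k)
    have h₃ := (hX k).count_le (B.first k)
    have h₄ := (hB k).2
    omega
  · intro k t ht u hu
    have h₁ := mem_Icc_of_mem_tensorSplines hX hB k.rev (hk.first_mem k.rev)
    have h₂ := mem_Icc_of_mem_tensorSplines hX hB k.rev (hk.last_mem k.rev)
    simp only [tensorMesh]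
    rw [if_pos ⟨h₁.1.trans hu.1, hu.2.trans h₂.2⟩]
    exact List.count_pos_iff.mpr ((hB k).1.sublist.subset ht)

theorem minimalSupport_of_mem_tensorSplines
    (hX : ∀ k, IsOpenKnotVector (p k) (lo k) (hi k) (X k)) {B : TBSpline}
    (hB : B ∈ tensorSplines p X) : MinimalSupport (tensorMesh lo hi X) B := by
  intro k t hs
  have hk := isKnotted_of_mem_tensorSplines (fun k => (hX k).sorted) hB
  have h := hs.2.2 (B.first k.rev) ⟨le_rfl, hk.first_le_last k.rev⟩
  simp only [tensorMesh] at h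
  rw [if_pos (mem_Icc_of_mem_tensorSplines hX hB k.rev (hk.first_mem k.rev)),
    count_eq_of_infix (hX k).sorted (hB k).1 hs.1 hs.2.1] at h
  exact lt_irrefl _ h

theorem finite_tensorSplines (p : Fin 2 → ℕ) (X : Fin 2 → List ℝ) :
    (tensorSplines p X).Finite := by
  have : (Set.pi Set.univ fun k => {l : List ℝ | l.Sublist (X k)}).Finite := by
    refine Set.Finite.pi fun k => ?_
    refine ((X k).sublists.toFinset.finite_toSet).subset fun l hl => ?_
    simpa using hl
  refine Set.Finite.of_finite_image (f := TBSpline.knots) (this.subset ?_)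
    (fun B _ C _ h => TBSpline.ext h)
  rintro _ ⟨B, hB, rfl⟩ k _
  exact (hB k).1.sublist

end Tensor

namespace IsLR

variable {p : Fin 2 → ℕ} {M : Mesh} {S : Set TBSpline}

theorem isOnMesh (h : IsLR p M S) : ∀ B ∈ S, IsOnMesh p M B := by
  induction h with
  | tensor lo hi X hX => exact fun B hB => isOnMesh_of_mem_tensorSplines hX hB
  | insert M S S' g hM hg hS ih =>
    exact forall_of_refines_path (fun B C hB hC => hB.child hC) hS.1
      fun B hB => (ih B hB).mono rfl rfl (M.mult_le_insert g)

theorem minimalSupport (h : IsLR p M S) : ∀ B ∈ S, MinimalSupport M B := by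
  cases h with
  | tensor lo hi X hX => exact fun B hB => minimalSupport_of_mem_tensorSplines hX hB
  | insert M S S' g hM hg hS => exact hS.2

theorem finite (h : IsLR p M S) : S.Finite := by
  induction h with
  | tensor lo hi X hX => exact finite_tensorSplines p X
  | insert M S S' g hM hg hS ih =>
    obtain ⟨hS, -⟩ := hS
    induction hS with
    | refl => exact ih
    | tail _ hr ih =>
      obtain ⟨B, hB, k, t, hs, rfl⟩ := hr
      exact (ih.subset Set.sdiff_subset).union (by simp)

/-- Finitely many line positions and bounded multiplicities: this makes knot insertion terminate and
provides small rectangles without meshlines. -/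
theorem exists_mult_bound (h : IsLR p M S) :
    ∃ (T : Finset ℝ) (N : ℕ), ∀ k t u, M.mult k t u ≤ N ∧ (M.mult k t u ≠ 0 → t ∈ T) := by
  induction h with
  | tensor lo hi X hX =>
    refine ⟨(X 0).toFinset ∪ (X 1).toFinset, (X 0).length + (X 1).length, fun k t u => ?_⟩
    have h₁ : (tensorMesh lo hi X).mult k t u ≤ (X k).count t := by
      simp only [tensorMesh]; split_ifs <;> simp
    constructor
    · refine h₁.trans (List.count_le_length.trans ?_)
      fin_cases k <;> simp
    · intro h0
      have : t ∈ X k := List.count_pos_iff.mp ((Nat.pos_of_ne_zero h0).trans_le h₁)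
      fin_cases k <;> simp_all
  | insert M S S' g hM hg hS ih =>
    obtain ⟨T, N, hTN⟩ := ih
    exact ⟨{g.pos} ∪ T, max N g.mul, mult_bound_insert hTN g⟩

theorem lo_lt_hi (h : IsLR p M S) (k : Fin 2) : M.lo k < M.hi k := by
  induction h with
  | tensor lo hi X hX => exact (hX k).lt
  | insert M S S' g hM hg hS ih => exact ih

/-- Every mesh in the construction of `M` is coarser than `M'`, so all its replacements preserve the
descendants on `M'`; the initial tensor-product mesh reduces to the Bernstein knots. -/
theorem descendants_eq (h : IsLR p M S) {M' : Mesh}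
    (hM' : ∀ k t u, M.mult k t u ≤ M'.mult k t u) :
    descendants M' S =
      descendants M' (tensorSplines p fun k => bernsteinKnots (p k) (M.lo k) (M.hi k)) := by
  induction h with
  | tensor lo hi X hX =>
    refine descendants_tensorSplines_of_open hX fun k t _ _ u hu => ?_
    have := hM' k t u
    simp only [tensorMesh] at this
    rwa [if_pos (show u ∈ Set.Icc (lo k.rev) (hi k.rev) from hu)] at this
  | insert M S S' g hM hg hS ih =>
    rw [descendants_eq_of_path hM' hS.1 fun B hB => (hM.isOnMesh B hB).isKnotted]
    exact ih fun k t u => (M.mult_le_insert g k t u).trans (hM' k t u)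

/-- The LR B-splines are determined by the mesh. -/
theorem eq_descendants (h : IsLR p M S) :
    S = descendants M (tensorSplines p fun k => bernsteinKnots (p k) (M.lo k) (M.hi k)) := by
  rw [← h.descendants_eq fun _ _ _ => le_rfl, descendants_of_minimalSupport h.minimalSupport]

end IsLR

/-! ### Termination of knot insertion -/

/-- The number of knot insertions that are still possible in `B`. -/
def weight (T : Finset ℝ) (N : ℕ) (B : TBSpline) : ℕ :=
  ∑ k, ∑ t ∈ T, if B.first k < t ∧ t < B.last k then N - (B.knots k).count t else 0

/-- The support shrinks and the multiplicities of knots inside it do not decrease, so no term grows.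
The term of the inserted knot drops strictly: its local multiplicity was below that of the mesh,
hence below `N`. -/
theorem weight_lt_of_child {p : Fin 2 → ℕ} {M : Mesh} {T : Finset ℝ} {N : ℕ}
    (hTN : ∀ k t u, M.mult k t u ≤ N ∧ (M.mult k t u ≠ 0 → t ∈ T)) {B C : TBSpline}
    (hB : B.IsKnotted p) (hC : Child M B C) : weight T N C < weight T N B := by
  obtain ⟨k, t, hs, hC⟩ := hC
  have hr := child_range hB hs.1 hs.2.1 hC
  obtain ⟨hrev, mid, hmid, hk⟩ := child_knots hB hs.1 hs.2.1 hC
  have hcnt : ∀ x, B.first k < x → x < B.last k →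
      (B.knots k).count x + (if t = x then 1 else 0) ≤ (C.knots k).count x := by
    intro x h₁ h₂
    have e₁ : (B.knots k).count x = mid.count x := by
      rw [hmid, List.count_cons, List.count_append, List.count_singleton]
      simp [h₁.ne, h₂.ne']
    rw [e₁, ← count_ins]
    rcases hk with hk | hk <;> rw [hk]
    · exact (List.sublist_cons_self _ _).count_le x
    · exact (List.sublist_append_left _ _).count_le x
  have hlt := hs.2.2 (B.first k.rev) ⟨le_rfl, hB.first_le_last k.rev⟩
  have hb := hTN k t (B.first k.rev)
  have hle : ∀ x ∈ T,
      (if C.first k < x ∧ x < C.last k then N - (C.knots k).count x else 0) ≤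
        if B.first k < x ∧ x < B.last k then N - (B.knots k).count x else 0 := by
    intro x _
    by_cases hx : C.first k < x ∧ x < C.last k
    · have hx₁ := hr.1.trans_lt hx.1
      have hx₂ := hx.2.trans_le hr.2
      rw [if_pos hx, if_pos ⟨hx₁, hx₂⟩]
      have := hcnt x hx₁ hx₂
      omega
    · rw [if_neg hx]; exact Nat.zero_le _
  refine Finset.sum_lt_sum (fun j _ => ?_) ⟨k, Finset.mem_univ _, ?_⟩
  · by_cases hj : j = k
    · subst hj; exact Finset.sum_le_sum hle
    · obtain rfl := eq_rev_of_ne hj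
      rw [first, last, hrev]; rfl
  · refine Finset.sum_lt_sum hle ⟨t, hb.2 (by omega), ?_⟩
    rw [if_pos (⟨hs.1, hs.2.1⟩ : B.first k < t ∧ t < B.last k)]
    have := hcnt t hs.1 hs.2.1
    rw [if_pos rfl] at this
    split_ifs <;> omega

/-- Induction on the number of possible insertions. -/
theorem child_induction {p : Fin 2 → ℕ} {M : Mesh} {T : Finset ℝ} {N : ℕ}
    (hTN : ∀ k t u, M.mult k t u ≤ N ∧ (M.mult k t u ≠ 0 → t ∈ T)) {P : TBSpline → Prop}
    (hmin : ∀ B, B.IsKnotted p → MinimalSupport M B → P B)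
    (hskip : ∀ B k t, B.IsKnotted p → Skips M B k t → P (B.leftChild k t) →
      P (B.rightChild k t) → P B) (B : TBSpline) (hB : B.IsKnotted p) : P B := by
  induction hn : weight T N B using Nat.strong_induction_on generalizing B with
  | _ n ih =>
    subst hn
    by_cases hm : MinimalSupport M B
    · exact hmin B hB hm
    · simp only [MinimalSupport, not_forall, not_not] at hm
      obtain ⟨k, t, hs⟩ := hm
      exact hskip B k t hB hs
        (ih _ (weight_lt_of_child hTN hB ⟨k, t, hs, Or.inl rfl⟩) _ (hB.leftChild k t) rfl)
        (ih _ (weight_lt_of_child hTN hB ⟨k, t, hs, Or.inr rfl⟩) _ (hB.rightChild k t) rfl)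

theorem sum_insert_le {α : Type*} (s : Finset α) (a : α) (f : α → ℕ) :
    ∑ x ∈ insert a s, f x ≤ f a + ∑ x ∈ s, f x := by
  by_cases h : a ∈ s
  · rw [Finset.insert_eq_of_mem h]; omega
  · rw [Finset.sum_insert h]

/-- The knot insertion procedure terminates. -/
theorem exists_refines {p : Fin 2 → ℕ} {M : Mesh} {T : Finset ℝ} {N : ℕ}
    (hTN : ∀ k t u, M.mult k t u ≤ N ∧ (M.mult k t u ≠ 0 → t ∈ T)) (S : Finset TBSpline)
    (hS : ∀ B ∈ S, B.IsKnotted p) : ∃ S', Refines M (S : Set TBSpline) S' := by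
  induction hn : ∑ B ∈ S, 3 ^ weight T N B using Nat.strong_induction_on generalizing S with
  | _ n ih =>
    subst hn
    by_cases hm : ∀ B ∈ S, MinimalSupport M B
    · exact ⟨S, .refl, hm⟩
    · simp only [MinimalSupport, not_forall, not_not] at hm
      obtain ⟨B, hB, k, t, hs⟩ := hm
      have hr : Replace M (S : Set TBSpline)
          (insert (B.leftChild k t) (insert (B.rightChild k t) (S.erase B)) : Finset TBSpline) := by
        refine ⟨B, hB, k, t, hs, ?_⟩
        ext C
        simp only [Finset.coe_insert, Finset.coe_erase, Set.mem_insert_iff, Set.mem_union,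
          Set.mem_singleton_iff]
        tauto
      -- Base `3` pays for the branching: two children of smaller weight contribute at most two
      -- thirds of the term of `B`.
      have hlt : ∑ C ∈ insert (B.leftChild k t) (insert (B.rightChild k t) (S.erase B)),
          3 ^ weight T N C < ∑ C ∈ S, 3 ^ weight T N C := by
        refine (sum_insert_le _ _ _).trans_lt ?_
        refine (Nat.add_le_add_left (sum_insert_le _ _ _) _).trans_lt ?_
        rw [← Finset.add_sum_erase S _ hB]
        have h₁ := weight_lt_of_child hTN (hS B hB) ⟨k, t, hs, Or.inl rfl⟩
        have h₂ := weight_lt_of_child hTN (hS B hB) ⟨k, t, hs, Or.inr rfl⟩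
        have g₁ : 3 ^ (weight T N (B.leftChild k t) + 1) ≤ 3 ^ weight T N B :=
          Nat.pow_le_pow_right (by norm_num) h₁
        have g₂ : 3 ^ (weight T N (B.rightChild k t) + 1) ≤ 3 ^ weight T N B :=
          Nat.pow_le_pow_right (by norm_num) h₂
        have g₃ : 0 < 3 ^ weight T N B := by positivity
        rw [pow_succ] at g₁ g₂
        omega
      have hr' := hr.isKnotted (p := p) hS
      obtain ⟨S', hS', hmin⟩ := ih _ hlt _ hr' rfl
      exact ⟨S', hS'.head hr, hmin⟩

/-! ### Repeated knots and the passage from degree one to degree `2 * s + 1` -/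

/-- Every knot is repeated `r` times. -/
def repeatKnots (r : ℕ) (L : List ℝ) : List ℝ := L.flatMap (List.replicate r)

@[simp] theorem repeatKnots_nil (r : ℕ) : repeatKnots r [] = [] := rfl

theorem repeatKnots_cons (r : ℕ) (a : ℝ) (L : List ℝ) :
    repeatKnots r (a :: L) = List.replicate r a ++ repeatKnots r L := rfl

theorem repeatKnots_append (r : ℕ) (L L' : List ℝ) :
    repeatKnots r (L ++ L') = repeatKnots r L ++ repeatKnots r L' := List.flatMap_append

theorem count_repeatKnots (r : ℕ) (L : List ℝ) (t : ℝ) :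
    (repeatKnots r L).count t = r * L.count t := by
  induction L with
  | nil => simp
  | cons a L ih =>
    rw [repeatKnots_cons, List.count_append, ih, List.count_replicate, List.count_cons]
    by_cases h : a = t <;> simp [h, mul_add, add_comm]

theorem length_repeatKnots (r : ℕ) (L : List ℝ) : (repeatKnots r L).length = r * L.length := by
  induction L with
  | nil => simp
  | cons a L ih => rw [repeatKnots_cons]; simp [ih, mul_add, add_comm]

theorem mem_of_mem_repeatKnots {r : ℕ} {L : List ℝ} {t : ℝ} (h : t ∈ repeatKnots r L) : t ∈ L := by
  obtain ⟨a, ha, h⟩ := List.mem_flatMap.mp h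
  rwa [List.eq_of_mem_replicate h]

theorem mem_repeatKnots {r : ℕ} (hr : 0 < r) {L : List ℝ} {t : ℝ} (h : t ∈ L) :
    t ∈ repeatKnots r L :=
  List.mem_flatMap.mpr ⟨t, h, List.mem_replicate.mpr ⟨hr.ne', rfl⟩⟩

theorem sorted_repeatKnots (r : ℕ) {L : List ℝ} (h : L.Pairwise (· ≤ ·)) :
    (repeatKnots r L).Pairwise (· ≤ ·) := by
  induction L with
  | nil => simp
  | cons a L ih =>
    rw [List.pairwise_cons] at h
    rw [repeatKnots_cons, List.pairwise_append]
    refine ⟨List.pairwise_replicate.mpr (Or.inr le_rfl), ih h.2, fun x hx y hy => ?_⟩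
    rw [List.eq_of_mem_replicate hx]
    exact h.1 y (mem_of_mem_repeatKnots hy)

theorem repeatKnots_ins (r : ℕ) {L : List ℝ} (h : L.Pairwise (· ≤ ·)) (t : ℝ) :
    repeatKnots r (ins t L) = insAll (List.replicate r t) (repeatKnots r L) := by
  refine eq_of_perm_of_sorted ?_ (sorted_repeatKnots r (sorted_ins h t))
    (sorted_insAll _ (sorted_repeatKnots r h))
  rw [List.perm_iff_count]
  intro x
  rw [count_repeatKnots, count_ins, count_insAll, count_repeatKnots, List.count_replicate]
  by_cases hx : t = x <;> simp [hx, mul_add, add_comm]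

theorem ends_repeatKnots {r : ℕ} (hr : 0 < r) {L : List ℝ} (h : L.Pairwise (· ≤ ·))
    (h0 : L ≠ []) :
    (repeatKnots r L).headD 0 = L.headD 0 ∧ (repeatKnots r L).getLastD 0 = L.getLastD 0 :=
  ⟨headD_eq_of (sorted_repeatKnots r h) (mem_repeatKnots hr (headD_mem h0))
      fun _ hx => headD_le h (mem_of_mem_repeatKnots hx),
    getLastD_eq_of (sorted_repeatKnots r h) (mem_repeatKnots hr (getLastD_mem h0))
      fun _ hx => le_getLastD h (mem_of_mem_repeatKnots hx)⟩

theorem repeatKnots_infix (r : ℕ) {V L : List ℝ} (h : V <:+: L) :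
    repeatKnots r V <:+: repeatKnots r L := by
  obtain ⟨A, C, rfl⟩ := h
  rw [repeatKnots_append, repeatKnots_append]
  exact ⟨_, _, rfl⟩

/-- A window of `2 r + 1` repeated knots lies over three consecutive knots. -/
theorem exists_window_repeatKnots {r : ℕ} {W L : List ℝ} (h : W <:+: repeatKnots r L)
    (hW : W.length = 2 * r + 1) : ∃ V, V <:+: L ∧ V.length = 3 ∧ W <:+: repeatKnots r V := by
  induction L with
  | nil =>
    rw [repeatKnots_nil, List.infix_nil] at h
    simp [h] at hW
  | cons a L ih =>
    obtain ⟨A, C, h⟩ := h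
    -- If the window starts after the first block, that block is discarded. Otherwise at most `r -
    -- 1` entries precede it, so it ends within the first `3 * r` entries; as it has more than `2 *
    -- r` entries, at least three blocks exist.
    by_cases hA : r ≤ A.length
    · rw [repeatKnots_cons, List.append_assoc] at h
      have h' := congrArg (List.drop r) h
      rw [List.drop_append_of_le_length hA, List.drop_left' (by simp)] at h'
      obtain ⟨V, hV, hVl, hVW⟩ := ih ⟨A.drop r, C, by rw [← h', List.append_assoc]⟩
      exact ⟨V, hV.trans (List.suffix_cons a L).isInfix, hVl, hVW⟩
    · have hlen : (a :: L).length ≥ 3 := by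
        have := congrArg List.length h
        rw [length_repeatKnots, List.length_append, List.length_append, hW] at this
        by_contra hcon
        have : r * (a :: L).length ≤ r * 2 := Nat.mul_le_mul_left r (by omega)
        omega
      refine ⟨(a :: L).take 3, (List.take_prefix 3 _).isInfix, by rw [List.length_take]; omega, ?_⟩
      have h₁ : A ++ W <+: repeatKnots r (a :: L) := ⟨C, h⟩
      have h₂ : repeatKnots r ((a :: L).take 3) <+: repeatKnots r (a :: L) := by
        refine ⟨repeatKnots r ((a :: L).drop 3), ?_⟩
        rw [← repeatKnots_append, List.take_append_drop]
      have h₃ := List.prefix_of_prefix_length_le h₁ h₂ (by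
        rw [length_repeatKnots, List.length_take, min_eq_left hlen, List.length_append, hW]
        omega)
      exact (List.suffix_append A W).isInfix.trans h₃.isInfix

/-- The B-splines of degree `2 s + 1` that correspond to a B-spline of degree `1`. -/
def raised (s : ℕ) (B : TBSpline) : Set TBSpline :=
  tensorSplines (fun _ => 2 * s + 1) fun k => repeatKnots (s + 1) (B.knots k)

/-- Since `2 * s + 3 = 2 * (s + 1) + 1`, each long window lies over three consecutive original
knots, that is, over a degree-one B-spline. -/
theorem tensorSplines_repeatKnots (s : ℕ) (X : Fin 2 → List ℝ) :
    tensorSplines (fun _ => 2 * s + 1) (fun k => repeatKnots (s + 1) (X k)) =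
      ⋃ B ∈ tensorSplines (fun _ => 2 * 0 + 1) X, raised s B := by
  ext C
  simp only [Set.mem_iUnion, exists_prop]
  constructor
  · intro hC
    choose V hV hVl hW using fun k => exists_window_repeatKnots (hC k).1
      (by rw [(hC k).2]; ring)
    exact ⟨⟨V⟩, fun k => ⟨hV k, hVl k⟩, fun k => ⟨hW k, (hC k).2⟩⟩
  · rintro ⟨B, hB, hC⟩ k
    exact ⟨(hC k).1.trans (repeatKnots_infix _ (hB k).1), (hC k).2⟩

theorem headD_of_replicate_append {r : ℕ} {a : ℝ} {R A L : List ℝ}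
    (h : A ++ L = List.replicate r a ++ R) (hA : A.length < r) : L.headD 0 = a := by
  have h' := congrArg (List.drop A.length) h
  rw [List.drop_left, List.drop_append_of_le_length (by simp; omega), List.drop_replicate] at h'
  obtain ⟨n, hn⟩ := Nat.exists_eq_add_of_lt hA
  rw [h', show r - A.length = n + 1 by omega, List.replicate_succ]
  simp

theorem getLastD_of_append_replicate {r : ℕ} {a : ℝ} {R C L : List ℝ}
    (h : L ++ C = R ++ List.replicate r a) (hC : C.length < r) : L.getLastD 0 = a := by
  have hl := congrArg List.length h
  simp only [List.length_append, List.length_replicate] at hl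
  have h' := congrArg (List.take L.length) h
  obtain ⟨n, hn⟩ := Nat.exists_eq_add_of_lt hC
  rw [List.take_left, show L.length = R.length + (n + 1) by omega, List.take_length_add_append,
    List.take_replicate, min_eq_left (by omega), List.replicate_succ'] at h'
  rw [h', ← List.append_assoc, List.getLastD_concat]

theorem length_eq_three {B : TBSpline} (hB : B.IsKnotted fun _ => 2 * 0 + 1) (k : Fin 2) :
    (B.knots k).length = 3 := (hB k).2

theorem exists_three_knots {B : TBSpline} (hB : B.IsKnotted fun _ => 2 * 0 + 1) (k : Fin 2) :
    ∃ b, B.knots k = [B.first k, b, B.last k] := by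
  obtain ⟨mid, hmid⟩ := hB.exists_decomp k
  have hl := (hB k).2
  rw [hmid] at hl
  simp at hl
  obtain ⟨b, rfl⟩ := List.length_eq_one_iff.mp hl
  exact ⟨b, hmid⟩

/-- A window omits `3 * (s + 1) - (2 * s + 3) = s` entries in total, so it retains a copy from the
first block and one from the last. -/
theorem ends_of_mem_raised {s : ℕ} {B C : TBSpline} (hB : B.IsKnotted fun _ => 2 * 0 + 1)
    (hC : C ∈ raised s B) : C.first = B.first ∧ C.last = B.last := by
  rw [funext_iff, funext_iff, ← forall_and]
  intro k
  obtain ⟨b, hb⟩ := exists_three_knots hB k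
  obtain ⟨⟨A, D, h⟩, hl⟩ := hC k
  dsimp only at h hl
  have hlen := congrArg List.length h
  rw [length_repeatKnots, length_eq_three hB k, List.length_append, List.length_append, hl] at hlen
  rw [hb] at h
  have hC0 : C.knots k ≠ [] := by
    intro h
    rw [h] at hl
    simp at hl
  constructor
  · have := headD_of_replicate_append (r := s + 1) (a := B.first k) (A := A)
      (R := repeatKnots (s + 1) [b, B.last k]) (L := C.knots k ++ D)
      (by rw [← List.append_assoc, h, ← repeatKnots_cons]) (by omega)
    rwa [headD_append_of_ne_nil _ hC0] at this
  · have := getLastD_of_append_replicate (r := s + 1) (a := B.last k) (C := D)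
      (R := repeatKnots (s + 1) [B.first k, b]) (L := A ++ C.knots k)
      (by
        rw [h, show [B.first k, b, B.last k] = [B.first k, b] ++ [B.last k] from rfl,
          repeatKnots_append, repeatKnots_cons _ (B.last k), repeatKnots_nil, List.append_nil])
      (by omega)
    rwa [getLastD_append_of_ne_nil _ hC0] at this

/-- The window reaches both ends of the support, so it contains every copy of an inner knot. Skipped
lines in the two degrees can thus be compared. -/
theorem count_of_mem_raised {s : ℕ} {B C : TBSpline} (hB : B.IsKnotted fun _ => 2 * 0 + 1)
    (hC : C ∈ raised s B) {k : Fin 2} {t : ℝ} (h₁ : B.first k < t) (h₂ : t < B.last k) :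
    (C.knots k).count t = (s + 1) * (B.knots k).count t := by
  obtain ⟨e₁, e₂⟩ := ends_of_mem_raised hB hC
  rw [← count_repeatKnots, count_eq_of_infix (sorted_repeatKnots _ (hB k).1) (hC k).1]
  · have := e₁ ▸ h₁; exact this
  · have := e₂ ▸ h₂; exact this

theorem raised_nonempty (s : ℕ) {B : TBSpline} (hB : B.IsKnotted fun _ => 2 * 0 + 1) :
    (raised s B).Nonempty := by
  refine ⟨⟨fun k => (repeatKnots (s + 1) (B.knots k)).take (2 * s + 3)⟩, fun k => ?_⟩
  refine ⟨(List.take_prefix _ _).isInfix, ?_⟩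
  rw [List.length_take, length_repeatKnots, length_eq_three hB k]
  dsimp only
  omega

/-- In each direction a window is determined by its offset, one of `0, …, s`. The upper bound
suffices, since the dimension count supplies the opposite inequality. -/
theorem ncard_raised_le (s : ℕ) {B : TBSpline} (hB : B.IsKnotted fun _ => 2 * 0 + 1) :
    (raised s B).Finite ∧ (raised s B).ncard ≤ (s + 1) ^ 2 := by
  set f : ℕ × ℕ → TBSpline := fun i =>
    ⟨![((repeatKnots (s + 1) (B.knots 0)).drop i.1).take (2 * s + 3),
      ((repeatKnots (s + 1) (B.knots 1)).drop i.2).take (2 * s + 3)]⟩ with hf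
  have hsub : raised s B ⊆ ((Finset.range (s + 1) ×ˢ Finset.range (s + 1)).image f : Finset _) := by
    intro C hC
    have : ∀ k, ∃ i < s + 1,
        C.knots k = ((repeatKnots (s + 1) (B.knots k)).drop i).take (2 * s + 3) := by
      intro k
      obtain ⟨⟨A, D, h⟩, hl⟩ := hC k
      dsimp only at h hl
      have hlen := congrArg List.length h
      rw [length_repeatKnots, length_eq_three hB k, List.length_append, List.length_append, hl] at hlen
      refine ⟨A.length, by omega, ?_⟩
      rw [← h, List.append_assoc, List.drop_left, List.take_left' hl]
    obtain ⟨i, hi, hi'⟩ := this 0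
    obtain ⟨j, hj, hj'⟩ := this 1
    rw [Finset.mem_coe, Finset.mem_image]
    refine ⟨(i, j), by simp [hi, hj], ?_⟩
    refine TBSpline.ext ?_
    funext k
    fin_cases k
    · exact hi'.symm
    · exact hj'.symm
  refine ⟨(Finset.finite_toSet _).subset hsub, ?_⟩
  refine (Set.ncard_le_ncard hsub (Finset.finite_toSet _)).trans ?_
  rw [Set.ncard_coe_finset]
  refine Finset.card_image_le.trans ?_
  rw [Finset.card_product, Finset.card_range, pow_two]

theorem infix_of_length_succ {V L : List ℝ} (h : V <:+: L) (hl : L.length = V.length + 1) :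
    V = L.dropLast ∨ V = L.tail := by
  obtain ⟨A, C, rfl⟩ := h
  rw [List.length_append, List.length_append] at hl
  rcases A with _ | ⟨a, A⟩
  · obtain ⟨c, rfl⟩ := List.length_eq_one_iff.mp (show C.length = 1 by simp at hl; omega)
    left; simp
  · rw [List.length_cons] at hl
    obtain rfl := List.length_eq_zero_iff.mp (show A.length = 0 by omega)
    obtain rfl := List.length_eq_zero_iff.mp (show C.length = 0 by omega)
    right; simp

/-- Insertion of a knot in degree one corresponds to an `(s + 1)`-fold insertion. -/
theorem descendants_raised_of_skips {s : ℕ} {M : Mesh} {B : TBSpline}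
    (hB : B.IsKnotted fun _ => 2 * 0 + 1) {k : Fin 2} {t : ℝ} (h₁ : B.first k < t)
    (h₂ : t < B.last k)
    (hM : ∀ u ∈ Set.Icc (B.first k.rev) (B.last k.rev),
      (s + 1) * ((B.knots k).count t + 1) ≤ M.mult k t u) :
    descendants M (raised s (B.leftChild k t) ∪ raised s (B.rightChild k t)) =
      descendants M (raised s B) := by
  have hends : ∀ j, (repeatKnots (s + 1) (B.knots j)).headD 0 = B.first j ∧
      (repeatKnots (s + 1) (B.knots j)).getLastD 0 = B.last j :=
    fun j => ends_repeatKnots (Nat.succ_pos s) (hB j).1 (hB.ne_nil j)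
  -- Only the middle one of the three knots can equal `t`, so `s + 1` further copies keep the
  -- multiplicity at most `2 * (s + 1)`, the largest allowed in degree `2 * s + 1`.
  have hc1 : (B.knots k).count t ≤ 1 := by
    obtain ⟨b, hb⟩ := exists_three_knots hB k
    rw [hb]
    simp only [List.count_cons, List.count_nil, beq_iff_eq, h₁.ne, h₂.ne', if_false]
    split_ifs <;> omega
  have hY : (fun j => repeatKnots (s + 1) (Function.update B.knots k (ins t (B.knots k)) j)) =
      Function.update (fun j => repeatKnots (s + 1) (B.knots j)) k
        (insAll (List.replicate (s + 1) t) (repeatKnots (s + 1) (B.knots k))) := by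
    funext j
    by_cases hj : j = k
    · subst hj; rw [Function.update_self, Function.update_self, repeatKnots_ins _ (hB j).1]
    · rw [Function.update_of_ne hj, Function.update_of_ne hj]
  have hunion : raised s (B.leftChild k t) ∪ raised s (B.rightChild k t) =
      tensorSplines (fun _ => 2 * s + 1) (Function.update
        (fun j => repeatKnots (s + 1) (B.knots j)) k
        (insAll (List.replicate (s + 1) t) (repeatKnots (s + 1) (B.knots k)))) := by
    rw [← hY, tensorSplines_repeatKnots]
    -- After the insertion there are four knots in direction `k` and three in the other, so the only
    -- windows are the two children.
    have : tensorSplines (fun _ => 2 * 0 + 1)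
        (Function.update B.knots k (ins t (B.knots k))) =
          {B.leftChild k t, B.rightChild k t} := by
      ext C
      constructor
      · intro hC
        have hk := hC k
        have hr := hC k.rev
        rw [Function.update_self] at hk
        rw [Function.update_of_ne (rev_ne k)] at hr
        have hr' : C.knots k.rev = B.knots k.rev :=
          hr.1.sublist.eq_of_length (by rw [hr.2, (hB k.rev).2])
        rcases infix_of_length_succ hk.1 (by
          rw [List.orderedInsert_length, hk.2, (hB k).2]) with h | h
        · left
          refine ext_knots k ?_ ?_
          · rw [h, leftChild_eq, knots_setKnots_self]
          · rw [hr', leftChild_eq, knots_setKnots_rev]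
        · right
          refine ext_knots k ?_ ?_
          · rw [h, rightChild_eq, knots_setKnots_self]
          · rw [hr', rightChild_eq, knots_setKnots_rev]
      · rintro (rfl | rfl) j
        · refine ⟨?_, (hB.leftChild k t j).2⟩
          by_cases hj : j = k
          · subst hj
            rw [leftChild_eq, knots_setKnots_self, Function.update_self]
            exact (List.dropLast_prefix _).isInfix
          · rw [leftChild_eq, knots_setKnots_of_ne _ hj, Function.update_of_ne hj]
        · refine ⟨?_, (hB.rightChild k t j).2⟩
          by_cases hj : j = k
          · subst hj
            rw [rightChild_eq, knots_setKnots_self, Function.update_self]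
            exact (List.tail_suffix _).isInfix
          · rw [rightChild_eq, knots_setKnots_of_ne _ hj, Function.update_of_ne hj]
    rw [this, Set.biUnion_pair]
  rw [hunion, raised]
  refine descendants_tensorSplines_insAll (fun j => sorted_repeatKnots _ (hB j).1) ?_ _ ?_ ?_ ?_
  · rw [length_repeatKnots, length_eq_three hB k]; omega
  · intro x hx
    rw [List.eq_of_mem_replicate hx, (hends k).1, (hends k).2]
    exact ⟨h₁, h₂⟩
  · intro x hx
    rw [List.eq_of_mem_replicate hx, List.count_replicate_self, count_repeatKnots]
    have := Nat.mul_le_mul_left (s + 1) hc1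
    omega
  · intro x hx u hu
    rw [List.eq_of_mem_replicate hx, List.count_replicate_self, count_repeatKnots]
    rw [(hends _).1, (hends _).2] at hu
    have := hM u hu
    rw [mul_add] at this
    omega

theorem IsOpenKnotVector.repeatKnots {s : ℕ} {a b : ℝ} {l : List ℝ}
    (h : IsOpenKnotVector (2 * 0 + 1) a b l) :
    IsOpenKnotVector (2 * s + 1) a b (repeatKnots (s + 1) l) where
  lt := h.lt
  sorted := sorted_repeatKnots _ h.sorted
  mem_Icc t ht := h.mem_Icc t (mem_of_mem_repeatKnots ht)
  count_left := by rw [count_repeatKnots, h.count_left]; ring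
  count_right := by rw [count_repeatKnots, h.count_right]; ring
  count_le t := by
    rw [count_repeatKnots]
    refine (Nat.mul_le_mul_left _ (h.count_le t)).trans (le_of_eq (by ring))

/-- The degree-one construction is followed step by step: an initial mesh becomes one with repeated
knots, and each replacement becomes an `(s + 1)`-fold insertion, which `M'` permits. Only internal
lines matter, because a skipped line lies strictly inside a support. -/
theorem descendants_iUnion_raised {M M' : Mesh} {S : Set TBSpline} {s : ℕ}
    (h : IsLR (fun _ => 2 * 0 + 1) M S)
    (hM : ∀ k t u, M.lo k < t → t < M.hi k → (s + 1) * M.mult k t u ≤ M'.mult k t u) :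
    descendants M' (⋃ B ∈ S, raised s B) =
      descendants M' (tensorSplines (fun _ => 2 * s + 1)
        fun k => bernsteinKnots (2 * s + 1) (M.lo k) (M.hi k)) := by
  induction h with
  | tensor lo hi X hX =>
    rw [← tensorSplines_repeatKnots]
    refine descendants_tensorSplines_of_open (fun k => (hX k).repeatKnots) fun k t h₁ h₂ u hu => ?_
    rw [count_repeatKnots]
    have := hM k t u h₁ h₂
    simp only [tensorMesh] at this
    rwa [if_pos (show u ∈ Set.Icc (lo k.rev) (hi k.rev) from hu)] at this
  | insert M S S' g hM₀ hg hS ih =>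
    refine Eq.trans ?_ (ih fun k t u h₁ h₂ =>
      (Nat.mul_le_mul_left _ (M.mult_le_insert g k t u)).trans (hM k t u h₁ h₂))
    have hon : ∀ B ∈ S, IsOnMesh (fun _ => 2 * 0 + 1) (M.insert g) B :=
      fun B hB => (hM₀.isOnMesh B hB).mono rfl rfl (M.mult_le_insert g)
    obtain ⟨hS, -⟩ := hS
    induction hS with
    | refl => rfl
    | tail hp hr ih' =>
      rw [← ih']
      have hon' := forall_of_refines_path (fun B C hB hC => hB.child hC) hp hon
      obtain ⟨B, hB, k, t, hs, rfl⟩ := hr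
      have hBm := hon' B hB
      -- The B-spline being replaced is split off from the union; the others contribute equally on
      -- both sides.
      conv_rhs => rw [← Set.insert_eq_of_mem hB, ← Set.insert_sdiff_singleton]
      rw [Set.biUnion_union, Set.biUnion_pair, Set.biUnion_insert, descendants_union,
        descendants_raised_of_skips hBm.isKnotted hs.1 hs.2.1, ← descendants_union, Set.union_comm]
      intro u hu
      have h₁ : M.lo k ≤ _ := (hBm.mem k _ (hBm.isKnotted.first_mem k)).1
      have h₂ : _ ≤ M.hi k := (hBm.mem k _ (hBm.isKnotted.last_mem k)).2
      exact (Nat.mul_le_mul_left _ (hs.2.2 u hu)).trans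
        (hM k t u (h₁.trans_lt hs.1) (hs.2.1.trans_le h₂))

/-! ### The raised mesh and its LR B-splines -/

section Raise

variable {M : Mesh} {s : ℕ}

/-- For multiplicities `0` and `1`, adding `s` where a line exists is the same as multiplying by `s
+ 1`, which is how knot repetition acts. -/
theorem raise_mult_of_internal (hint : ∀ k t u, M.lo k < t → t < M.hi k → M.mult k t u ≤ 1)
    {k : Fin 2} {t : ℝ} (u : ℝ) (h₁ : M.lo k < t) (h₂ : t < M.hi k) :
    (M.raise s).mult k t u = (s + 1) * M.mult k t u := by
  have := hint k t u h₁ h₂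
  simp only [Mesh.raise, h₁.ne', h₂.ne, or_self, if_false]
  split_ifs with h0
  · rw [h0]; rfl
  · rw [show M.mult k t u = 1 by omega]; ring

theorem raise_mult_pos {k : Fin 2} {t u : ℝ} :
    0 < (M.raise s).mult k t u ↔ 0 < M.mult k t u := by
  simp only [Mesh.raise]
  split_ifs <;> omega

/-- The LR B-splines on the raised mesh. -/
theorem IsLR.eq_iUnion_raised {S S' : Set TBSpline} (h : IsLR (fun _ => 2 * 0 + 1) M S)
    (hint : ∀ k t u, M.lo k < t → t < M.hi k → M.mult k t u ≤ 1)
    (h' : IsLR (fun _ => 2 * s + 1) (M.raise s) S') : S' = ⋃ B ∈ S, raised s B := by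
  have hD := descendants_iUnion_raised (M' := M.raise s) (s := s) h
    fun k t u h₁ h₂ => (raise_mult_of_internal hint u h₁ h₂).ge
  rw [h'.eq_descendants]
  -- It remains to see that the union has minimal support. A line skipped by a raised B-spline
  -- would, after cancelling the factor `s + 1`, be skipped by its parent.
  refine hD.symm.trans (descendants_of_minimalSupport ?_)
  intro C hC k t hs
  simp only [Set.mem_iUnion, exists_prop] at hC
  obtain ⟨B, hB, hC⟩ := hC
  have hBm := h.isOnMesh B hB
  obtain ⟨e₁, e₂⟩ := ends_of_mem_raised hBm.isKnotted hC
  obtain ⟨h₁, h₂, h₃⟩ := hs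
  rw [e₁, e₂] at h₃
  rw [e₁] at h₁
  rw [e₂] at h₂
  refine h.minimalSupport B hB k t ⟨h₁, h₂, fun u hu => ?_⟩
  have := h₃ u hu
  rw [count_of_mem_raised hBm.isKnotted hC h₁ h₂, raise_mult_of_internal hint u
    ((hBm.mem k _ (hBm.isKnotted.first_mem k)).1.trans_lt h₁)
    (h₂.trans_le (hBm.mem k _ (hBm.isKnotted.last_mem k)).2)] at this
  exact lt_of_mul_lt_mul_left this (Nat.zero_le _)

/-- On the boundary too, raising multiplies by `s + 1`, because `2 + 2 * s = 2 * (s + 1)`. -/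
theorem raise_tensorMesh {lo hi : Fin 2 → ℝ} {X : Fin 2 → List ℝ}
    (hX : ∀ k, IsOpenKnotVector (2 * 0 + 1) (lo k) (hi k) (X k))
    (hint : ∀ k t u, lo k < t → t < hi k → (tensorMesh lo hi X).mult k t u ≤ 1) :
    (tensorMesh lo hi X).raise s = tensorMesh lo hi fun k => repeatKnots (s + 1) (X k) := by
  refine Mesh.ext rfl rfl ?_
  funext k t u
  by_cases hu : u ∈ Set.Icc (lo k.rev) (hi k.rev)
  · have hm : ∀ Y : Fin 2 → List ℝ, (tensorMesh lo hi Y).mult k t u = (Y k).count t :=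
      fun Y => if_pos hu
    rw [hm]
    by_cases hb : t = lo k ∨ t = hi k
    · have hc : (X k).count t = 2 := by
        rcases hb with rfl | rfl
        · exact (hX k).count_left
        · exact (hX k).count_right
      simp only [Mesh.raise]
      rw [hm, hc, if_neg (by norm_num), if_pos (show t = (tensorMesh lo hi X).lo k ∨ t = (tensorMesh lo hi X).hi k from hb), count_repeatKnots, hc]
      ring
    · by_cases hin : lo k < t ∧ t < hi k
      · rw [raise_mult_of_internal hint u hin.1 hin.2, hm, count_repeatKnots]
      · have hc : (X k).count t = 0 := List.count_eq_zero_of_not_mem fun h => by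
          have := (hX k).mem_Icc t h
          push Not at hb hin
          exact absurd (lt_of_le_of_ne this.2 hb.2)
            (not_lt.mpr (hin (lt_of_le_of_ne this.1 hb.1.symm)))
        simp only [Mesh.raise]
        rw [hm, hc, if_pos rfl, count_repeatKnots, hc, mul_zero]
  · have hm : ∀ Y : Fin 2 → List ℝ, (tensorMesh lo hi Y).mult k t u = 0 :=
      fun Y => if_neg hu
    rw [hm]
    simp only [Mesh.raise]
    rw [hm, if_pos rfl]

/-- Internal multiplicities are at most one after the insertion, so the segment has multiplicity one
and becomes a segment of multiplicity `s + 1`. Where it overlaps an existing line, that line already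
has this multiplicity. -/
theorem raise_insert {g : Meshline} (h₁ : M.lo g.dir < g.pos) (h₂ : g.pos < M.hi g.dir)
    (hone : 1 ≤ g.mul)
    (hint : ∀ k t u, M.lo k < t → t < M.hi k → (M.insert g).mult k t u ≤ 1) :
    (M.insert g).raise s = (M.raise s).insert { g with mul := s + 1 } := by
  refine Mesh.ext rfl rfl ?_
  funext k t u
  by_cases hc : k = g.dir ∧ t = g.pos ∧ u ∈ Set.Icc g.beg g.fin
  · obtain ⟨rfl, rfl, hu⟩ := hc
    rw [raise_mult_of_internal (M := M.insert g) hint u h₁ h₂]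
    have e := hint g.dir g.pos u h₁ h₂
    have e₁ : (M.insert g).mult g.dir g.pos u = max (M.mult g.dir g.pos u) g.mul :=
      if_pos ⟨rfl, rfl, hu⟩
    have e₂ : ((M.raise s).insert { g with mul := s + 1 }).mult g.dir g.pos u =
      max ((M.raise s).mult g.dir g.pos u) (s + 1) := if_pos ⟨rfl, rfl, hu⟩
    have e₃ : (M.raise s).mult g.dir g.pos u ≤ s + 1 := by
      have := M.mult_le_insert g g.dir g.pos u
      rw [raise_mult_of_internal
        (fun k t u h h' => (M.mult_le_insert g k t u).trans (hint k t u h h')) u h₁ h₂]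
      calc (s + 1) * M.mult g.dir g.pos u ≤ (s + 1) * 1 := Nat.mul_le_mul_left _ (this.trans e)
        _ = s + 1 := mul_one _
    rw [e₂, max_eq_right e₃]
    rw [show (M.insert g).mult g.dir g.pos u = 1 by
      have := le_max_right (M.mult g.dir g.pos u) g.mul
      omega, mul_one]
  · have e₁ : (M.insert g).mult k t u = M.mult k t u := if_neg hc
    have e₂ : ((M.raise s).insert { g with mul := s + 1 }).mult k t u = (M.raise s).mult k t u :=
      if_neg hc
    rw [e₂]
    simp only [Mesh.raise, e₁]
    rfl

theorem traverses_raise {k : Fin 2} {t : ℝ} {B C : TBSpline} (h₁ : C.first = B.first)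
    (h₂ : C.last = B.last) : Traverses (M.raise s) k t C ↔ Traverses M k t B := by
  simp only [Traverses, raise_mult_pos, h₁, h₂]

/-- The raised mesh is an LR mesh. -/
theorem IsLR.exists_raise {S : Set TBSpline} (h : IsLR (fun _ => 2 * 0 + 1) M S)
    (hint : ∀ k t u, M.lo k < t → t < M.hi k → M.mult k t u ≤ 1) (s : ℕ) :
    ∃ S', IsLR (fun _ => 2 * s + 1) (M.raise s) S' := by
  induction h with
  | tensor lo hi X hX =>
    rw [raise_tensorMesh hX hint]
    exact ⟨_, IsLR.tensor lo hi _ fun k => (hX k).repeatKnots⟩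
  | insert M S S₁ g hM hg hS ih =>
    have hint' : ∀ k t u, M.lo k < t → t < M.hi k → M.mult k t u ≤ 1 := fun k t u h₁ h₂ =>
      (M.mult_le_insert g k t u).trans (hint k t u h₁ h₂)
    obtain ⟨S', hS'⟩ := ih hint'
    have hr := raise_insert (s := s) hg.lo_lt hg.lt_hi hg.one_le hint
    have hcan : CanInsert (fun _ => 2 * s + 1) (M.raise s) S' { g with mul := s + 1 } := by
      refine ⟨hg.lo_lt, hg.lt_hi, hg.lo_le, hg.beg_lt, hg.le_hi, raise_mult_pos.mpr hg.beg_mem,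
        raise_mult_pos.mpr hg.fin_mem, by simp, by simp; omega, ?_⟩
      refine hg.new_or_old.imp ?_ (fun h u hu => raise_mult_pos.mpr (h u hu))
      rintro ⟨B, hB, hB₁, hB₂⟩
      have hBk := (hM.isOnMesh B hB).isKnotted
      -- Any raised B-spline of `B` is a witness for the newly traversed support, because it has the
      -- same support.
      obtain ⟨C, hC⟩ := raised_nonempty s hBk
      obtain ⟨e₁, e₂⟩ := ends_of_mem_raised hBk hC
      refine ⟨C, ?_, ?_, ?_⟩
      · rw [hM.eq_iUnion_raised hint' hS']
        simp only [Set.mem_iUnion, exists_prop]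
        exact ⟨B, hB, hC⟩
      · rw [← hr]
        exact (traverses_raise e₁ e₂).mpr hB₁
      · exact fun h => hB₂ ((traverses_raise e₁ e₂).mp h)
    obtain ⟨T, N, hTN⟩ := hS'.exists_mult_bound
    obtain ⟨S'', hS''⟩ := exists_refines (p := fun _ => 2 * s + 1)
      (M := (M.raise s).insert { g with mul := s + 1 }) (T := {g.pos} ∪ T) (N := max N (s + 1))
      (mult_bound_insert hTN _)
      hS'.finite.toFinset (fun B hB => (hS'.isOnMesh B (by simpa using hB)).isKnotted)
    rw [Set.Finite.coe_toFinset] at hS''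
    rw [hr]
    exact ⟨S'', IsLR.insert _ _ _ _ hS' hcan hS''⟩

end Raise

/-! ### Univariate B-splines: support, positivity and polynomial pieces -/

theorem bspline_congr {p : ℕ} {t t' : ℕ → ℝ} (h : ∀ i ≤ p + 1, t i = t' i) (x : ℝ) :
    bspline p t x = bspline p t' x := by
  induction p generalizing t t' with
  | zero => simp only [bspline, h 0 (by omega), h 1 (by omega)]
  | succ p ih =>
    simp only [bspline]
    rw [ih (t := t) (t' := t') (fun i hi => h i (by omega)),
      ih (t := fun i => t (i + 1)) (t' := fun i => t' (i + 1)) (fun i hi => h (i + 1) (by omega)),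
      h 0 (by omega), h 1 (by omega), h (p + 1) (by omega), h (p + 2) (by omega)]

theorem le_of_chain {p : ℕ} {t : ℕ → ℝ} (h : ∀ i ≤ p, t i ≤ t (i + 1)) {i j : ℕ} (hij : i ≤ j)
    (hj : j ≤ p + 1) : t i ≤ t j := by
  induction j, hij using Nat.le_induction with
  | base => exact le_rfl
  | succ j hij ih => exact (ih (by omega)).trans (h j (by omega))

/-- The support is half-open, as in degree zero; in particular the B-spline vanishes identically
when its end knots coincide. -/
theorem bspline_eq_zero {p : ℕ} {t : ℕ → ℝ} (h : ∀ i ≤ p, t i ≤ t (i + 1)) {x : ℝ}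
    (hx : x < t 0 ∨ t (p + 1) ≤ x) : bspline p t x = 0 := by
  induction p generalizing t with
  | zero =>
    simp only [bspline]
    rw [if_neg]
    rintro ⟨h₁, h₂⟩
    rcases hx with hx | hx
    · exact absurd hx (not_lt.mpr h₁)
    · exact absurd h₂ (not_lt.mpr hx)
  | succ p ih =>
    simp only [bspline]
    rw [ih (fun i hi => h i (by omega)) (hx.imp id fun hx => (h (p + 1) (by omega)).trans hx),
      ih (t := fun i => t (i + 1)) (fun i hi => h (i + 1) (by omega))
        (hx.imp (fun hx => hx.trans_le (h 0 (by omega))) id)]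
    ring

theorem bspline_nonneg {p : ℕ} {t : ℕ → ℝ} (h : ∀ i ≤ p, t i ≤ t (i + 1)) (x : ℝ) :
    0 ≤ bspline p t x := by
  induction p generalizing t with
  | zero => simp only [bspline]; split_ifs <;> norm_num
  | succ p ih =>
    have h₁ : ∀ i ≤ p, t i ≤ t (i + 1) := fun i hi => h i (by omega)
    have h₂ : ∀ i ≤ p, t (i + 1) ≤ t (i + 1 + 1) := fun i hi => h (i + 1) (by omega)
    simp only [bspline]
    by_cases hx : x < t 0 ∨ t (p + 2) ≤ x
    · exact (bspline_eq_zero (p := p + 1) h hx).ge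
    · push Not at hx
      have d₁ := le_of_chain h (i := 0) (j := p + 1) (by omega) (by omega)
      have d₂ := le_of_chain h (i := 1) (j := p + 2) (by omega) (by omega)
      exact add_nonneg
        (mul_nonneg (div_nonneg (sub_nonneg.mpr hx.1) (sub_nonneg.mpr d₁)) (ih h₁))
        (mul_nonneg (div_nonneg (sub_nonneg.mpr hx.2.le) (sub_nonneg.mpr d₂))
          (ih (t := fun i => t (i + 1)) h₂))

/-- Both recursion terms are nonnegative. To the left of `t (p + 1)` the first is positive by
induction, to the right of it the second; the point itself is excluded as a knot. -/
theorem bspline_pos {p : ℕ} {t : ℕ → ℝ} (h : ∀ i ≤ p, t i ≤ t (i + 1)) {x : ℝ}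
    (hx : ∀ i ≤ p + 1, x ≠ t i) (h₀ : t 0 < x) (h₁ : x < t (p + 1)) : 0 < bspline p t x := by
  induction p generalizing t with
  | zero => simp only [bspline]; rw [if_pos ⟨h₀.le, h₁⟩]; norm_num
  | succ p ih =>
    have m₁ : ∀ i ≤ p, t i ≤ t (i + 1) := fun i hi => h i (by omega)
    have m₂ : ∀ i ≤ p, t (i + 1) ≤ t (i + 1 + 1) := fun i hi => h (i + 1) (by omega)
    have d₁ := le_of_chain h (i := 0) (j := p + 1) (by omega) (by omega)
    have d₂ := le_of_chain h (i := 1) (j := p + 2) (by omega) (by omega)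
    have n₁ := bspline_nonneg m₁ x
    have n₂ := bspline_nonneg (t := fun i => t (i + 1)) m₂ x
    simp only [bspline]
    rcases lt_or_gt_of_ne (hx (p + 1) (by omega)) with hlt | hgt
    · have := ih m₁ (fun i hi => hx i (by omega)) h₀ hlt
      exact add_pos_of_pos_of_nonneg
        (mul_pos (div_pos (sub_pos.mpr h₀) (sub_pos.mpr (h₀.trans hlt))) this)
        (mul_nonneg (div_nonneg (sub_nonneg.mpr h₁.le) (sub_nonneg.mpr d₂)) n₂)
    · have hx1 : t 1 < x :=
        (le_of_chain h (i := 1) (j := p + 1) (by omega) (by omega)).trans_lt hgt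
      have := ih (t := fun i => t (i + 1)) m₂ (fun i hi => hx (i + 1) (by omega)) hx1 h₁
      exact add_pos_of_nonneg_of_pos
        (mul_nonneg (div_nonneg (sub_nonneg.mpr h₀.le) (sub_nonneg.mpr d₁)) n₁)
        (mul_pos (div_pos (sub_pos.mpr h₁) (sub_pos.mpr (hx1.trans h₁))) this)

open Polynomial in
/-- Between two consecutive knots a B-spline is a polynomial. -/
theorem exists_polynomial_bspline (p : ℕ) {t : ℕ → ℝ} {c d : ℝ}
    (ht : ∀ i ≤ p + 1, t i ∉ Set.Ioo c d) :
    ∃ P : ℝ[X], P.natDegree ≤ p ∧ ∀ x ∈ Set.Ioo c d, bspline p t x = P.eval x := by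
  induction p generalizing t with
  | zero =>
    refine ⟨C (if t 0 ≤ c ∧ d ≤ t 1 then 1 else 0), (natDegree_C _).le, fun x hx => ?_⟩
    simp only [bspline, eval_C]
    have h₀ := ht 0 (by omega)
    have h₁ := ht 1 (by omega)
    simp only [Set.mem_Ioo, not_and_or, not_lt] at h₀ h₁ hx
    have e₀ : t 0 ≤ x ↔ t 0 ≤ c := by
      constructor
      · intro h; exact h₀.elim id fun h' => by linarith
      · intro h; linarith
    have e₁ : x < t 1 ↔ d ≤ t 1 := by
      constructor
      · intro h; exact h₁.elim (fun h' => by linarith) id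
      · intro h; linarith
    simp only [e₀, e₁]
  | succ p ih =>
    obtain ⟨P, hP, hP'⟩ := ih (t := t) fun i hi => ht i (by omega)
    obtain ⟨Q, hQ, hQ'⟩ := ih (t := fun i => t (i + 1)) fun i hi => ht (i + 1) (by omega)
    refine ⟨C (1 / (t (p + 1) - t 0)) * (X - C (t 0)) * P +
      C (1 / (t (p + 2) - t 1)) * (C (t (p + 2)) - X) * Q, ?_, fun x hx => ?_⟩
    · refine natDegree_add_le_of_degree_le ?_ ?_
      · refine natDegree_mul_le.trans ?_
        have : (C (1 / (t (p + 1) - t 0)) * (X - C (t 0))).natDegree ≤ 1 :=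
          (natDegree_C_mul_le _ _).trans (natDegree_X_sub_C_le _)
        omega
      · refine natDegree_mul_le.trans ?_
        have : (C (1 / (t (p + 2) - t 1)) * (C (t (p + 2)) - X)).natDegree ≤ 1 := by
          refine (natDegree_C_mul_le _ _).trans ?_
          refine (natDegree_sub_le _ _).trans ?_
          simp
        omega
    · simp only [bspline, hP' x hx, hQ' x hx, eval_add, eval_mul, eval_C, eval_sub, eval_X]
      ring

/-! ### The knot insertion formula -/

/-- The B-spline divided by the length of its support. -/
def scaledBspline (p : ℕ) (t : ℕ → ℝ) (x : ℝ) : ℝ := bspline p t x / (t (p + 1) - t 0)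

theorem scaledBspline_congr {p : ℕ} {t t' : ℕ → ℝ} (h : ∀ i ≤ p + 1, t i = t' i) (x : ℝ) :
    scaledBspline p t x = scaledBspline p t' x := by
  rw [scaledBspline, scaledBspline, bspline_congr h, h 0 (by omega), h (p + 1) le_rfl]

theorem scaledBspline_of_const {p : ℕ} {t : ℕ → ℝ} {c : ℝ} (h : ∀ i ≤ p + 1, t i = c) (x : ℝ) :
    scaledBspline p t x = 0 := by
  rw [scaledBspline, h 0 (by omega), h (p + 1) le_rfl, sub_self, div_zero]

/-- Nothing is lost by dividing by a vanishing support length, because the B-spline is then zero. -/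
theorem mul_scaledBspline {p : ℕ} {t : ℕ → ℝ} (h : ∀ i ≤ p, t i ≤ t (i + 1)) (x : ℝ) :
    (t (p + 1) - t 0) * scaledBspline p t x = bspline p t x := by
  by_cases h0 : t (p + 1) - t 0 = 0
  · rw [h0, zero_mul, bspline_eq_zero h]
    rcases lt_or_ge x (t 0) with hx | hx
    · exact Or.inl hx
    · right; linarith
  · rw [scaledBspline, mul_div_cancel₀ _ h0]

/-- In this normalisation the Cox–de Boor recursion has no denominators. -/
theorem mul_scaledBspline_succ {p : ℕ} {t : ℕ → ℝ} (h : ∀ i ≤ p + 1, t i ≤ t (i + 1)) (x : ℝ) :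
    (t (p + 2) - t 0) * scaledBspline (p + 1) t x =
      (x - t 0) * scaledBspline p t x +
        (t (p + 2) - x) * scaledBspline p (fun i => t (i + 1)) x := by
  rw [mul_scaledBspline (p := p + 1) h, bspline, scaledBspline, scaledBspline]
  ring

/-- The sequence without its entry of index `j`. -/
def skipIndex (j : ℕ) (t : ℕ → ℝ) (i : ℕ) : ℝ := t (if i < j then i else i + 1)

theorem skipIndex_chain {p j : ℕ} {t : ℕ → ℝ} (h : ∀ i ≤ p + 1, t i ≤ t (i + 1)) :
    ∀ i ≤ p, skipIndex j t i ≤ skipIndex j t (i + 1) := by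
  intro i hi
  simp only [skipIndex]
  split_ifs <;> exact le_of_chain h (by omega) (by omega)

/-- Knot insertion. -/
theorem scaledBspline_insert {p : ℕ} {t : ℕ → ℝ} (h : ∀ i ≤ p + 1, t i ≤ t (i + 1)) {j : ℕ}
    (hj : j ≤ p + 2) (x : ℝ) :
    (t (p + 2) - t 0) * scaledBspline p (skipIndex j t) x =
      (t j - t 0) * scaledBspline p t x +
        (t (p + 2) - t j) * scaledBspline p (fun i => t (i + 1)) x := by
  rcases Nat.eq_zero_or_pos j with rfl | hj0
  · rw [show skipIndex 0 t = fun i => t (i + 1) from funext fun i => by simp [skipIndex]]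
    ring
  rcases hj.eq_or_lt with rfl | hjlt
  · rw [scaledBspline_congr (t := skipIndex (p + 2) t) (t' := t)
      (fun i hi => by rw [skipIndex, if_pos (by omega)])]
    ring
  induction p generalizing t j with
  | zero =>
    obtain rfl : j = 1 := by omega
    have e₁ := mul_scaledBspline (p := 0) (t := skipIndex 1 t) (skipIndex_chain h) x
    have e₂ := mul_scaledBspline (p := 0) (t := t) (fun i hi => h i (by omega)) x
    have e₃ := mul_scaledBspline (p := 0) (t := fun i => t (i + 1))
      (fun i hi => h (i + 1) (by omega)) x
    have m₀ := h 0 (by omega)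
    have m₁ := h 1 (by omega)
    simp only [skipIndex, bspline] at e₁ e₂ e₃
    norm_num at e₁ e₂ e₃ m₀ m₁ ⊢
    rw [e₁, e₂, e₃]
    clear e₁ e₂ e₃ h
    split_ifs <;> first | (exfalso; grind) | norm_num
  | succ p ih =>
    have hj' : j ≤ p + 2 := by omega
    have c₁ : ∀ i ≤ p + 1, t i ≤ t (i + 1) := fun i hi => h i (by omega)
    have c₂ : ∀ i ≤ p + 1, t (i + 1) ≤ t (i + 1 + 1) := fun i hi => h (i + 1) (by omega)
    have hsk : (fun i => skipIndex j t (i + 1)) = skipIndex (j - 1) fun i => t (i + 1) := by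
      funext i
      simp only [skipIndex]
      by_cases hi : i + 1 < j
      · rw [if_pos hi, if_pos (by omega)]
      · rw [if_neg hi, if_neg (by omega)]
    have s₀ : skipIndex j t 0 = t 0 := by rw [skipIndex, if_pos hj0]
    have s₁ : skipIndex j t (p + 2) = t (p + 3) := by rw [skipIndex, if_neg (by omega)]
    have eJ := mul_scaledBspline_succ (skipIndex_chain (j := j) (p := p + 1) h) x
    rw [s₀, s₁, hsk] at eJ
    have eN := mul_scaledBspline_succ c₁ x
    have eZ := mul_scaledBspline_succ (t := fun i => t (i + 1)) c₂ x
    -- The recursion for the spline without `t j` involves two splines of lower degree; `hU` and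
    -- `hV` are the insertion formulas for them, trivial when the omitted knot is an end knot.
    have hU : (t (p + 2) - t 0) * scaledBspline p (skipIndex j t) x =
        (t j - t 0) * scaledBspline p t x +
          (t (p + 2) - t j) * scaledBspline p (fun i => t (i + 1)) x := by
      rcases hj'.eq_or_lt with rfl | hlt
      · rw [scaledBspline_congr (t := skipIndex (p + 2) t) (t' := t)
          (fun i hi => by rw [skipIndex, if_pos (by omega)])]
        ring
      · exact ih c₁ hj' hj0 hlt
    have hV : (t (p + 3) - t 1) * scaledBspline p (skipIndex (j - 1) fun i => t (i + 1)) x =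
        (t j - t 1) * scaledBspline p (fun i => t (i + 1)) x +
          (t (p + 3) - t j) * scaledBspline p (fun i => t (i + 1 + 1)) x := by
      rcases Nat.eq_zero_or_pos (j - 1) with h1 | h1
      · obtain rfl : j = 1 := by omega
        rw [show skipIndex (1 - 1) (fun i => t (i + 1)) = fun i => t (i + 1 + 1) from
          funext fun i => by simp [skipIndex]]
        ring
      · have := ih (t := fun i => t (i + 1)) (j := j - 1) c₂ (by omega) h1 (by omega)
        rw [Nat.sub_add_cancel hj0] at this
        exact this
    simp only [Nat.zero_add, Nat.add_assoc, Nat.reduceAdd] at eJ eN eZ hU hV ⊢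
    rw [eJ]
    -- The final cancellation needs both knot differences to be nonzero. If one vanishes, the knots
    -- concerned all coincide and the corresponding splines are zero.
    by_cases d₂ : t (p + 3) - t 1 = 0
    · have hall : ∀ i, 1 ≤ i → i ≤ p + 3 → t i = t 1 := fun i h₁ h₂ => by
        have a₁ := le_of_chain h (i := 1) (j := i) h₁ (by omega)
        have a₂ := le_of_chain h (i := i) (j := p + 3) h₂ (by omega)
        linarith
      have v₁ : scaledBspline p (skipIndex (j - 1) fun i => t (i + 1)) x = 0 :=
        scaledBspline_of_const (c := t 1) (fun i hi => by
          simp only [skipIndex]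
          split_ifs <;> exact hall _ (by omega) (by omega)) x
      have v₂ : scaledBspline p (fun i => t (i + 1)) x = 0 :=
        scaledBspline_of_const (fun i hi => hall (i + 1) (by omega) (by omega)) x
      have v₃ : scaledBspline (p + 1) (fun i => t (i + 1)) x = 0 :=
        scaledBspline_of_const (fun i hi => hall (i + 1) (by omega) (by omega)) x
      rw [v₂] at hU eN
      rw [v₁, v₃]
      have ej : t j = t (p + 2) := by
        rw [hall j hj0 (by omega), hall (p + 2) (by omega) (by omega)]
      by_cases d₁ : t (p + 2) - t 0 = 0
      · have hall' : ∀ i, i ≤ p + 2 → t i = t 0 := fun i h₂ => by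
          have a₁ := le_of_chain h (i := 0) (j := i) (by omega) (by omega)
          have a₂ := le_of_chain h (i := i) (j := p + 2) h₂ (by omega)
          linarith
        have v₄ : scaledBspline p (skipIndex j t) x = 0 :=
          scaledBspline_of_const (c := t 0) (fun i hi => by
            simp only [skipIndex]
            split_ifs <;> exact hall' _ (by omega)) x
        have v₅ : scaledBspline (p + 1) t x = 0 :=
          scaledBspline_of_const hall' x
        rw [v₄, v₅]; ring
      · rw [ej] at hU ⊢
        have : scaledBspline p (skipIndex j t) x = scaledBspline p t x :=
          mul_left_cancel₀ d₁ (by linear_combination hU)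
        rw [this]
        linear_combination -eN
    · by_cases d₁ : t (p + 2) - t 0 = 0
      · have hall' : ∀ i, i ≤ p + 2 → t i = t 0 := fun i h₂ => by
          have a₁ := le_of_chain h (i := 0) (j := i) (by omega) (by omega)
          have a₂ := le_of_chain h (i := i) (j := p + 2) h₂ (by omega)
          linarith
        have v₂ : scaledBspline p (fun i => t (i + 1)) x = 0 :=
          scaledBspline_of_const (fun i hi => hall' (i + 1) (by omega)) x
        have v₄ : scaledBspline p (skipIndex j t) x = 0 :=
          scaledBspline_of_const (c := t 0) (fun i hi => by
            simp only [skipIndex]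
            split_ifs <;> exact hall' _ (by omega)) x
        have v₅ : scaledBspline (p + 1) t x = 0 :=
          scaledBspline_of_const hall' x
        rw [v₂] at hV eZ
        rw [hall' j hj', hall' 1 (by omega)] at *
        have : scaledBspline p (skipIndex (j - 1) fun i => t (i + 1)) x =
            scaledBspline p (fun i => t (i + 2)) x :=
          mul_left_cancel₀ d₂ (by linear_combination hV)
        rw [v₄, v₅, this]
        linear_combination -eZ
      · refine mul_left_cancel₀ (mul_ne_zero d₁ d₂) ?_
        -- Both sides are multiplied by the two differences; the insertion formulas then remove the
        -- lower-degree splines without `t j`, and the recursions `eN` and `eZ` recover those of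
        -- higher degree.
        linear_combination (x - t 0) * (t (p + 3) - t 1) * hU +
          (t (p + 3) - x) * (t (p + 2) - t 0) * hV - (t j - t 0) * (t (p + 3) - t 1) * eN -
          (t (p + 3) - t j) * (t (p + 2) - t 0) * eZ

/-! ### Bernstein polynomials -/

/-- The B-splines without internal knots are multiples of the Bernstein polynomials. -/
theorem exists_bspline_eq_bernstein {a b : ℝ} (hab : a < b) (i j : ℕ) :
    ∃ c > 0, ∀ x ∈ Set.Ico a b,
      bspline (i + j) (fun n => if n < i + 1 then a else b) x = c * ((x - a) ^ j * (b - x) ^ i) := by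
  induction hp : i + j generalizing i j with
  | zero =>
    obtain rfl : i = 0 := by omega
    obtain rfl : j = 0 := by omega
    refine ⟨1, one_pos, fun x hx => ?_⟩
    simp only [bspline]
    rw [if_pos (by simpa using hx)]
    ring
  | succ p ih =>
    have hd : b - a ≠ 0 := (sub_pos.mpr hab).ne'
    -- With a single `a` the shifted knots all equal `b`, so the second recursion term has
    -- denominator zero and vanishes. A single `b` is the mirror case; otherwise both terms are
    -- multiples of the same polynomial.
    rcases i with _ | i
    · obtain ⟨c, hc, h⟩ := ih 0 p (by omega)
      obtain rfl : j = p + 1 := by omega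
      refine ⟨c / (b - a), div_pos hc (sub_pos.mpr hab), fun x hx => ?_⟩
      simp only [bspline]
      rw [h x hx]
      simp
      field_simp
      ring
    rcases j with _ | j
    · obtain ⟨c, hc, h⟩ := ih p 0 (by omega)
      obtain rfl : i = p := by omega
      refine ⟨c / (b - a), div_pos hc (sub_pos.mpr hab), fun x hx => ?_⟩
      simp only [bspline]
      rw [show (fun n => if n + 1 < i + 1 + 1 then a else b) = fun n => if n < i + 1 then a else b
        from funext fun n => by simp, h x hx]
      simp
      field_simp
      ring
    · obtain ⟨c₁, hc₁, h₁⟩ := ih (i + 1) j (by omega)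
      obtain ⟨c₂, hc₂, h₂⟩ := ih i (j + 1) (by omega)
      refine ⟨(c₁ + c₂) / (b - a), div_pos (add_pos hc₁ hc₂) (sub_pos.mpr hab), fun x hx => ?_⟩
      simp only [bspline]
      rw [show (fun n => if n + 1 < i + 1 + 1 then a else b) = fun n => if n < i + 1 then a else b
        from funext fun n => by simp, h₁ x hx, h₂ x hx, if_pos (by omega), if_neg (by omega),
        if_neg (by omega), if_pos (by omega)]
      field_simp
      ring

/-- The Bernstein polynomials span all polynomials. -/
theorem pow_mem_span_bernstein {a b : ℝ} (hab : a < b) (p : ℕ) {m : ℕ} (hm : m ≤ p) :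
    (fun x : ℝ => x ^ m) ∈ Submodule.span ℝ
      {f : ℝ → ℝ | ∃ i j, i + j = p ∧ f = fun x => (x - a) ^ j * (b - x) ^ i} := by
  have hd : b - a ≠ 0 := (sub_pos.mpr hab).ne'
  induction p generalizing m with
  | zero =>
    obtain rfl : m = 0 := by omega
    refine Submodule.subset_span ⟨0, 0, rfl, by simp⟩
  | succ p ih =>
    set T := Submodule.span ℝ
      {f : ℝ → ℝ | ∃ i j, i + j = p + 1 ∧ f = fun x => (x - a) ^ j * (b - x) ^ i} with hT
    have key : ∀ f ∈ Submodule.span ℝ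
        {f : ℝ → ℝ | ∃ i j, i + j = p ∧ f = fun x => (x - a) ^ j * (b - x) ^ i},
        (fun x => (x - a) * f x) ∈ T ∧ (fun x => (b - x) * f x) ∈ T := by
      intro f hf
      induction hf using Submodule.span_induction with
      | mem f hf =>
        obtain ⟨i, j, hij, rfl⟩ := hf
        refine ⟨Submodule.subset_span ⟨i, j + 1, by omega, funext fun x => by ring⟩,
          Submodule.subset_span ⟨i + 1, j, by omega, funext fun x => by ring⟩⟩
      | zero => simp only [Pi.zero_apply, mul_zero]; exact ⟨T.zero_mem, T.zero_mem⟩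
      | add f g _ _ hf hg =>
        refine ⟨?_, ?_⟩
        · convert T.add_mem hf.1 hg.1 using 1; funext x; simp [mul_add]
        · convert T.add_mem hf.2 hg.2 using 1; funext x; simp [mul_add]
      | smul c f _ hf =>
        refine ⟨?_, ?_⟩
        · convert T.smul_mem c hf.1 using 1; funext x; simp; ring
        · convert T.smul_mem c hf.2 using 1; funext x; simp; ring
    -- Degree elevation uses `(b - a) * x = b * (x - a) + a * (b - x)` for the top power, and `b - a
    -- = (x - a) + (b - x)` for lower ones.
    rcases hm.eq_or_lt with rfl | hlt
    · have h := key _ (ih le_rfl)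
      convert T.smul_mem (1 / (b - a)) (T.add_mem (T.smul_mem b h.1) (T.smul_mem a h.2)) using 1
      funext x
      simp
      field_simp
      ring
    · have h := key _ (ih (Nat.lt_succ_iff.mp hlt))
      convert T.smul_mem (1 / (b - a)) (T.add_mem h.1 h.2) using 1
      funext x
      simp
      field_simp
      ring

open Polynomial in
theorem eq_zero_of_sum_pow {n : ℕ} {a : Fin n → ℝ} {c d : ℝ} (hcd : c < d)
    (h : ∀ x ∈ Set.Ioo c d, ∑ i, a i * x ^ (i : ℕ) = 0) (i : Fin n) : a i = 0 := by
  have hP : ∑ i : Fin n, Polynomial.C (a i) * X ^ (i : ℕ) = 0 := by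
    refine Polynomial.eq_zero_of_infinite_isRoot _ ((Set.Ioo_infinite hcd).mono fun x hx => ?_)
    simp only [Set.mem_ofPred_eq, IsRoot.def, eval_finsetSum, eval_mul, eval_C, eval_pow, eval_X]
    exact h x hx
  have := congrArg (fun P => P.coeff i) hP
  simpa [finsetSum_coeff, coeff_C_mul, coeff_X_pow, Fin.val_inj] using this

/-! ### B-splines as combinations of their descendants -/

theorem getD_append_eq_getD_insert (A R : List ℝ) (t : ℝ) (i : ℕ) :
    (A ++ R).getD i 0 = (A ++ t :: R).getD (if i < A.length then i else i + 1) 0 := by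
  split_ifs with h
  · rw [List.getD_append _ _ _ _ h, List.getD_append _ _ _ _ h]
  · rw [List.getD_append_right _ _ _ _ (by omega), List.getD_append_right _ _ _ _ (by omega),
      show i + 1 - A.length = (i - A.length) + 1 by omega, List.getD_cons_succ]

theorem getD_le_getD_succ {L : List ℝ} (h : L.Pairwise (· ≤ ·)) {i : ℕ} (hi : i + 1 < L.length) :
    L.getD i 0 ≤ L.getD (i + 1) 0 := by
  rw [List.getD_eq_getElem _ _ (by omega), List.getD_eq_getElem _ _ hi]
  exact List.pairwise_iff_getElem.mp h i (i + 1) _ _ (by omega)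

theorem headD_eq_getD_zero (L : List ℝ) : L.headD 0 = L.getD 0 0 := by
  cases L <;> simp

theorem getLastD_eq_getD {L : List ℝ} {n : ℕ} (h : L.length = n + 1) :
    L.getLastD 0 = L.getD n 0 := by
  rcases List.eq_nil_or_concat L with rfl | ⟨L', b, rfl⟩
  · simp at h
  · rw [List.concat_eq_append, List.length_append] at h
    simp only [List.length_singleton] at h
    rw [List.concat_eq_append, List.getLastD_concat, List.getD_append_right _ _ _ _ (by omega),
      show n - L'.length = 0 by omega]
    rfl

/-- In the enlarged knot vector the original B-spline is the one that omits the inserted entry, so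
`scaledBspline_insert` applies at its position. Only the existence of coefficients is needed later.
-/
theorem exists_bspline_ins {p : ℕ} {L : List ℝ} (hL : L.Pairwise (· ≤ ·))
    (hl : L.length = p + 2) {t : ℝ} (h₁ : L.headD 0 < t) (h₂ : t < L.getLastD 0) :
    ∃ α β : ℝ, ∀ x, bspline p (fun i => L.getD i 0) x =
      α * bspline p (fun i => (ins t L).dropLast.getD i 0) x +
        β * bspline p (fun i => (ins t L).tail.getD i 0) x := by
  obtain ⟨A, R, rfl, hins, hA, hR⟩ := exists_ins_split hL t
  set τ : ℕ → ℝ := fun i => (A ++ t :: R).getD i 0 with hτ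
  have hlen : (A ++ t :: R).length = p + 3 := by
    rw [← hins, List.orderedInsert_length, hl]
  have hs : (A ++ t :: R).Pairwise (· ≤ ·) := hins ▸ sorted_ins hL t
  have hchain : ∀ i ≤ p + 1, τ i ≤ τ (i + 1) := fun i hi => getD_le_getD_succ hs (by omega)
  have hskip : (fun i => (A ++ R).getD i 0) = skipIndex A.length τ := by
    funext i
    exact getD_append_eq_getD_insert A R t i
  have hAlen : A.length ≤ p + 2 := by
    rw [List.length_append, List.length_cons] at hlen; omega
  have e₀ : τ 0 = (A ++ R).headD 0 := by
    cases A with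
    | nil =>
      exfalso
      have : R ≠ [] := by rintro rfl; simp at hl
      exact absurd h₁ (not_lt.mpr (hR _ (headD_mem this)))
    | cons a A => rfl
  have e₁ : τ (p + 2) = (A ++ R).getLastD 0 := by
    have : R ≠ [] := by
      rintro rfl
      have h0 : A ≠ [] := by rintro rfl; simp at hl
      rw [List.append_nil] at h₂
      exact absurd h₂ (not_lt.mpr (hA _ (getLastD_mem h0)).le)
    rw [hτ]
    simp only
    rw [← getLastD_eq_getD hlen, getLastD_append_of_ne_nil _ this,
      getLastD_append_of_ne_nil _ (by simp), getLastD_cons_of_ne_nil _ this]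
  have hne : τ (p + 2) - τ 0 ≠ 0 := by
    rw [e₀, e₁]
    exact (sub_pos.mpr (h₁.trans h₂)).ne'
  refine ⟨(τ A.length - τ 0) / (τ (p + 1) - τ 0),
    (τ (p + 2) - τ A.length) / (τ (p + 2) - τ 1), fun x => ?_⟩
  have key := scaledBspline_insert hchain hAlen x
  have hfirst : bspline p (fun i => (ins t (A ++ R)).dropLast.getD i 0) x = bspline p τ x := by
    rw [hins]
    refine bspline_congr (fun i hi => ?_) x
    rw [hτ]
    simp only
    rw [List.getD_eq_getElem _ _ (by rw [List.length_dropLast]; omega),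
      List.getD_eq_getElem _ _ (by omega), List.getElem_dropLast]
  have htail : bspline p (fun i => (ins t (A ++ R)).tail.getD i 0) x =
      bspline p (fun i => τ (i + 1)) x := by
    rw [hins]
    refine bspline_congr (fun i hi => ?_) x
    rw [hτ]
    simp only
    rw [List.getD_eq_getElem _ _ (by rw [List.length_tail]; omega),
      List.getD_eq_getElem _ _ (by omega), List.getElem_tail]
  rw [hskip, hfirst, htail]
  have hchain' := skipIndex_chain (j := A.length) hchain
  have hm := mul_scaledBspline hchain' x
  have s₀ : skipIndex A.length τ 0 = τ 0 := by
    rw [← hskip, e₀]; exact (headD_eq_getD_zero _).symm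
  have s₁ : skipIndex A.length τ (p + 1) = τ (p + 2) := by
    rw [← hskip, e₁]; exact (getLastD_eq_getD hl).symm
  rw [s₀, s₁] at hm
  rw [← hm, key, scaledBspline, scaledBspline]
  ring

theorem prod_eq_mul_rev (f : Fin 2 → ℝ) (k : Fin 2) : ∏ j, f j = f k * f k.rev := by
  fin_cases k
  · exact Fin.prod_univ_two f
  · exact (Fin.prod_univ_two f).trans (mul_comm _ _)

theorem eval_setKnots (p : Fin 2 → ℕ) (B : TBSpline) (k : Fin 2) (L : List ℝ) (x : Fin 2 → ℝ) :
    (B.setKnots k L).eval p x = bspline (p k) (fun i => L.getD i 0) (x k) *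
      bspline (p k.rev) (fun i => (B.knots k.rev).getD i 0) (x k.rev) := by
  rw [eval, prod_eq_mul_rev _ k, knots_setKnots_self, knots_setKnots_rev]

/-- A B-spline is a linear combination of its children. -/
theorem exists_eval_eq_children {p : Fin 2 → ℕ} {B : TBSpline} (hB : B.IsKnotted p) {k : Fin 2}
    {t : ℝ} (h₁ : B.first k < t) (h₂ : t < B.last k) :
    ∃ α β : ℝ, ∀ x, B.eval p x =
      α * (B.leftChild k t).eval p x + β * (B.rightChild k t).eval p x := by
  obtain ⟨α, β, h⟩ := exists_bspline_ins (hB k).1 (hB k).2 h₁ h₂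
  refine ⟨α, β, fun x => ?_⟩
  conv_lhs => rw [← setKnots_knots B k]
  rw [leftChild_eq, rightChild_eq, eval_setKnots, eval_setKnots, eval_setKnots, h]
  ring

/-- The restriction of a B-spline to a subset. -/
def restrict (p : Fin 2 → ℕ) (U : Set (Fin 2 → ℝ)) (B : TBSpline) (x : U) : ℝ := B.eval p x

/-- Repeated splitting into children terminates, and the descendants of a child are descendants of
`B`. -/
theorem restrict_mem_span_descendants {p : Fin 2 → ℕ} {M : Mesh} {T : Finset ℝ} {N : ℕ}
    (hTN : ∀ k t u, M.mult k t u ≤ N ∧ (M.mult k t u ≠ 0 → t ∈ T)) (U : Set (Fin 2 → ℝ))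
    (B : TBSpline) (hB : B.IsKnotted p) :
    restrict p U B ∈ Submodule.span ℝ (restrict p U '' descendants M {B}) := by
  refine child_induction hTN
    (P := fun B => restrict p U B ∈ Submodule.span ℝ (restrict p U '' descendants M {B}))
    (fun B _ hm => ?_) (fun B k t hB hs hl hr => ?_) B hB
  · exact Submodule.subset_span ⟨B, ⟨B, rfl, .refl, hm⟩, rfl⟩
  · obtain ⟨α, β, h⟩ := exists_eval_eq_children hB hs.1 hs.2.1
    have he : restrict p U B =
        α • restrict p U (B.leftChild k t) + β • restrict p U (B.rightChild k t) :=
      funext fun x => h x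
    have hd := descendants_singleton_of_skips hB hs
    rw [he]
    refine Submodule.add_mem _ (Submodule.smul_mem _ _ ?_) (Submodule.smul_mem _ _ ?_)
    · refine Submodule.span_mono (Set.image_mono ?_) hl
      rw [hd]
      exact descendants_mono (by simp)
    · refine Submodule.span_mono (Set.image_mono ?_) hr
      rw [hd]
      exact descendants_mono (by simp)

/-! ### Polynomials on a rectangle without meshlines -/

/-- An open rectangle. -/
def box (c d : Fin 2 → ℝ) : Set (Fin 2 → ℝ) := Set.pi Set.univ fun k => Set.Ioo (c k) (d k)

theorem mem_box {c d x : Fin 2 → ℝ} : x ∈ box c d ↔ ∀ k, c k < x k ∧ x k < d k := by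
  simp [box]

/-- The monomials of bidegree at most `(n, n)`, restricted to a rectangle. -/
def monomials (n : ℕ) (c d : Fin 2 → ℝ) (i : Fin (n + 1) × Fin (n + 1)) (x : box c d) : ℝ :=
  x.1 0 ^ (i.1 : ℕ) * x.1 1 ^ (i.2 : ℕ)

theorem linearIndependent_monomials (n : ℕ) {c d : Fin 2 → ℝ} (hcd : ∀ k, c k < d k) :
    LinearIndependent ℝ (monomials n c d) := by
  rw [Fintype.linearIndependent_iff]
  rintro g hg ⟨i, j⟩
  have h : ∀ x ∈ Set.Ioo (c 0) (d 0), ∀ y ∈ Set.Ioo (c 1) (d 1),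
      ∑ i, (∑ j, g (i, j) * y ^ (j : ℕ)) * x ^ (i : ℕ) = 0 := by
    intro x hx y hy
    have hm : (![x, y] : Fin 2 → ℝ) ∈ box c d := by
      rw [mem_box]
      intro k
      fin_cases k
      exacts [hx, hy]
    have := congrFun hg ⟨_, hm⟩
    rw [Fintype.sum_prod_type] at this
    simp only [Finset.sum_apply, Pi.smul_apply, smul_eq_mul, monomials, Pi.zero_apply,
      Matrix.cons_val_zero, Matrix.cons_val_one] at this
    rw [← this]
    refine Finset.sum_congr rfl fun i _ => ?_
    rw [Finset.sum_mul]
    exact Finset.sum_congr rfl fun j _ => by ring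
  exact eq_zero_of_sum_pow (hcd 1)
    (fun y hy => eq_zero_of_sum_pow (hcd 0) (fun x hx => h x hx y hy) i) j

theorem finrank_span_monomials (n : ℕ) {c d : Fin 2 → ℝ} (hcd : ∀ k, c k < d k) :
    Module.finrank ℝ (Submodule.span ℝ (Set.range (monomials n c d))) = (n + 1) ^ 2 := by
  rw [finrank_span_eq_card (linearIndependent_monomials n hcd), Fintype.card_prod,
    Fintype.card_fin, pow_two]

theorem replicate_infix_bernsteinKnots {p i j : ℕ} (h : i + j = p) (a b : ℝ) :
    List.replicate (i + 1) a ++ List.replicate (j + 1) b <:+: bernsteinKnots p a b := by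
  refine ⟨List.replicate j a, List.replicate i b, ?_⟩
  rw [bernsteinKnots, ← List.append_assoc, List.replicate_append_replicate, List.append_assoc,
    List.replicate_append_replicate, show j + (i + 1) = p + 1 by omega,
    show j + 1 + i = p + 1 by omega]

theorem getD_replicate_append (i j n : ℕ) (a b : ℝ) (hn : n ≤ i + j + 1) :
    (List.replicate (i + 1) a ++ List.replicate (j + 1) b).getD n 0 =
      if n < i + 1 then a else b := by
  split_ifs with h
  · rw [List.getD_append _ _ _ _ (by simpa using h), List.getD_replicate _ h]
  · rw [List.getD_append_right _ _ _ _ (by simp; omega), List.getD_replicate]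
    simp; omega

/-- The B-splines without internal knots span the polynomials. -/
theorem monomials_mem_span_bernstein (n : ℕ) {lo hi c d : Fin 2 → ℝ} (hlh : ∀ k, lo k < hi k)
    (hlo : ∀ k, lo k ≤ c k) (hhi : ∀ k, d k ≤ hi k) (i : Fin (n + 1) × Fin (n + 1)) :
    monomials n c d i ∈ Submodule.span ℝ (restrict (fun _ => n) (box c d) ''
      tensorSplines (fun _ => n) fun k => bernsteinKnots n (lo k) (hi k)) := by
  -- `Φ` is the tensor product of univariate functions. It maps pairs of spans into the span of the
  -- products, so univariate spanning gives the bivariate statement.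
  set Φ : (ℝ → ℝ) →ₗ[ℝ] (ℝ → ℝ) →ₗ[ℝ] (box c d → ℝ) :=
    LinearMap.mk₂ ℝ (fun f g x => f (x.1 0) * g (x.1 1))
      (fun f f' g => by funext x; simp [add_mul]) (fun a f g => by funext x; simp [mul_assoc])
      (fun f g g' => by funext x; simp [mul_add])
      (fun a f g => by funext x; simp [mul_left_comm]) with hΦ
  have h₀ := pow_mem_span_bernstein (hlh 0) n (Nat.lt_succ_iff.mp i.1.isLt)
  have h₁ := pow_mem_span_bernstein (hlh 1) n (Nat.lt_succ_iff.mp i.2.isLt)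
  have h := Submodule.apply_mem_map₂ Φ h₀ h₁
  rw [Submodule.map₂_span_span] at h
  refine Submodule.span_le.mpr ?_ h
  rintro _ ⟨f, ⟨i, j, hij, rfl⟩, g, ⟨i', j', hij', rfl⟩, rfl⟩
  obtain ⟨a, ha, ha'⟩ := exists_bspline_eq_bernstein (hlh 0) i j
  obtain ⟨b, hb, hb'⟩ := exists_bspline_eq_bernstein (hlh 1) i' j'
  set B : TBSpline := ⟨![List.replicate (i + 1) (lo 0) ++ List.replicate (j + 1) (hi 0),
    List.replicate (i' + 1) (lo 1) ++ List.replicate (j' + 1) (hi 1)]⟩ with hBdef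
  have hB : B ∈ tensorSplines (fun _ => n) fun k => bernsteinKnots n (lo k) (hi k) := by
    intro k
    fin_cases k
    · exact ⟨replicate_infix_bernsteinKnots hij _ _, by simp [hBdef]; omega⟩
    · exact ⟨replicate_infix_bernsteinKnots hij' _ _, by simp [hBdef]; omega⟩
  have he : Φ (fun x => (x - lo 0) ^ j * (hi 0 - x) ^ i)
      (fun x => (x - lo 1) ^ j' * (hi 1 - x) ^ i') =
        (a * b)⁻¹ • restrict (fun _ => n) (box c d) B := by
    funext x
    have hx := mem_box.mp x.2
    have e₀ : bspline n (fun m => (B.knots 0).getD m 0) (x.1 0) =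
        a * ((x.1 0 - lo 0) ^ j * (hi 0 - x.1 0) ^ i) := by
      rw [← ha' (x.1 0) ⟨(hlo 0).trans (hx 0).1.le, (hx 0).2.trans_le (hhi 0)⟩, hij]
      exact bspline_congr (fun m hm => getD_replicate_append i j m _ _ (by omega)) _
    have e₁ : bspline n (fun m => (B.knots 1).getD m 0) (x.1 1) =
        b * ((x.1 1 - lo 1) ^ j' * (hi 1 - x.1 1) ^ i') := by
      rw [← hb' (x.1 1) ⟨(hlo 1).trans (hx 1).1.le, (hx 1).2.trans_le (hhi 1)⟩, hij']
      exact bspline_congr (fun m hm => getD_replicate_append i' j' m _ _ (by omega)) _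
    simp only [hΦ, LinearMap.mk₂_apply, Pi.smul_apply, smul_eq_mul, restrict, TBSpline.eval,
      Fin.prod_univ_two, e₀, e₁]
    field_simp
  rw [SetLike.mem_coe]
  beta_reduce
  rw [he]
  exact Submodule.smul_mem _ _ (Submodule.subset_span ⟨B, hB, rfl⟩)

/-- No meshline of `M` meets the open rectangle. -/
def MeshFree (M : Mesh) (c d : Fin 2 → ℝ) : Prop :=
  ∀ k, ∀ t ∈ Set.Ioo (c k) (d k), ∀ u ∈ Set.Ioo (c k.rev) (d k.rev), M.mult k t u = 0

/-- The support of `B` covers the rectangle. -/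
def Covers (c d : Fin 2 → ℝ) (B : TBSpline) : Prop := ∀ k, B.first k ≤ c k ∧ d k ≤ B.last k

theorem covers_iff {c d : Fin 2 → ℝ} (hcd : ∀ k, c k < d k) {B : TBSpline} :
    Covers c d B ↔ Set.Icc c d ⊆ B.supp := by
  rw [supp, Set.Icc_subset_Icc_iff fun k => (hcd k).le, Pi.le_def, Pi.le_def, ← forall_and]
  rfl

section Rectangle

variable {p : Fin 2 → ℕ} {M : Mesh} {B : TBSpline} {c d : Fin 2 → ℝ}

/-- The knot lines of `B` are meshlines across its whole support. One that entered the rectangle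
would continue into the overlap of support and rectangle, where no meshline passes. -/
theorem IsOnMesh.covers (hB : IsOnMesh p M B) (hV : MeshFree M c d) (hcd : ∀ k, c k < d k)
    (h : ∀ k, B.first k < d k ∧ c k < B.last k) :
    Covers c d B ∧ ∀ k, ∀ t ∈ B.knots k, t ∉ Set.Ioo (c k) (d k) := by
  have hk : ∀ k, ∀ t ∈ B.knots k, t ∉ Set.Ioo (c k) (d k) := by
    intro k t ht htI
    obtain ⟨u, hu₁, hu₂⟩ := exists_between
      (show max (c k.rev) (B.first k.rev) < min (d k.rev) (B.last k.rev) from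
        max_lt (lt_min (hcd _) (h _).2) (lt_min (h _).1 (hB.lt _)))
    rw [max_lt_iff] at hu₁
    rw [lt_min_iff] at hu₂
    have := hB.mult_pos k t ht u ⟨hu₁.2.le, hu₂.2.le⟩
    rw [hV k t htI u ⟨hu₁.1, hu₂.1⟩] at this
    exact lt_irrefl _ this
  refine ⟨fun k => ⟨?_, ?_⟩, hk⟩
  · by_contra hcon
    exact hk k _ (hB.isKnotted.first_mem k) ⟨not_le.mp hcon, (h k).1⟩
  · by_contra hcon
    exact hk k _ (hB.isKnotted.last_mem k) ⟨(h k).2, not_le.mp hcon⟩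

theorem TBSpline.IsKnotted.chain (hB : B.IsKnotted p) (k : Fin 2) :
    ∀ i ≤ p k, (B.knots k).getD i 0 ≤ (B.knots k).getD (i + 1) 0 := fun i hi =>
  getD_le_getD_succ (hB k).1 (by rw [(hB k).2]; omega)

theorem TBSpline.IsKnotted.getD_mem (hB : B.IsKnotted p) (k : Fin 2) {i : ℕ}
    (hi : i ≤ p k + 1) : (B.knots k).getD i 0 ∈ B.knots k := by
  rw [List.getD_eq_getElem _ _ (by rw [(hB k).2]; omega)]
  exact List.getElem_mem _

theorem TBSpline.IsKnotted.mem_of_eval_ne_zero (hB : B.IsKnotted p) {x : Fin 2 → ℝ}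
    (hx : B.eval p x ≠ 0) (k : Fin 2) : B.first k ≤ x k ∧ x k < B.last k := by
  by_contra hcon
  refine hx (Finset.prod_eq_zero (Finset.mem_univ k) (bspline_eq_zero (hB.chain k) ?_))
  rw [← headD_eq_getD_zero, ← getLastD_eq_getD (hB k).2]
  rw [not_and_or, not_le, not_lt] at hcon
  exact hcon

theorem IsOnMesh.restrict_eq_zero (hB : IsOnMesh p M B) (hV : MeshFree M c d)
    (hcd : ∀ k, c k < d k) (h : ¬ Covers c d B) : restrict p (box c d) B = 0 := by
  funext x
  by_contra hx
  refine h (hB.covers hV hcd fun k => ?_).1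
  have h₁ := hB.isKnotted.mem_of_eval_ne_zero hx k
  have h₂ := mem_box.mp x.2 k
  exact ⟨h₁.1.trans_lt h₂.2, h₂.1.trans h₁.2⟩

theorem IsOnMesh.not_mem_of_covers (hB : IsOnMesh p M B) (hV : MeshFree M c d)
    (hcd : ∀ k, c k < d k) (h : Covers c d B) (k : Fin 2) {t : ℝ} (ht : t ∈ B.knots k) :
    t ∉ Set.Ioo (c k) (d k) :=
  (hB.covers hV hcd fun k =>
    ⟨(h k).1.trans_lt (hcd k), (hcd k).trans_le (h k).2⟩).2 k t ht

/-- Together with `IsOnMesh.restrict_eq_zero` this shows that covering the rectangle is the same as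
not vanishing on it. -/
theorem IsOnMesh.eval_pos (hB : IsOnMesh p M B) (hV : MeshFree M c d)
    (hcd : ∀ k, c k < d k) (h : Covers c d B) {x : Fin 2 → ℝ} (hx : x ∈ box c d) :
    0 < B.eval p x := by
  rw [mem_box] at hx
  refine Finset.prod_pos fun k _ => bspline_pos (hB.isKnotted.chain k) (fun i hi he => ?_) ?_ ?_
  · exact hB.not_mem_of_covers hV hcd h k (hB.isKnotted.getD_mem k hi) (he ▸ hx k)
  · rw [← headD_eq_getD_zero]
    exact (h k).1.trans_lt (hx k).1
  · rw [← getLastD_eq_getD (hB.isKnotted k).2]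
    exact (hx k).2.trans_le (h k).2

theorem IsOnMesh.restrict_mem_span_monomials {n : ℕ} (hB : IsOnMesh (fun _ => n) M B)
    (hV : MeshFree M c d) (hcd : ∀ k, c k < d k) :
    restrict (fun _ => n) (box c d) B ∈ Submodule.span ℝ (Set.range (monomials n c d)) := by
  by_cases h : Covers c d B
  · have hP : ∀ k, ∃ P : Polynomial ℝ, P.natDegree ≤ n ∧ ∀ x ∈ Set.Ioo (c k) (d k),
        bspline n (fun i => (B.knots k).getD i 0) x = P.eval x := fun k =>
      exists_polynomial_bspline n fun i hi =>
        hB.not_mem_of_covers hV hcd h k (hB.isKnotted.getD_mem k hi)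
    choose P hP hP' using hP
    have : restrict (fun _ => n) (box c d) B =
        ∑ i : Fin (n + 1) × Fin (n + 1), ((P 0).coeff i.1 * (P 1).coeff i.2) •
          monomials n c d i := by
      funext x
      have hx := mem_box.mp x.2
      have e : ∀ k, (P k).eval (x.1 k) = ∑ i : Fin (n + 1), (P k).coeff i * x.1 k ^ (i : ℕ) :=
        fun k => by
          rw [Polynomial.eval_eq_sum_range' (Nat.lt_succ_of_le (hP k)), Finset.sum_range]
      simp only [restrict, TBSpline.eval, Fin.prod_univ_two]
      rw [hP' 0 _ (hx 0), hP' 1 _ (hx 1), e 0, e 1, Finset.sum_mul_sum, Fintype.sum_prod_type]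
      simp only [Finset.sum_apply, Pi.smul_apply, smul_eq_mul, monomials]
      exact Finset.sum_congr rfl fun i _ => Finset.sum_congr rfl fun j _ => by ring
    rw [this]
    exact Submodule.sum_mem _ fun i _ =>
      Submodule.smul_mem _ _ (Submodule.subset_span ⟨i, rfl⟩)
  · rw [hB.restrict_eq_zero hV hcd h]
    exact Submodule.zero_mem _

end Rectangle

/-! ### Local linear independence and dimension count -/

/-- Local linear independence bounds the number of B-splines whose supports cover a mesh-free
rectangle by the dimension of the polynomial space. -/
theorem LocallyLinearIndependent.ncard_covers_le {n : ℕ} {M : Mesh} {S : Set TBSpline}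
    (hL : LocallyLinearIndependent (fun _ => n) M S)
    (hS : ∀ B ∈ S, IsOnMesh (fun _ => n) M B) {c d : Fin 2 → ℝ} (hcd : ∀ k, c k < d k)
    (hlo : ∀ k, M.lo k ≤ c k) (hhi : ∀ k, d k ≤ M.hi k) (hV : MeshFree M c d) :
    {B ∈ S | Covers c d B}.Finite ∧ {B ∈ S | Covers c d B}.ncard ≤ (n + 1) ^ 2 := by
  have hopen : IsOpen (box c d) := isOpen_set_pi Set.finite_univ fun k _ => isOpen_Ioo
  have hsub : box c d ⊆ Set.Icc M.lo M.hi := fun x hx =>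
    ⟨fun k => (hlo k).trans (mem_box.mp hx k).1.le, fun k => (mem_box.mp hx k).2.le.trans (hhi k)⟩
  have hli := hL (box c d) hopen hsub
  set W := Submodule.span ℝ (Set.range (monomials n c d)) with hW
  set I := {B : TBSpline // B ∈ S ∧ ∃ x ∈ box c d, B.eval (fun _ => n) x ≠ 0}
  have hli' : LinearIndependent ℝ (fun B : I => (⟨restrict (fun _ => n) (box c d) B.1,
      (hS B.1 B.2.1).restrict_mem_span_monomials hV hcd⟩ : W)) :=
    LinearIndependent.of_comp W.subtype hli
  have hfin : Module.Finite ℝ W := Module.Finite.span_of_finite ℝ (Set.finite_range _)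
  have hI : Finite I := hli'.finite_of_isNoetherian
  have : Fintype I := Fintype.ofFinite I
  have hcard := hli'.fintype_card_le_finrank
  rw [hW, finrank_span_monomials n hcd] at hcard
  have himg : {B ∈ S | Covers c d B} ⊆ Set.range (Subtype.val : I → TBSpline) := by
    rintro B ⟨hB, hc⟩
    have hx : (fun k => (c k + d k) / 2) ∈ box c d := by
      rw [mem_box]; intro k; have := hcd k; constructor <;> linarith
    exact ⟨⟨B, hB, _, hx, ((hS B hB).eval_pos hV hcd hc hx).ne'⟩, rfl⟩
  refine ⟨(Set.finite_range _).subset himg, ?_⟩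
  refine (Set.ncard_le_ncard himg (Set.finite_range _)).trans ?_
  rw [← Set.image_univ]
  refine (Set.ncard_image_le Set.finite_univ).trans ?_
  rwa [Set.ncard_univ, Nat.card_eq_fintype_card]

/-- If not more LR B-splines than the dimension of the polynomial space cover a mesh-free
rectangle, then they form a basis. -/
theorem IsLR.linearIndepOn_covers {n : ℕ} {M : Mesh} {S : Set TBSpline}
    (h : IsLR (fun _ => n) M S) {c d : Fin 2 → ℝ} (hcd : ∀ k, c k < d k)
    (hlo : ∀ k, M.lo k ≤ c k) (hhi : ∀ k, d k ≤ M.hi k) (hV : MeshFree M c d)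
    (hcard : {B ∈ S | Covers c d B}.ncard ≤ (n + 1) ^ 2) :
    {B ∈ S | Covers c d B}.ncard = (n + 1) ^ 2 ∧
      LinearIndepOn ℝ (restrict (fun _ => n) (box c d)) {B ∈ S | Covers c d B} := by
  set A := {B ∈ S | Covers c d B} with hA
  set r := restrict (fun _ => n) (box c d) with hr
  have hAfin : A.Finite := h.finite.subset fun B hB => hB.1
  obtain ⟨T, N, hTN⟩ := h.exists_mult_bound
  -- Non-covering B-splines vanish on the rectangle, so only `A` contributes; `h₂` and `h₃` then put
  -- all polynomials into its span.
  have h₁ : Submodule.span ℝ (r '' S) ≤ Submodule.span ℝ (r '' A) := by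
    refine Submodule.span_le.mpr ?_
    rintro _ ⟨B, hB, rfl⟩
    by_cases hc : Covers c d B
    · exact Submodule.subset_span ⟨B, ⟨hB, hc⟩, rfl⟩
    · rw [hr, (h.isOnMesh B hB).restrict_eq_zero hV hcd hc]
      exact Submodule.zero_mem _
  have h₂ : Submodule.span ℝ (r '' tensorSplines (fun _ => n)
      fun k => bernsteinKnots n (M.lo k) (M.hi k)) ≤ Submodule.span ℝ (r '' S) := by
    refine Submodule.span_le.mpr ?_
    rintro _ ⟨B, hB, rfl⟩
    refine Submodule.span_mono (Set.image_mono ?_) (restrict_mem_span_descendants hTN (box c d) B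
      (isKnotted_of_mem_tensorSplines (fun k => sorted_bernsteinKnots n (h.lo_lt_hi k).le) hB))
    conv_rhs => rw [h.eq_descendants]
    exact descendants_mono (by simpa using hB)
  have h₃ : Submodule.span ℝ (Set.range (monomials n c d)) ≤ Submodule.span ℝ (r '' A) := by
    refine le_trans (Submodule.span_le.mpr ?_) (h₂.trans h₁)
    rintro _ ⟨i, rfl⟩
    exact monomials_mem_span_bernstein n h.lo_lt_hi hlo hhi i
  have hfinite : Module.Finite ℝ (Submodule.span ℝ (r '' A)) :=
    Module.Finite.span_of_finite ℝ (hAfin.image r)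
  have h₄ := Submodule.finrank_mono h₃
  rw [finrank_span_monomials n hcd] at h₄
  have : Fintype A := hAfin.fintype
  have hrange : Set.range (fun a : A => r a) = r '' A := by
    rw [Set.image_eq_range]
  have hcA : Fintype.card A = A.ncard := by
    rw [← Nat.card_eq_fintype_card, Nat.card_coe_set_eq]
  have h₅ : Module.finrank ℝ (Submodule.span ℝ (r '' A)) ≤ Fintype.card A := by
    rw [← hrange]; exact finrank_range_le_card _
  refine ⟨le_antisymm hcard (by omega), ?_⟩
  -- At most `(n + 1) ^ 2` functions have a span of at least that dimension, hence they are
  -- independent.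
  refine linearIndependent_iff_card_le_finrank_span.mpr ?_
  rw [hrange, Set.finrank]
  omega

/-- To the upper right of every point there is a small mesh-free rectangle. -/
theorem exists_meshFree {M : Mesh} {T : Finset ℝ} (hT : ∀ k t u, M.mult k t u ≠ 0 → t ∈ T)
    {U : Set (Fin 2 → ℝ)} (hU : IsOpen U) {x : Fin 2 → ℝ} (hx : x ∈ U) :
    ∃ d, (∀ k, x k < d k) ∧ d ∈ U ∧ box x d ⊆ U ∧ MeshFree M x d := by
  obtain ⟨ε, hε, hball⟩ := Metric.isOpen_iff.mp hU x hx
  have hev : ∀ t ∈ T, ∀ k : Fin 2, ∀ᶠ δ in nhdsWithin (0 : ℝ) (Set.Ioi 0),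
      t ∉ Set.Ioo (x k) (x k + δ) := by
    intro t _ k
    by_cases ht : x k < t
    · have : ∀ᶠ δ in nhdsWithin (0 : ℝ) (Set.Ioi 0), δ < t - x k :=
        Filter.Eventually.filter_mono nhdsWithin_le_nhds (eventually_lt_nhds (sub_pos.mpr ht))
      filter_upwards [this] with δ hδ hmem
      linarith [hmem.2]
    · exact Filter.Eventually.of_forall fun δ hmem => ht hmem.1
  have hall : ∀ᶠ δ in nhdsWithin (0 : ℝ) (Set.Ioi 0), ∀ t ∈ T, ∀ k : Fin 2,
      t ∉ Set.Ioo (x k) (x k + δ) :=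
    (Filter.eventually_all_finset T).mpr fun t ht => Filter.eventually_all.mpr fun k => hev t ht k
  have hlt : ∀ᶠ δ in nhdsWithin (0 : ℝ) (Set.Ioi 0), δ < ε :=
    Filter.Eventually.filter_mono nhdsWithin_le_nhds (eventually_lt_nhds hε)
  obtain ⟨δ, ⟨hδ, hδε⟩, hδ0⟩ := ((hall.and hlt).and self_mem_nhdsWithin).exists
  replace hδ0 : 0 < δ := hδ0
  refine ⟨fun k => x k + δ, fun k => by simpa using hδ0, hball ?_, fun y hy => hball ?_, ?_⟩
  · rw [Metric.mem_ball, dist_pi_lt_iff hε]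
    intro k
    rw [Real.dist_eq, add_sub_cancel_left, abs_of_pos hδ0]
    exact hδε
  · rw [Metric.mem_ball, dist_pi_lt_iff hε]
    intro k
    have := mem_box.mp hy k
    rw [Real.dist_eq, abs_of_pos (sub_pos.mpr this.1)]
    linarith [this.2]
  · intro k t ht u _
    by_contra h0
    exact hδ t (hT k t u h0) k ht

/-- Bounds on the numbers of covering B-splines imply local linear independence. -/
theorem IsLR.locallyLinearIndependent {n : ℕ} {M : Mesh} {S : Set TBSpline}
    (h : IsLR (fun _ => n) M S)
    (hcard : ∀ c d : Fin 2 → ℝ, (∀ k, c k < d k) → (∀ k, M.lo k ≤ c k) → (∀ k, d k ≤ M.hi k) →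
      MeshFree M c d → {B ∈ S | Covers c d B}.ncard ≤ (n + 1) ^ 2) :
    LocallyLinearIndependent (fun _ => n) M S := by
  intro U hU hsub
  change LinearIndepOn ℝ (restrict (fun _ => n) U)
    {B | B ∈ S ∧ ∃ x ∈ U, B.eval (fun _ => n) x ≠ 0}
  rw [linearIndepOn_iff']
  intro s g hs hg B hBs
  obtain ⟨hBS, x, hxU, hx⟩ := hs hBs
  obtain ⟨T, N, hTN⟩ := h.exists_mult_bound
  obtain ⟨d, hxd, hdU, hbox, hV⟩ := exists_meshFree (fun k t u => (hTN k t u).2) hU hxU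
  have hlo := fun k => (hsub hxU).1 k
  have hhi := fun k => (hsub hdU).2 k
  have hli := (h.linearIndepOn_covers hxd hlo hhi hV (hcard x d hxd hlo hhi hV)).2
  -- Supports of the functions are half-open, closed on the left and below. A nonzero value at `x`
  -- therefore makes the support meet the rectangle to the upper right of `x`, and so cover it.
  have hcov : Covers x d B := by
    refine ((h.isOnMesh B hBS).covers hV hxd fun k => ?_).1
    have := (h.isOnMesh B hBS).isKnotted.mem_of_eval_ne_zero hx k
    exact ⟨this.1.trans_lt (hxd k), this.2⟩
  rw [linearIndepOn_iff'] at hli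
  -- On the small rectangle the relation reduces to the covering B-splines, which are independent
  -- there; thus the coefficient of `B` vanishes.
  refine hli (s.filter (Covers x d)) g ?_ ?_ B (Finset.mem_filter.mpr ⟨hBs, hcov⟩)
  · intro C hC
    rw [Finset.mem_coe, Finset.mem_filter] at hC
    exact ⟨(hs hC.1).1, hC.2⟩
  · have hzero : ∑ C ∈ s, g C • restrict (fun _ => n) (box x d) C = 0 := by
      funext y
      have := congrFun hg ⟨y.1, hbox y.2⟩
      simpa [Finset.sum_apply, restrict] using this
    rw [← hzero]
    refine Finset.sum_filter_of_ne fun C hC hne => ?_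
    by_contra hcon
    exact hne (by rw [(h.isOnMesh C (hs hC).1).restrict_eq_zero hV hxd hcon, smul_zero])

/-! ### Counting on the raised mesh and conclusion -/

/-- A raised B-spline has the support of its parent, so it covers the rectangle only if the parent
does. -/
theorem ncard_covers_iUnion_raised_le {S : Set TBSpline} {s : ℕ}
    (hS : ∀ B ∈ S, B.IsKnotted fun _ => 2 * 0 + 1) {c d : Fin 2 → ℝ}
    (hfin : {B ∈ S | Covers c d B}.Finite) :
    {B ∈ ⋃ B ∈ S, raised s B | Covers c d B}.ncard ≤
      {B ∈ S | Covers c d B}.ncard * (s + 1) ^ 2 := by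
  have hsub : {B ∈ ⋃ B ∈ S, raised s B | Covers c d B} ⊆ ⋃ B ∈ hfin.toFinset, raised s B := by
    rintro C ⟨hC, hcov⟩
    simp only [Set.mem_iUnion, exists_prop] at hC
    obtain ⟨B, hB, hC⟩ := hC
    obtain ⟨e₁, e₂⟩ := ends_of_mem_raised (hS B hB) hC
    rw [Covers, e₁, e₂] at hcov
    simp only [Set.mem_iUnion, exists_prop, Set.Finite.mem_toFinset]
    exact ⟨B, ⟨hB, hcov⟩, hC⟩
  have hmem : ∀ B ∈ hfin.toFinset, B ∈ S := fun B hB => ((Set.Finite.mem_toFinset hfin).mp hB).1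
  have hf : (⋃ B ∈ hfin.toFinset, raised s B).Finite :=
    hfin.toFinset.finite_toSet.biUnion fun B hB => (ncard_raised_le s (hS B (hmem B hB))).1
  refine (Set.ncard_le_ncard hsub hf).trans ?_
  refine (Finset.set_ncard_biUnion_le _ _).trans ?_
  refine (Finset.sum_le_card_nsmul _ _ _ fun B hB =>
    (ncard_raised_le s (hS B (hmem B hB))).2).trans ?_
  rw [smul_eq_mul, Set.ncard_eq_toFinset_card _ hfin]

section Admissible

variable {M : Mesh} {s : ℕ}

theorem Admissible.mult_le_one (hM : Admissible 0 M) (k : Fin 2) (t u : ℝ) (h₁ : M.lo k < t)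
    (h₂ : t < M.hi k) : M.mult k t u ≤ 1 := by
  by_cases h0 : M.mult k t u = 0
  · rw [h0]; exact Nat.zero_le _
  · exact (hM.internal k t u h₁ h₂ h0).le

theorem meshFree_raise {c d : Fin 2 → ℝ} : MeshFree (M.raise s) c d ↔ MeshFree M c d := by
  have : ∀ k t u, (M.raise s).mult k t u = 0 ↔ M.mult k t u = 0 := fun k t u => by
    simp only [← Nat.le_zero, ← not_lt, raise_mult_pos]
  simp only [MeshFree, this]

/-- Raising keeps the positions of the meshlines, so the rectangle is also free of lines in `M`. The
bound `(1 + 1) ^ 2` there is multiplied by `(s + 1) ^ 2`. -/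
theorem Admissible.ncard_covers_raise_le (hM : Admissible 0 M) {S : Set TBSpline}
    (hS : IsLR (fun _ => 2 * s + 1) (M.raise s) S) {c d : Fin 2 → ℝ} (hcd : ∀ k, c k < d k)
    (hlo : ∀ k, M.lo k ≤ c k) (hhi : ∀ k, d k ≤ M.hi k) (hV : MeshFree (M.raise s) c d) :
    {B ∈ S | Covers c d B}.ncard ≤ (2 * s + 1 + 1) ^ 2 := by
  obtain ⟨S₀, hS₀⟩ := hM.isLR
  have h := (hM.locallyLinearIndependent S₀ hS₀).ncard_covers_le hS₀.isOnMesh hcd hlo hhi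
    (meshFree_raise.mp hV)
  rw [hS₀.eq_iUnion_raised hM.mult_le_one hS]
  refine (ncard_covers_iUnion_raised_le (fun B hB => (hS₀.isOnMesh B hB).isKnotted) h.1).trans ?_
  refine (Nat.mul_le_mul_right _ h.2).trans (le_of_eq (by ring))

theorem Admissible.raise (hM : Admissible 0 M) (s : ℕ) : Admissible s (M.raise s) where
  isLR := by
    obtain ⟨S, hS⟩ := hM.isLR
    exact hS.exists_raise hM.mult_le_one s
  internal k t u h₁ h₂ h0 := by
    have h := raise_mult_of_internal (s := s) hM.mult_le_one u h₁ h₂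
    rw [h] at h0 ⊢
    rw [hM.internal k t u h₁ h₂ (right_ne_zero_of_mul h0)]
    ring
  boundary k t u ht hu := by
    have h : M.mult k t u = 2 := hM.boundary k t u ht hu
    have ht' : t = M.lo k ∨ t = M.hi k := ht
    simp only [Mesh.raise, h, if_pos ht']
    rw [if_neg (by norm_num)]
    ring
  locallyLinearIndependent S hS :=
    hS.locallyLinearIndependent fun c d hcd hlo hhi hV =>
      hM.ncard_covers_raise_le hS hcd hlo hhi hV

end Admissible

end LR
end

theorem proposition1 (s : ℕ) (M : LR.Mesh) (hM : LR.Admissible 0 M) :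
    LR.Admissible s (M.raise s) ∧
      ∀ S : Set LR.TBSpline, LR.IsLR (fun _ => 2 * s + 1) (M.raise s) S →
        ∀ c d : Fin 2 → ℝ, LR.IsCell (M.raise s) c d →
          {B ∈ S | Set.Icc c d ⊆ B.supp}.ncard = 4 * (s + 1) ^ 2 ∧
            4 * (s + 1) ^ 2 = ((2 * s + 1) + 1) ^ 2 := by
  refine ⟨hM.raise s, fun S hS c d hcell => ?_⟩
  have he : 4 * (s + 1) ^ 2 = ((2 * s + 1) + 1) ^ 2 := by ring
  refine ⟨?_, he⟩
  -- A cell is in particular a rectangle without meshlines in its interior, so the upper bound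
  -- forces the exact count.
  have h := (hS.linearIndepOn_covers hcell.lt hcell.lo_le hcell.le_hi hcell.inside
    (hM.ncard_covers_raise_le hS hcell.lt hcell.lo_le hcell.le_hi hcell.inside)).1
  rw [he, ← h]
  simp only [LR.covers_iff hcell.lt]
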